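/- Let $\Bbbk$ be a field of characteristic zero, let $\mathscr P$ be one of the operads $\mathscr Ass$, $\mathscr Com$, $\mathscr Lie$, and let $\mathscr P^!$ be its Koszul dual. Let $H$ be a $\mathbb Z$-graded $\Bbbk$-vector space. A $\mathscr P_\infty$-algebra is an $A_\infty$-, $C_\infty$- or $L_\infty$-algebra respectively, with operations $m_n$ ($n\ge 1$) of homological degree $n-2$; a morphism $\phi=(\phi_n)_{n\ge1}$ of $\mathscr P_\infty$-algebras (with $\phi_n$ of degree $n-1$) is a quasi-isomorphism if $\phi_1$ induces an isomorphism on homology with respect to $m_1$, and a $\mathscr P_\infty$-algebra is called quasi-isomorphic to another one if there is a $\mathscr P_\infty$-quasi-isomorphism from the first to the second. Let $\mathcal H=(H,0,m_2)$ be a dg $\mathscr P$-algebra with zero differential (i.e. a graded associative, graded commutative associative, or graded Lie algebra), regarded as the $\mathscr P_\infty$-algebra $(H,0,m_2,0,0,\dots)$. Let $C^{*}_{\mathscr P}(\mathcal H)$ be its operadic (Hochschild, Harrison or Chevalley–Eilenberg) cochain complex with coefficients in $\mathcal H$, with differential $\partial_{\mathscr P}$; $C^{n,p}_{\mathscr P}(\mathcal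 H)$, $n\ge1$, consists of the elements of $\mathrm{Hom}(\mathscr P^!(n)\otimes_{S_n}H^{\otimes n},H)$ of homological degree $p$, and $\partial_{\mathscr P}$ maps $C^{n,p}_{\mathscr P}(\mathcal H)$ to $C^{n+1,p}_{\mathscr P}(\mathcal H)$. Let $k\ge 3$ and let $H_\alpha=(H,0,m_2,0,\dots,0,m_k,m_{k+1},\dots)$ be a $\mathscr P_\infty$-algebra on $H$ with $m_1=0$, with the given $m_2$, and with $m_n=0$ for $3\le n<k$. (a) If $H_\alpha$ is quasi-isomorphic to $\mathcal H$, then $m_k$ is a coboundary in $C^*_{\mathscr P}(\mathcal H)$: there is $\phi_{k-1}\in C^{k-1,k-2}_{\mathscr P}(\mathcal H)$ with $m_k=\partial_{\mathscr P}(\phi_{k-1})$. (b) Conversely, if $m_k=\partial_{\mathscr P}(\phi_{k-1})$ for some $\phi_{k-1}\in C^{k-1,k-2}_{\mathscr P}(\mathcal H)$, then $H_\alpha$ is quasi-isomorphic to some $\mathscr P_\infty$-algebra of the form $H_\beta=(H,0,m_2,0,\dots,0,m'_{k+1},m'_{k+2},\dots)$, i.e. with the same underlying graded vector space $H$, with $m'_1=0$,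 $m'_2=m_2$ and $m'_n=0$ for $3\le n\le k$. -/

import Mathlib

noncomputable section

namespace MinimalPInfinity

/-- The three operads under consideration. -/
inductive OperadKind
  | ass
  | com
  | lie

/-- The sign `(-1)^e`, as a scalar. -/
def sg (K : Type*) [Ring K] (e : ℤ) : K := ((Int.negOnePow e : ℤˣ) : ℤ)

/-- The sign `γ(σ; x)` for passing from `x₀ ⊗ ⋯ ⊗ xₙ₋₁` to `x_{σ 0} ⊗ ⋯ ⊗ x_{σ (n-1)}`, where
`x i` has degree `d i`: the sign of the permutation times its Koszul sign (a factor
`(-1)^{|x||y|}` for each pair `x, y` whose order is reversed). -/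
def gammaSign (K : Type*) [CommRing K] {n : ℕ} (σ : Equiv.Perm (Fin n)) (d : Fin n → ℤ) : K :=
  ((Equiv.Perm.sign σ : ℤ) : K) *
    ∏ ij : Fin n × Fin n,
      if ij.1 < ij.2 ∧ σ ij.2 < σ ij.1 then sg K (d (σ ij.1) * d (σ ij.2)) else 1

/-- A finite tuple, extended by zero to a sequence. -/
def toSeq {M : Type*} [Zero M] {n : ℕ} (x : Fin n → M) (i : ℕ) : M :=
  if h : i < n then x ⟨i, h⟩ else 0

/-- The sequence `y₀, …, y_{r-1}, g(y_r, …, y_{r+s-1}), y_{r+s}, …`. -/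
def insertArg {M : Type*} (r : ℕ) {s : ℕ} (g : (Fin s → M) → M) (y : ℕ → M) (i : ℕ) : M :=
  if i < r then y i else if i = r then g (fun j => y (r + j)) else y (i + s - 1)

theorem toSeq_update {M : Type*} [Zero M] {n : ℕ} [DecidableEq (Fin n)]
    (x : Fin n → M) (j : Fin n) (a : M) :
    toSeq (Function.update x j a) = Function.update (toSeq x) (j : ℕ) a := by
  funext i
  by_cases hi : i = (j : ℕ)
  · subst hi
    simp [toSeq]
  · rw [Function.update_of_ne hi]
    unfold toSeq
    split_ifs with h
    · rw [Function.update_of_ne]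
      intro h'
      exact hi (by rw [← h'])
    · rfl

section Multilinear

variable {K H : Type*} [Field K] [AddCommGroup H] [Module K H]

theorem insertArg_update {a s : ℕ} (g : MultilinearMap K (fun _ : Fin s => H) H)
    (r : ℕ) (hr : r < a) (y : ℕ → H) (j : ℕ) (hj : j + 1 < a + s) :
    (∃ k : Fin a, ∀ b : H, (fun i : Fin a => insertArg r g (Function.update y j b) i) =
      Function.update (fun i : Fin a => insertArg r g y i) k b) ∨
    (∃ k : Fin a, ∃ l : Fin s, ∀ b : H,
      (fun i : Fin a => insertArg r g (Function.update y j b) i) =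
      Function.update (fun i : Fin a => insertArg r g y i) k
        (g (Function.update (fun i : Fin s => y (r + i)) l b))) := by
  by_cases h1 : j < r
  · left
    refine ⟨⟨j, by omega⟩, fun b => funext fun i => ?_⟩
    by_cases hi : i = ⟨j, by omega⟩
    · subst hi
      simp [insertArg, h1]
    · have hij : (i : ℕ) ≠ j := fun h => hi (Fin.ext h)
      rw [Function.update_of_ne hi]
      unfold insertArg
      split_ifs with h2 h3
      · rw [Function.update_of_ne hij]
      · congr 1
        funext l
        rw [Function.update_of_ne (by omega)]
      · rw [Function.update_of_ne (by omega)]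
  · by_cases h2 : j < r + s
    · right
      refine ⟨⟨r, hr⟩, ⟨j - r, by omega⟩, fun b => funext fun i => ?_⟩
      by_cases hi : i = ⟨r, hr⟩
      · subst hi
        simp only [insertArg, lt_irrefl, if_false, if_true, Function.update_self]
        congr 1
        funext l
        by_cases hl : l = ⟨j - r, by omega⟩
        · subst hl
          rw [Function.update_self]
          have : r + (j - r) = j := by omega
          simp [this]
        · have : (l : ℕ) ≠ j - r := fun h => hl (Fin.ext h)
          rw [Function.update_of_ne hl, Function.update_of_ne (by omega)]
      · have hir : (i : ℕ) ≠ r := fun h => hi (Fin.ext h)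
        rw [Function.update_of_ne hi]
        unfold insertArg
        split_ifs with h3
        · rw [Function.update_of_ne (by omega)]
        · rw [Function.update_of_ne (by omega)]
    · left
      refine ⟨⟨j + 1 - s, by omega⟩, fun b => funext fun i => ?_⟩
      by_cases hi : i = ⟨j + 1 - s, by omega⟩
      · subst hi
        have e1 : ¬ (j + 1 - s < r) := by omega
        have e2 : ¬ (j + 1 - s = r) := by omega
        have e3 : j + 1 - s + s - 1 = j := by omega
        simp [insertArg, e1, e2, e3]
      · have hij : (i : ℕ) ≠ j + 1 - s := fun h => hi (Fin.ext h)
        rw [Function.update_of_ne hi]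
        unfold insertArg
        split_ifs with h3 h4
        · rw [Function.update_of_ne (by omega)]
        · congr 1
          funext l
          rw [Function.update_of_ne (by omega)]
        · rw [Function.update_of_ne (by omega)]

/-- The unsigned partial composite
`f(x₀, …, x_{r-1}, g(x_r, …, x_{r+s-1}), x_{r+s}, …, x_{N-1})`. -/
def partialComp {a s : ℕ} (f : MultilinearMap K (fun _ : Fin a => H) H)
    (g : MultilinearMap K (fun _ : Fin s => H) H) (r N : ℕ) (hN : N + 1 = a + s) (hr : r < a) :
    MultilinearMap K (fun _ : Fin N => H) H where
  toFun x := f (fun i => insertArg r g (toSeq x) i)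
  map_update_add' x j u v := by
    simp only [toSeq_update]
    rcases insertArg_update g r hr (toSeq x) j (by omega) with ⟨k, h⟩ | ⟨k, l, h⟩
    · rw [h, h, h, f.map_update_add]
    · rw [h, h, h, g.map_update_add, f.map_update_add]
  map_update_smul' x j c u := by
    simp only [toSeq_update]
    rcases insertArg_update g r hr (toSeq x) j (by omega) with ⟨k, h⟩ | ⟨k, l, h⟩
    · rw [h, h, f.map_update_smul]
    · rw [h, h, g.map_update_smul, f.map_update_smul]

/-- The multilinear map that agrees with `F d` on homogeneous arguments of degrees
`d 0, …, d (n-1)`. -/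
def glue (𝒢 : ℤ → Submodule K H) [DirectSum.Decomposition 𝒢] {n : ℕ}
    (F : (Fin n → ℤ) → MultilinearMap K (fun _ : Fin n => H) H) :
    MultilinearMap K (fun _ : Fin n => H) H :=
  (MultilinearMap.fromDirectSumEquiv (κ := fun _ : Fin n => ℤ)
      (M := fun (_ : Fin n) (j : ℤ) => 𝒢 j) (R := K) (M' := H)
      (fun d => (F d).compLinearMap (fun i => (𝒢 (d i)).subtype))).compLinearMap
    (fun _ => (DirectSum.decomposeLinearEquiv 𝒢).toLinearMap)

theorem glue_apply (𝒢 : ℤ → Submodule K H) [DirectSum.Decomposition 𝒢] {n : ℕ}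
    (F : (Fin n → ℤ) → MultilinearMap K (fun _ : Fin n => H) H)
    (d : Fin n → ℤ) (x : Fin n → H) (hx : ∀ i, x i ∈ 𝒢 (d i)) :
    glue 𝒢 F x = F d x := by
  have key : (fun i => (DirectSum.decomposeLinearEquiv 𝒢).toLinearMap (x i)) =
      fun i => DirectSum.lof K ℤ (fun j => 𝒢 j) (d i) ⟨x i, hx i⟩ := by
    funext i
    exact DirectSum.decompose_of_mem 𝒢 (hx i)
  unfold glue
  rw [MultilinearMap.compLinearMap_apply, key]
  exact (MultilinearMap.fromDirectSumEquiv_lof (κ := fun _ : Fin n => ℤ)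
    (M := fun (_ : Fin n) (j : ℤ) => 𝒢 j) _ d (fun i => ⟨x i, hx i⟩)).trans rfl

end Multilinear

section Cochains

variable {K H H' : Type*} [Field K] [AddCommGroup H] [Module K H] [AddCommGroup H'] [Module K H']

/-- The elements of `Hom(P^!(n) ⊗_{S_n} H^{⊗n}, H')` of homological degree `p`, as multilinear maps:
for `Ass` all multilinear maps, for `Com` those that vanish on all signed shuffle products, for
`Lie` the graded antisymmetric ones. There are none but zero for `n = 0`. -/
structure IsCochain (P : OperadKind) (𝒢 : ℤ → Submodule K H) (𝒢' : ℤ → Submodule K H')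
    {n : ℕ} (p : ℤ) (f : MultilinearMap K (fun _ : Fin n => H) H') : Prop where
  eq_zero : n = 0 → f = 0
  degree : ∀ (d : Fin n → ℤ) (x : Fin n → H), (∀ i, x i ∈ 𝒢 (d i)) → f x ∈ 𝒢' (∑ i, d i + p)
  shuffle : P = .com → ∀ q : ℕ, 0 < q → q < n →
    ∀ (d : Fin n → ℤ) (x : Fin n → H), (∀ i, x i ∈ 𝒢 (d i)) →
      ∑ σ : Equiv.Perm (Fin n) with ∀ i j : Fin n, i < j → ((j : ℕ) < q ∨ q ≤ (i : ℕ)) → σ i < σ j,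
        gammaSign K σ⁻¹ d • f (fun i => x (σ⁻¹ i)) = 0
  antisymm : P = .lie → ∀ (σ : Equiv.Perm (Fin n)) (d : Fin n → ℤ) (x : Fin n → H),
    (∀ i, x i ∈ 𝒢 (d i)) → gammaSign K σ d • f (fun i => x (σ i)) = f x

end Cochains

section Structures

variable {K H H' : Type*} [Field K] [AddCommGroup H] [Module K H] [AddCommGroup H'] [Module K H']

/-- `∑_{r+s+t=n} (-1)^{r+st} f_{r+1+t} ∘ (id^{⊗r} ⊗ m_s ⊗ id^{⊗t})`, evaluated on homogeneous
`x₀, …, xₙ₋₁` of degrees `d`; the Koszul rule contributes `(-1)^{(s-2)(|x₀|+⋯+|x_{r-1}|)}`. -/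
def innerSumAss (m : (n : ℕ) → MultilinearMap K (fun _ : Fin n => H) H)
    (f : (n : ℕ) → MultilinearMap K (fun _ : Fin n => H) H')
    {n : ℕ} (d : Fin n → ℤ) (x : Fin n → H) : H' :=
  ∑ s ∈ Finset.Icc 1 n, ∑ r ∈ Finset.range (n - s + 1),
    sg K ((r : ℤ) + s * ((n - s - r : ℕ) : ℤ) + ((s : ℤ) - 2) * ∑ i ∈ Finset.range r, toSeq d i) •
      f (n - s + 1) (fun i => insertArg r (m s) (toSeq x) i)

/-- `∑_{s+t=n} ∑_σ (-1)^{st} γ(σ) f_{1+t}(m_s(x_{σ 0}, …, x_{σ (s-1)}), x_{σ s}, …, x_{σ (n-1)})`,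
where `σ` runs over the `(s,t)`-unshuffles; by antisymmetry this is the sum over all permutations
divided by `s! t!`. -/
def innerSumLie (m : (n : ℕ) → MultilinearMap K (fun _ : Fin n => H) H)
    (f : (n : ℕ) → MultilinearMap K (fun _ : Fin n => H) H')
    {n : ℕ} (d : Fin n → ℤ) (x : Fin n → H) : H' :=
  ∑ s ∈ Finset.Icc 1 n, ((s.factorial * (n - s).factorial : ℕ) : K)⁻¹ •
    ∑ σ : Equiv.Perm (Fin n), (gammaSign K σ d * sg K (s * ((n - s : ℕ) : ℤ))) •
      f (n - s + 1) (fun i => insertArg 0 (m s) (toSeq (fun j => x (σ j))) i)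

/-- The left-hand side of the structure equations (`f = m`) and of the morphism equations. -/
def innerSum (P : OperadKind) (m : (n : ℕ) → MultilinearMap K (fun _ : Fin n => H) H)
    (f : (n : ℕ) → MultilinearMap K (fun _ : Fin n => H) H')
    {n : ℕ} (d : Fin n → ℤ) (x : Fin n → H) : H' :=
  match P with
  | .ass => innerSumAss m f d x
  | .com => innerSumAss m f d x
  | .lie => innerSumLie m f d x

/-- `(-1)^ε m_k ∘ (f_{i_1} ⊗ ⋯ ⊗ f_{i_k})` for a composition `n = i_1 + ⋯ + i_k`, evaluated on
homogeneous `x₀, …, xₙ₋₁` of degrees `d`. Here `ε = ∑_j (k - j)(i_j - 1)`, and the Koszul rule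
contributes `(i_j - 1)` times the degree of all arguments in front of the `j`-th block. -/
def outerTerm (m : (n : ℕ) → MultilinearMap K (fun _ : Fin n => H') H')
    (f : (n : ℕ) → MultilinearMap K (fun _ : Fin n => H) H')
    {n : ℕ} (c : Composition n) (d : Fin n → ℤ) (x : Fin n → H) : H' :=
  sg K (∑ j : Fin c.length, ((c.blocksFun j : ℤ) - 1) *
      ((c.length : ℤ) - 1 - j + ∑ i ∈ Finset.range (c.sizeUpTo j), toSeq d i)) •
    m c.length (fun j => f (c.blocksFun j) (fun i => x (c.embedding j i)))

/-- The right-hand side of the morphism equations: `∑ ± m_k(f_{i_1} ⊗ ⋯ ⊗ f_{i_k})` over all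
compositions of `n`, respectively its antisymmetrization (over unordered families of blocks, which
accounts for the factor `1 / (k! i_1! ⋯ i_k!)`). -/
def outerSum (P : OperadKind) (m : (n : ℕ) → MultilinearMap K (fun _ : Fin n => H') H')
    (f : (n : ℕ) → MultilinearMap K (fun _ : Fin n => H) H')
    {n : ℕ} (d : Fin n → ℤ) (x : Fin n → H) : H' :=
  match P with
  | .ass => ∑ c : Composition n, outerTerm m f c d x
  | .com => ∑ c : Composition n, outerTerm m f c d x
  | .lie => ∑ c : Composition n,
      ((c.length.factorial * ∏ j, (c.blocksFun j).factorial : ℕ) : K)⁻¹ •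
        ∑ σ : Equiv.Perm (Fin n),
          gammaSign K σ d • outerTerm m f c (fun i => d (σ i)) (fun i => x (σ i))

/-- A `P_∞`-algebra structure on a graded vector space: an `A_∞`-, `C_∞`- or `L_∞`-algebra. -/
structure PInfAlgebra (P : OperadKind) (𝒢 : ℤ → Submodule K H) where
  op : (n : ℕ) → MultilinearMap K (fun _ : Fin n => H) H
  isCochain : ∀ n : ℕ, IsCochain P 𝒢 𝒢 ((n : ℤ) - 2) (op n)
  relation : ∀ (n : ℕ) (d : Fin n → ℤ) (x : Fin n → H), (∀ i, x i ∈ 𝒢 (d i)) →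
    innerSum P op op d x = 0

/-- A morphism of `P_∞`-algebras. -/
structure PInfMorphism {P : OperadKind} {𝒢 : ℤ → Submodule K H} {𝒢' : ℤ → Submodule K H'}
    (A : PInfAlgebra P 𝒢) (B : PInfAlgebra P 𝒢') where
  comp : (n : ℕ) → MultilinearMap K (fun _ : Fin n => H) H'
  isCochain : ∀ n : ℕ, IsCochain P 𝒢 𝒢' ((n : ℤ) - 1) (comp n)
  relation : ∀ (n : ℕ) (d : Fin n → ℤ) (x : Fin n → H), (∀ i, x i ∈ 𝒢 (d i)) →
    innerSum P A.op comp d x = outerSum P B.op comp d x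

/-- The linear part `(H, m_1) → (H', m'_1)` induces a bijection on homology. -/
structure PInfMorphism.IsQuasiIso {P : OperadKind} {𝒢 : ℤ → Submodule K H}
    {𝒢' : ℤ → Submodule K H'} {A : PInfAlgebra P 𝒢} {B : PInfAlgebra P 𝒢'}
    (φ : PInfMorphism A B) : Prop where
  injective : ∀ x : H, A.op 1 (fun _ => x) = 0 →
    (∃ y' : H', B.op 1 (fun _ => y') = φ.comp 1 (fun _ => x)) → ∃ y : H, A.op 1 (fun _ => y) = x
  surjective : ∀ x' : H', B.op 1 (fun _ => x') = 0 →
    ∃ x : H, A.op 1 (fun _ => x) = 0 ∧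
      ∃ y' : H', φ.comp 1 (fun _ => x) + B.op 1 (fun _ => y') = x'

/-- There is a `P_∞`-quasi-isomorphism from `A` to `B`. -/
def QuasiIsomorphic {P : OperadKind} {𝒢 : ℤ → Submodule K H} {𝒢' : ℤ → Submodule K H'}
    (A : PInfAlgebra P 𝒢) (B : PInfAlgebra P 𝒢') : Prop :=
  ∃ φ : PInfMorphism A B, φ.IsQuasiIso

/-- A dg `P`-algebra with zero differential: a graded associative, graded commutative (and
associative), or graded Lie algebra. -/
structure GradedAlgebra (P : OperadKind) (𝒢 : ℤ → Submodule K H) where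
  mul : MultilinearMap K (fun _ : Fin 2 => H) H
  degree : ∀ (a b : ℤ) (x y : H), x ∈ 𝒢 a → y ∈ 𝒢 b → mul ![x, y] ∈ 𝒢 (a + b)
  assoc : P = .ass ∨ P = .com → ∀ x y z : H, mul ![mul ![x, y], z] = mul ![x, mul ![y, z]]
  comm : P = .com → ∀ (a b : ℤ) (x y : H), x ∈ 𝒢 a → y ∈ 𝒢 b →
    mul ![x, y] = sg K (a * b) • mul ![y, x]
  antisymm : P = .lie → ∀ (a b : ℤ) (x y : H), x ∈ 𝒢 a → y ∈ 𝒢 b →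
    mul ![x, y] = - sg K (a * b) • mul ![y, x]
  jacobi : P = .lie → ∀ (a b c : ℤ) (x y z : H), x ∈ 𝒢 a → y ∈ 𝒢 b → z ∈ 𝒢 c →
    mul ![x, mul ![y, z]] = mul ![mul ![x, y], z] + sg K (a * b) • mul ![y, mul ![x, z]]

end Structures

section GradedAlgebras

variable {K H : Type*} [Field K] [AddCommGroup H] [Module K H]

/-- The family of operations `(0, m_2, 0, 0, …)`. -/
def binaryOps (μ : MultilinearMap K (fun _ : Fin 2 => H) H) :
    (n : ℕ) → MultilinearMap K (fun _ : Fin n => H) H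
  | 2 => μ
  | _ => 0

theorem binaryOps_of_ne (μ : MultilinearMap K (fun _ : Fin 2 => H) H) {n : ℕ} (h : n ≠ 2) :
    binaryOps μ n = 0 := by
  unfold binaryOps
  split
  · exact absurd rfl h
  · rfl

theorem sg_mul_self (e : ℤ) : sg K e * sg K e = 1 := by
  unfold sg
  rw [← Int.cast_mul, ← Units.val_mul, Int.units_mul_self]
  simp

theorem sg_add (a b : ℤ) : sg K (a + b) = sg K a * sg K b := by
  unfold sg
  rw [Int.negOnePow_add]
  push_cast
  rfl

theorem sg_eq (e : ℤ) : sg K e = 1 ∨ sg K e = -1 := by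
  unfold sg
  rcases Int.units_eq_one_or (Int.negOnePow e) with h | h <;> simp [h]

theorem perm_two (σ : Equiv.Perm (Fin 2)) : σ = 1 ∨ σ = Equiv.swap 0 1 := by
  revert σ
  decide

theorem gammaSign_one {n : ℕ} (d : Fin n → ℤ) : gammaSign K 1 d = 1 := by
  unfold gammaSign
  rw [Finset.prod_eq_one]
  · simp
  · intro ij _
    rw [if_neg]
    rintro ⟨h1, h2⟩
    exact absurd h1 (by simpa using h2.le)

theorem gammaSign_swap_two (d : Fin 2 → ℤ) :
    gammaSign K (Equiv.swap (0 : Fin 2) 1) d = - sg K (d 0 * d 1) := by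
  simp [gammaSign, Fintype.prod_prod_type, Fin.prod_univ_two, mul_comm]


theorem binary_term_eq_zero (μ : MultilinearMap K (fun _ : Fin 2 => H) H) {n s r : ℕ}
    (hs : s ≤ n) (hr : r < n - s + 1) (h : ¬ (n = 3 ∧ s = 2)) (y : ℕ → H) :
    binaryOps μ (n - s + 1) (fun i => insertArg r (binaryOps μ s) y i) = 0 := by
  by_cases h1 : n - s + 1 = 2
  · have h2 : s ≠ 2 := by omega
    apply MultilinearMap.map_coord_zero (i := ⟨r, hr⟩)
    simp [insertArg, binaryOps_of_ne μ h2]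
  · rw [binaryOps_of_ne μ h1]
    rfl

theorem innerSumAss_binary (μ : MultilinearMap K (fun _ : Fin 2 => H) H)
    (hμ : ∀ x y z : H, μ ![μ ![x, y], z] = μ ![x, μ ![y, z]])
    {n : ℕ} (d : Fin n → ℤ) (x : Fin n → H) :
    innerSumAss (binaryOps μ) (binaryOps μ) d x = 0 := by
  unfold innerSumAss
  by_cases hn : n = 3
  · subst hn
    rw [Finset.sum_eq_single 2]
    · have e0 : (fun i : Fin 2 => insertArg 0 (binaryOps μ 2) (toSeq x) i) =
          ![μ ![x 0, x 1], x 2] := by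
        have : (fun j : Fin 2 => toSeq x (0 + (j : ℕ))) = ![x 0, x 1] := by
          funext j; fin_cases j <;> rfl
        funext i
        fin_cases i
        · exact congrArg μ this
        · rfl
      have e1 : (fun i : Fin 2 => insertArg 1 (binaryOps μ 2) (toSeq x) i) =
          ![x 0, μ ![x 1, x 2]] := by
        have : (fun j : Fin 2 => toSeq x (1 + (j : ℕ))) = ![x 1, x 2] := by
          funext j; fin_cases j <;> rfl
        funext i
        fin_cases i
        · rfl
        · simp only [insertArg, binaryOps]
          simp [this]
      change ∑ r ∈ Finset.range 2, _ • μ (fun i => insertArg r (binaryOps μ 2) (toSeq x) i) = 0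
      rw [Finset.sum_range_succ, Finset.sum_range_one, e0, e1, hμ, ← add_smul]
      simp [sg]
    · intro s hs hs2
      simp only [Finset.mem_Icc] at hs
      refine Finset.sum_eq_zero fun r hr => ?_
      rw [binary_term_eq_zero μ hs.2 (Finset.mem_range.1 hr) (by omega), smul_zero]
    · intro h
      simp at h
  · refine Finset.sum_eq_zero fun s hs => Finset.sum_eq_zero fun r hr => ?_
    rw [binary_term_eq_zero μ (Finset.mem_Icc.1 hs).2 (Finset.mem_range.1 hr) (by omega), smul_zero]

theorem univ_perm_three : (Finset.univ : Finset (Equiv.Perm (Fin 3))) =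
    {1, Equiv.swap 0 1, Equiv.swap 0 2, Equiv.swap 1 2, Equiv.swap 0 1 * Equiv.swap 1 2,
      Equiv.swap 1 2 * Equiv.swap 0 1} := by
  decide

theorem innerSumLie_binary [CharZero K] {𝒢 : ℤ → Submodule K H} (A : GradedAlgebra .lie 𝒢)
    {n : ℕ} (d : Fin n → ℤ) (x : Fin n → H) (hx : ∀ i, x i ∈ 𝒢 (d i)) :
    innerSumLie (binaryOps A.mul) (binaryOps A.mul) d x = 0 := by
  unfold innerSumLie
  by_cases hn : n = 3
  · subst hn
    rw [Finset.sum_eq_single 2]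
    · have e0 : ∀ y : Fin 3 → H, binaryOps A.mul (3 - 2 + 1)
          (fun i => insertArg 0 (binaryOps A.mul 2) (toSeq y) i) =
          A.mul ![A.mul ![y 0, y 1], y 2] := by
        intro y
        change A.mul (fun i : Fin 2 => insertArg 0 (binaryOps A.mul 2) (toSeq y) i) = _
        congr 1
        have : (fun j : Fin 2 => toSeq y (0 + (j : ℕ))) = ![y 0, y 1] := by
          funext j; fin_cases j <;> rfl
        funext i
        fin_cases i
        · exact congrArg A.mul this
        · rfl
      simp only [e0]
      have s01 : (Equiv.swap (0 : Fin 3) 1) 2 = 2 := by decide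
      have s02 : (Equiv.swap (0 : Fin 3) 2) 1 = 1 := by decide
      have s12 : (Equiv.swap (1 : Fin 3) 2) 0 = 0 := by decide
      have h01 := A.antisymm rfl _ _ _ _ (hx 1) (hx 0)
      have h02 := A.antisymm rfl _ _ _ _ (hx 2) (hx 0)
      have h12 := A.antisymm rfl _ _ _ _ (hx 2) (hx 1)
      have k0 := A.antisymm rfl _ _ _ _ (hx 0) (A.degree _ _ _ _ (hx 1) (hx 2))
      have k1 := A.antisymm rfl _ _ _ _ (hx 1) (A.degree _ _ _ _ (hx 0) (hx 2))
      have J := A.jacobi rfl _ _ _ _ _ _ (hx 0) (hx 1) (hx 2)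
      have lin : ∀ (c : K) (u v : H), A.mul ![c • u, v] = c • A.mul ![u, v] := by
        intro c u v
        have e : ∀ w : H, Function.update ![u, v] 0 w = ![w, v] := fun w => by
          funext i; fin_cases i <;> rfl
        have := A.mul.map_update_smul ![u, v] 0 c u
        rwa [e, e] at this
      rw [univ_perm_three, Finset.sum_insert (by decide), Finset.sum_insert (by decide),
        Finset.sum_insert (by decide), Finset.sum_insert (by decide), Finset.sum_pair (by decide)]
      simp [gammaSign, Fintype.prod_prod_type, Fin.prod_univ_three, s01, s02, s12, h01, h02, h12,
        -neg_smul, lin]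
      rw [k0, k1] at J
      simp only [mul_add, sg_add] at J
      rw [mul_comm (d 1) (d 0)] at J ⊢
      rw [mul_comm (d 2) (d 0), mul_comm (d 2) (d 1)]
      have e2 : sg K 2 = 1 := by simp [sg]
      rw [e2]
      generalize A.mul ![A.mul ![x 0, x 1], x 2] = u at J ⊢
      generalize A.mul ![A.mul ![x 1, x 2], x 0] = v at J ⊢
      generalize A.mul ![A.mul ![x 0, x 2], x 1] = w at J ⊢
      rcases sg_eq (K := K) (d 0 * d 1) with h1 | h1 <;>
      rcases sg_eq (K := K) (d 0 * d 2) with h2 | h2 <;>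
      rcases sg_eq (K := K) (d 1 * d 2) with h3 | h3 <;>
      (rw [h1, h2, h3] at J
       rw [h1, h2, h3]
       first
         | exact Eq.trans (by module) (sub_eq_zero.2 J)
         | exact Eq.trans (by module) (sub_eq_zero.2 J.symm))
    · intro s hs hs2
      simp only [Finset.mem_Icc] at hs
      rw [Finset.sum_eq_zero, smul_zero]
      intro σ _
      rw [binary_term_eq_zero A.mul hs.2 (by omega) (by omega), smul_zero]
    · intro h
      simp at h
  · refine Finset.sum_eq_zero fun s hs => ?_
    rw [Finset.sum_eq_zero, smul_zero]
    intro σ _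
    rw [binary_term_eq_zero A.mul (Finset.mem_Icc.1 hs).2 (by omega) (by omega), smul_zero]

theorem isCochain_binaryOps {P : OperadKind} {𝒢 : ℤ → Submodule K H} (A : GradedAlgebra P 𝒢)
    (n : ℕ) : IsCochain P 𝒢 𝒢 ((n : ℤ) - 2) (binaryOps A.mul n) := by
  have vec : ∀ y : Fin 2 → H, y = ![y 0, y 1] := fun y => by
    funext i; fin_cases i <;> rfl
  by_cases hn : n = 2
  · subst hn
    change IsCochain P 𝒢 𝒢 _ A.mul
    refine ⟨fun h => absurd h (by norm_num), ?_, ?_, ?_⟩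
    · intro d x hx
      rw [vec x]
      simpa [Fin.sum_univ_two] using A.degree _ _ _ _ (hx 0) (hx 1)
    · intro hP q hq hq2 d x hx
      have hq1 : q = 1 := by omega
      subst hq1
      have hu : (Finset.univ.filter fun σ : Equiv.Perm (Fin 2) => ∀ i j : Fin 2, i < j →
          ((j : ℕ) < 1 ∨ 1 ≤ (i : ℕ)) → σ i < σ j) = {1, Equiv.swap 0 1} := by
        decide
      rw [hu, Finset.sum_pair (by decide)]
      rw [inv_one, Equiv.swap_inv, gammaSign_one, gammaSign_swap_two, one_smul,
        vec (fun i => x ((1 : Equiv.Perm (Fin 2)) i)), vec (fun i => x (Equiv.swap 0 1 i))]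
      simp only [Equiv.Perm.coe_one, id_eq, Equiv.swap_apply_left, Equiv.swap_apply_right]
      rw [A.comm hP _ _ _ _ (hx 0) (hx 1), neg_smul, add_neg_cancel]
    · intro hP σ d x hx
      rcases perm_two σ with rfl | rfl
      · rw [gammaSign_one, one_smul]
        rfl
      · rw [gammaSign_swap_two, vec (fun i => x (Equiv.swap 0 1 i)), vec x]
        simp only [Equiv.swap_apply_left, Equiv.swap_apply_right]
        rw [A.antisymm hP _ _ _ _ (hx 0) (hx 1)]
        simp
  · rw [binaryOps_of_ne A.mul hn]
    refine ⟨fun _ => rfl, fun _ _ _ => Submodule.zero_mem _, fun _ _ _ _ _ _ _ => ?_,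
      fun _ _ _ _ _ => ?_⟩ <;> simp

/-- A graded `P`-algebra `(H, 0, m_2)`, regarded as the `P_∞`-algebra `(H, 0, m_2, 0, 0, …)`. -/
def GradedAlgebra.toPInf [CharZero K] {P : OperadKind} {𝒢 : ℤ → Submodule K H}
    (A : GradedAlgebra P 𝒢) :
    PInfAlgebra P 𝒢 where
  op := binaryOps A.mul
  isCochain := isCochain_binaryOps A
  relation n d x hx := by
    cases P with
    | ass => exact innerSumAss_binary _ (A.assoc (Or.inl rfl)) d x
    | com => exact innerSumAss_binary _ (A.assoc (Or.inr rfl)) d x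
    | lie => exact innerSumLie_binary A d x hx

end GradedAlgebras

section Differential

variable {K H : Type*} [Field K] [AddCommGroup H] [Module K H]

/-- The Hochschild coboundary of `φ : H^{⊗(n+1)} → H` of homological degree `p`, on homogeneous
`x₀, …, x_{n+1}` of degrees `d`:
`(-1)^{p|x₀|} x₀ φ(x₁, …) + ∑ᵢ (-1)^{i+1} φ(…, xᵢ xᵢ₊₁, …) + (-1)^{n+2} φ(x₀, …, xₙ) xₙ₊₁`. -/
def differentialAss (μ : MultilinearMap K (fun _ : Fin 2 => H) H) {n : ℕ} (p : ℤ)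
    (φ : MultilinearMap K (fun _ : Fin (n + 1) => H) H) (d : Fin (n + 2) → ℤ) :
    MultilinearMap K (fun _ : Fin (n + 2) => H) H :=
  sg K (p * d 0) • partialComp μ φ 1 (n + 2) (by omega) (by omega) +
    ∑ i : Fin (n + 1), sg K ((i : ℤ) + 1) • partialComp φ μ i (n + 2) (by omega) i.isLt +
    sg K ((n : ℤ) + 2) • partialComp μ φ 0 (n + 2) (by omega) (by omega)

/-- The Chevalley-Eilenberg coboundary of `φ : Λ^{n+1} H → H` of homological degree `p`, on
homogeneous `x₀, …, x_{n+1}` of degrees `d`: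
`∑_σ ± (-1)^{p|x_{σ 0}|} [x_{σ 0}, φ(x_{σ 1}, …)] - ∑_σ ± φ([x_{σ 0}, x_{σ 1}], x_{σ 2}, …)` over
the `(1,n+1)`- and the `(2,n)`-unshuffles, written as sums over all permutations. -/
def differentialLie (μ : MultilinearMap K (fun _ : Fin 2 => H) H) {n : ℕ} (p : ℤ)
    (φ : MultilinearMap K (fun _ : Fin (n + 1) => H) H) (d : Fin (n + 2) → ℤ) :
    MultilinearMap K (fun _ : Fin (n + 2) => H) H :=
  (((n + 1).factorial : ℕ) : K)⁻¹ • (∑ σ : Equiv.Perm (Fin (n + 2)),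
      (gammaSign K σ d * sg K (p * d (σ 0))) •
        (partialComp μ φ 1 (n + 2) (by omega) (by omega)).domDomCongr σ) -
    ((2 * n.factorial : ℕ) : K)⁻¹ • (∑ σ : Equiv.Perm (Fin (n + 2)),
      gammaSign K σ d • (partialComp φ μ 0 (n + 2) (by omega) (by omega)).domDomCongr σ)

/-- The differential `∂ : C^{n+1,p}_P(H, 0, m_2) → C^{n+2,p}_P(H, 0, m_2)` of the operadic cochain
complex: Hochschild, Harrison (its restriction to cochains vanishing on shuffles), or
Chevalley-Eilenberg. -/
def GradedAlgebra.differential {P : OperadKind} {𝒢 : ℤ → Submodule K H}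
    [DirectSum.Decomposition 𝒢] (A : GradedAlgebra P 𝒢) {n : ℕ} (p : ℤ)
    (φ : MultilinearMap K (fun _ : Fin (n + 1) => H) H) :
    MultilinearMap K (fun _ : Fin (n + 2) => H) H :=
  match P with
  | .ass => glue 𝒢 (differentialAss A.mul p φ)
  | .com => glue 𝒢 (differentialAss A.mul p φ)
  | .lie => glue 𝒢 (differentialLie A.mul p φ)

/-- `c` is a coboundary in `C^{n,p}_P(H, 0, m_2)`. As `C^0 = 0`, there is no coboundary but zero
for `n ≤ 1`. -/
def GradedAlgebra.IsCoboundary {P : OperadKind} {𝒢 : ℤ → Submodule K H}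
    [DirectSum.Decomposition 𝒢] (A : GradedAlgebra P 𝒢) (p : ℤ) :
    (n : ℕ) → MultilinearMap K (fun _ : Fin n => H) H → Prop
  | n + 2, c => ∃ φ : MultilinearMap K (fun _ : Fin (n + 1) => H) H,
      IsCochain P 𝒢 𝒢 p φ ∧ c = A.differential p φ
  | _, c => c = 0

/-- `M` has the form `(H, 0, m_2, 0, …, 0, m_k, m_{k+1}, …)`, with `m_2` the product of `A`. -/
structure PInfAlgebra.HasForm {P : OperadKind} {𝒢 : ℤ → Submodule K H} (M : PInfAlgebra P 𝒢)
    (A : GradedAlgebra P 𝒢) (k : ℕ) : Prop where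
  op_one : M.op 1 = 0
  op_two : M.op 2 = A.mul
  op_eq_zero : ∀ n, 3 ≤ n → n < k → M.op n = 0

end Differential

end MinimalPInfinity

end

noncomputable section

namespace MinimalPInfinity

open TensorProduct

/-! ### The tensor coalgebra on a free module -/

/-! Suspend `H` and choose a homogeneous basis indexed by `I`, so that a basis vector of degree `d`
becomes a letter of degree `d + 1`. On the tensor coalgebra `Tens K I` a family of operations
becomes a linear map to letters (`bar`, with inverse `unbar`). A structure becomes a coderivation of
degree -1 (`hat`), a morphism becomes a coalgebra map of degree 0 (`lift`), and all signs become
Koszul signs. Both kinds of maps are determined by their corestriction to letters.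

The three operads are treated together. For `Lie` every identity is restricted to symmetric tensors,
the image of the projection `symProj`; `IsSym` axiomatizes what is needed of it. For `Com` the
corestrictions have to vanish on signed shuffles, which makes the coderivations derivations, and the
coalgebra maps multiplicative, for the shuffle product (`IsCoder.apply_sh`, `IsCohom.apply_sh`). For
`Ass` nothing more is required. The operadic differential of a cochain with corestriction `ψ` is the
commutator `β ∘ hat ψ - ψ ∘ hat β₂`, where `β₂` is the binary part of the structure
(`repr_differential`).

Part (a) uses an Euler operator. Let `b` and `b'` be the coderivations of the given structure and of
the graded algebra, and let `Φ` be the coalgebra map of the quasi-isomorphism. The differentials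
vanish, so the linear part of `Φ` is bijective and hence `Φ` is invertible. The operator `N` that
multiplies a word by its length is a coderivation, and `[N, b'] = -b'` because `b'` is quadratic.
Therefore `D = Φ⁻¹ N Φ` is a coderivation with identity linear part and `[D, b] = -b`. The component
of arity `k` of this identity reads `(k - 2) b_k = [D_{k-1}, b_2]`, and division by `k - 2` exhibits
`b_k` as a coboundary (`exists_cobounding_of_lift`).

Part (b) is a gauge transformation. Conjugate `b` by the coalgebra automorphism with corestriction
`letter + ψ`. Below arity `k` nothing changes, and in arity `k` the coboundary of `ψ` is subtracted,
leaving zero. The automorphism is a morphism to the new structure by construction, and its linear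
part is the identity (`exists_truncation`).

The rest is the dictionary between words and multilinear maps: `repr_innerSum`, `repr_outerSum` and
`repr_differential` for the equations, `bar_isCochain` and `isCochain_unbar` for the symmetry
conditions. -/

/-- The tensor coalgebra on the free module `I →₀ K`, with its basis of words. -/
def Tens (K I : Type*) [Field K] := List I →₀ K

instance (K I : Type*) [Field K] : AddCommGroup (Tens K I) :=
  inferInstanceAs (AddCommGroup (List I →₀ K))

instance (K I : Type*) [Field K] : Module K (Tens K I) :=
  inferInstanceAs (Module K (List I →₀ K))

section Tensor

variable {K I : Type*} [Field K]

/-- The basis element given by a word. -/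
def wd (w : List I) : Tens K I := (Finsupp.single w 1 : List I →₀ K)

theorem tens_ext {M : Type*} [AddCommMonoid M] [Module K M] {f g : Tens K I →ₗ[K] M}
    (h : ∀ w, f (wd w) = g (wd w)) : f = g := by
  have : ∀ t : List I →₀ K, f t = g t := fun t => by
    induction t using Finsupp.induction_linear with
    | zero => exact (map_zero f).trans (map_zero g).symm
    | add a b ha hb => exact (map_add f _ _).trans ((congrArg₂ _ ha hb).trans (map_add g _ _).symm)
    | single w c =>
      have e : (Finsupp.single w c : List I →₀ K) = c • (wd w : Tens K I) := by
        change _ = c • (Finsupp.single w 1 : List I →₀ K)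
        simp
      exact (congrArg f e).trans (((map_smul f _ _).trans
        ((congrArg (c • ·) (h w)).trans (map_smul g _ _).symm)).trans (congrArg g e.symm))
  exact LinearMap.ext this

/-- The linear map with prescribed values on words. -/
def ofWords {M : Type*} [AddCommMonoid M] [Module K M] (f : List I → M) : Tens K I →ₗ[K] M :=
  (Finsupp.linearCombination K f : (List I →₀ K) →ₗ[K] M)

@[simp]
theorem ofWords_wd {M : Type*} [AddCommMonoid M] [Module K M] (f : List I → M) (w : List I) :
    ofWords f (wd w : Tens K I) = f w :=
  (Finsupp.linearCombination_single K (1 : K) w).trans (one_smul K _)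

/-- Prepend a vector. -/
def cons : (I →₀ K) →ₗ[K] Tens K I →ₗ[K] Tens K I :=
  Finsupp.linearCombination K fun i => ofWords fun w => wd (i :: w)

@[simp]
theorem cons_single_wd (i : I) (w : List I) :
    cons (Finsupp.single i 1) (wd w : Tens K I) = wd (i :: w) := by
  simp [cons]

/-- Prepending a vector, as a map on the tensor product. -/
def consT : (I →₀ K) ⊗[K] Tens K I →ₗ[K] Tens K I := TensorProduct.lift cons

@[simp]
theorem consT_tmul (v : I →₀ K) (t : Tens K I) : consT (v ⊗ₜ[K] t) = cons v t := rfl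

/-- The projection to words of length one. -/
def letter : Tens K I →ₗ[K] (I →₀ K) :=
  ofWords fun w => match w with
    | [i] => Finsupp.single i 1
    | _ => 0

/-- The coefficient of the empty word. -/
def counit : Tens K I →ₗ[K] K :=
  ofWords fun w => match w with
    | [] => 1
    | _ => 0

@[simp] theorem letter_nil : letter (wd [] : Tens K I) = 0 := by simp [letter]

@[simp] theorem counit_nil : counit (wd [] : Tens K I) = 1 := by simp [counit]

@[simp] theorem counit_cons_wd (i : I) (w : List I) : counit (wd (i :: w) : Tens K I) = 0 := by
  simp [counit]

theorem cons_ext {M : Type*} [AddCommMonoid M] [Module K M]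
    {f g : (I →₀ K) →ₗ[K] Tens K I →ₗ[K] M}
    (h : ∀ i w, f (Finsupp.single i 1) (wd w) = g (Finsupp.single i 1) (wd w)) : f = g :=
  Finsupp.lhom_ext' fun i => LinearMap.ext_ring (tens_ext (h i))

theorem counit_cons (v : I →₀ K) (t : Tens K I) : counit (cons v t) = 0 := by
  have : (cons : _ →ₗ[K] _ →ₗ[K] Tens K I).compr₂ counit = 0 := cons_ext fun i w => by simp
  exact LinearMap.congr_fun₂ this v t

theorem letter_cons (v : I →₀ K) (t : Tens K I) : letter (cons v t) = counit t • v := by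
  have : (cons : _ →ₗ[K] _ →ₗ[K] Tens K I).compr₂ letter =
      (LinearMap.lsmul K (I →₀ K)).flip.compl₂ counit := cons_ext fun i w => by
    cases w <;> simp [letter]
  exact LinearMap.congr_fun₂ this v t

/-- Deconcatenation of a word. -/
def comulWord : List I → Tens K I ⊗[K] Tens K I
  | [] => wd [] ⊗ₜ wd []
  | i :: w => wd [] ⊗ₜ wd (i :: w) +
      TensorProduct.map (cons (Finsupp.single i 1)) LinearMap.id (comulWord w)

/-- The deconcatenation coproduct. -/
def comul : Tens K I →ₗ[K] Tens K I ⊗[K] Tens K I := ofWords comulWord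

@[simp]
theorem comul_nil : comul (wd [] : Tens K I) = wd [] ⊗ₜ wd [] := by simp [comul, comulWord]

/-- A cut of `v ⊗ t` lies either in front of `v`, or is a cut of `t` with `v` put back on the left
part. -/
theorem comul_cons (v : I →₀ K) (t : Tens K I) :
    comul (cons v t) = wd [] ⊗ₜ cons v t + TensorProduct.map (cons v) LinearMap.id (comul t) := by
  have : (cons : _ →ₗ[K] _ →ₗ[K] Tens K I).compr₂ comul =
      cons.compr₂ (TensorProduct.mk K _ _ (wd [])) +
        ((TensorProduct.mapBilinear (.id K) (Tens K I) (Tens K I) (Tens K I) (Tens K I)).flip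
          LinearMap.id ∘ₗ cons).compl₂ comul := cons_ext fun i w => by
    simp [comul, comulWord]
  exact LinearMap.congr_fun₂ this v t

theorem comul_wd_cons (i : I) (w : List I) :
    comul (wd (i :: w) : Tens K I) = wd [] ⊗ₜ wd (i :: w) +
      TensorProduct.map (cons (Finsupp.single i 1)) LinearMap.id (comul (wd w)) := by
  rw [← cons_single_wd, comul_cons]

theorem comul_wd (w : List I) : comul (wd w : Tens K I) =
    ∑ j ∈ Finset.range (w.length + 1), wd (w.take j) ⊗ₜ wd (w.drop j) := by
  induction w with
  | nil => simp
  | cons i w ih =>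
    rw [comul_wd_cons, ih, List.length_cons, Finset.sum_range_succ' _ (w.length + 1), map_sum,
      add_comm]
    simp

/-- The first letter and the rest. -/
def head : Tens K I →ₗ[K] (I →₀ K) ⊗[K] Tens K I :=
  TensorProduct.map letter LinearMap.id ∘ₗ comul

theorem head_cons (v : I →₀ K) (t : Tens K I) : head (cons v t) = v ⊗ₜ t := by
  -- The left counit law: only the cut in front of everything has an empty left part.
  have key : ∀ t : Tens K I, TensorProduct.map (counit (K := K) (I := I))
      (LinearMap.id : Tens K I →ₗ[K] _) (comul t) = 1 ⊗ₜ t := fun t => by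
    have : TensorProduct.map (counit (K := K) (I := I)) (LinearMap.id : Tens K I →ₗ[K] _) ∘ₗ comul
        = TensorProduct.mk K _ _ 1 := tens_ext fun w => by
      cases w with
      | nil => simp
      | cons i w =>
        have : (counit (K := K) (I := I)) ∘ₗ cons (Finsupp.single i 1) = 0 :=
          LinearMap.ext fun t => counit_cons _ t
        rw [LinearMap.comp_apply, comul_wd_cons, map_add, ← LinearMap.comp_apply (map _ _),
          ← TensorProduct.map_comp, this]
        simp
    exact LinearMap.congr_fun this t
  have h : letter ∘ₗ cons v = (LinearMap.toSpanSingleton K _ v) ∘ₗ (counit (K := K) (I := I)) :=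
    LinearMap.ext fun t => by simp [letter_cons]
  rw [head, LinearMap.comp_apply, comul_cons, map_add, ← LinearMap.comp_apply (map _ _),
    ← TensorProduct.map_comp, h, ← LinearMap.id_comp (LinearMap.id ∘ₗ LinearMap.id)]
  rw [TensorProduct.map_comp, LinearMap.comp_apply]
  rw [LinearMap.comp_id, key]
  simp

theorem head_nil : head (wd [] : Tens K I) = 0 := by simp [head]

/-- Splitting off the first letter and putting it back loses only the constant term. A tensor
without constant term can thus be recovered from its coproduct and `letter`, which is the engine of
the uniqueness arguments. -/
theorem consT_head (t : Tens K I) : consT (head t) = t - counit t • wd [] := by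
  have : consT ∘ₗ head = LinearMap.id -
      (LinearMap.toSpanSingleton K _ (wd [])) ∘ₗ (counit (K := K) (I := I)) := tens_ext fun w => by
    cases w with
    | nil => simp [head_nil]
    | cons i w =>
      rw [LinearMap.comp_apply, ← cons_single_wd, head_cons]
      simp
  simpa using LinearMap.congr_fun this t

theorem comul_coassoc (t : Tens K I) :
    TensorProduct.assoc K _ _ _ (TensorProduct.map comul LinearMap.id (comul t)) =
      TensorProduct.map LinearMap.id comul (comul t) := by
  have : (TensorProduct.assoc K _ _ _).toLinearMap ∘ₗ TensorProduct.map comul LinearMap.id ∘ₗ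
      comul = TensorProduct.map (LinearMap.id : Tens K I →ₗ[K] _) comul ∘ₗ comul :=
    tens_ext fun w => by
      induction w with
      | nil => simp
      | cons i w ih =>
        simp only [LinearMap.comp_apply, LinearEquiv.coe_coe] at ih ⊢
        have h1 : ∀ y : Tens K I ⊗[K] Tens K I, TensorProduct.assoc K _ _ _
            (TensorProduct.map comul LinearMap.id
              (TensorProduct.map (cons (Finsupp.single i 1)) LinearMap.id y)) =
            wd [] ⊗ₜ (TensorProduct.map (cons (Finsupp.single i 1)) LinearMap.id y) +
            TensorProduct.map (cons (Finsupp.single i 1)) LinearMap.id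
              (TensorProduct.assoc K _ _ _ (TensorProduct.map comul LinearMap.id y)) := by
          intro y
          induction y with
          | zero => simp
          | add a b ha hb => simp only [map_add, tmul_add, ha, hb]; abel
          | tmul a b =>
            simp only [map_tmul, comul_cons, LinearMap.id_apply, add_tmul, map_add, assoc_tmul]
            congr 1
            generalize comul a = z
            induction z with
            | zero => simp
            | add a b ha hb => simp only [map_add, add_tmul, ha, hb]
            | tmul a b => simp
        have h2 : ∀ y : Tens K I ⊗[K] Tens K I,
            TensorProduct.map (LinearMap.id : Tens K I →ₗ[K] _) comul
              (TensorProduct.map (cons (Finsupp.single i 1)) LinearMap.id y) =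
            TensorProduct.map (cons (Finsupp.single i 1)) LinearMap.id
              (TensorProduct.map (LinearMap.id : Tens K I →ₗ[K] _) comul y) := by
          intro y
          simp only [← LinearMap.comp_apply, ← TensorProduct.map_comp, LinearMap.id_comp,
            LinearMap.comp_id]
        rw [comul_wd_cons, map_add, map_add, map_add, h1, ih, h2]
        simp only [map_tmul, comul_nil, LinearMap.id_apply, assoc_tmul]
        rw [comul_wd_cons, tmul_add]
        abel
  exact LinearMap.congr_fun this t

end Tensor

/-! ### Gradings, coderivations, coalgebra maps and the cofree coderivation. -/

section Graded

variable {K I : Type*} [Field K] (δ : I → ℤ)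

/-- The degree of a word. -/
def wdeg (w : List I) : ℤ := (w.map δ).sum

@[simp] theorem wdeg_nil : wdeg δ [] = 0 := rfl

@[simp] theorem wdeg_cons (i : I) (w : List I) : wdeg δ (i :: w) = δ i + wdeg δ w := by
  simp [wdeg]

/-- Multiplication by `c ^ d` in degree `d`. -/
def scale (c : Kˣ) : Tens K I →ₗ[K] Tens K I :=
  ofWords fun w => ((c ^ wdeg δ w : Kˣ) : K) • wd w

/-- Multiplication by `c ^ d` in degree `d`, on vectors. -/
def scaleV (c : Kˣ) : (I →₀ K) →ₗ[K] (I →₀ K) :=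
  Finsupp.linearCombination K fun i => ((c ^ δ i : Kˣ) : K) • Finsupp.single i 1

@[simp] theorem scale_wd (c : Kˣ) (w : List I) :
    scale δ c (wd w) = ((c ^ wdeg δ w : Kˣ) : K) • wd w := by simp [scale]

@[simp] theorem scaleV_single (c : Kˣ) (i : I) :
    scaleV δ c (Finsupp.single i 1) = ((c ^ δ i : Kˣ) : K) • Finsupp.single i 1 := by
  simp [scaleV]

/-- The grading is encoded by the action of the units `c` through `c ^ degree`: homogeneity of
degree `p` is equivariance up to `c ^ p`, and the Koszul sign is the action of a power of `-1`.
Additivity of degrees makes the action multiplicative. -/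
theorem scale_cons (c : Kˣ) (v : I →₀ K) (t : Tens K I) :
    scale δ c (cons v t) = cons (scaleV δ c v) (scale δ c t) := by
  have : (cons : _ →ₗ[K] _ →ₗ[K] Tens K I).compr₂ (scale δ c) =
      cons.compl₁₂ (scaleV δ c) (scale δ c) := cons_ext fun i w => by
    simp [-Finsupp.smul_single, smul_smul, zpow_add, mul_comm]
  exact LinearMap.congr_fun₂ this v t

theorem scale_comp (c c' : Kˣ) : scale δ c ∘ₗ scale δ c' = scale δ (c * c') :=
  tens_ext fun w => by simp [smul_smul, mul_zpow, mul_comm]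

theorem scale_scale (c c' : Kˣ) (t : Tens K I) :
    scale δ c (scale δ c' t) = scale δ (c * c') t := by
  rw [← scale_comp]; rfl

theorem scaleV_scaleV (c c' : Kˣ) (v : I →₀ K) :
    scaleV δ c (scaleV δ c' v) = scaleV δ (c * c') v := by
  have : scaleV δ c ∘ₗ scaleV δ c' = scaleV δ (c * c') :=
    Finsupp.lhom_ext' fun i => LinearMap.ext_ring (by
      simp [-Finsupp.smul_single, smul_smul, mul_zpow, mul_comm])
  rw [← this]; rfl

@[simp] theorem scale_one : scale δ (1 : Kˣ) = LinearMap.id := tens_ext fun w => by simp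

@[simp] theorem scaleV_one : scaleV δ (1 : Kˣ) = LinearMap.id :=
    Finsupp.lhom_ext' fun i => LinearMap.ext_ring (by simp)

theorem letter_scale (c : Kˣ) (t : Tens K I) : letter (scale δ c t) = scaleV δ c (letter t) := by
  have : letter ∘ₗ scale δ c = scaleV δ c ∘ₗ letter := tens_ext fun w => by
    match w with
    | [] => simp
    | [i] => simp [letter]
    | i :: j :: w => simp [letter]
  exact LinearMap.congr_fun this t

theorem counit_scale (c : Kˣ) (t : Tens K I) : counit (scale δ c t) = counit t := by
  have : counit ∘ₗ scale δ c = counit (K := K) (I := I) := tens_ext fun w => by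
    cases w <;> simp
  exact LinearMap.congr_fun this t

theorem comul_scale (c : Kˣ) (t : Tens K I) :
    comul (scale δ c t) = TensorProduct.map (scale δ c) (scale δ c) (comul t) := by
  have : comul ∘ₗ scale δ c = TensorProduct.map (scale δ c) (scale δ c) ∘ₗ comul :=
    tens_ext fun w => by
      have h : ∀ j, wdeg δ w = wdeg δ (w.take j) + wdeg δ (w.drop j) := fun j => by
        conv_lhs => rw [← List.take_append_drop j w]
        simp [wdeg]
      simp only [LinearMap.comp_apply, scale_wd, map_smul, comul_wd, map_sum, Finset.smul_sum,
        map_tmul, smul_tmul', tmul_smul, smul_smul]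
      refine Finset.sum_congr rfl fun j _ => ?_
      rw [h j, zpow_add, Units.val_mul, mul_comm]
  exact LinearMap.congr_fun this t

/-- The sign `(-1) ^ (p d)` in degree `d`. -/
def twist (p : ℤ) : Tens K I →ₗ[K] Tens K I := scale δ ((-1) ^ p)

/-- The sign `(-1) ^ (p d)` in degree `d`, on vectors. -/
def twistV (p : ℤ) : (I →₀ K) →ₗ[K] (I →₀ K) := scaleV δ ((-1) ^ p)

@[simp] theorem twist_nil (p : ℤ) : twist δ p (wd []) = (wd [] : Tens K I) := by simp [twist]

@[simp] theorem twist_zero : (twist δ 0 : Tens K I →ₗ[K] _) = LinearMap.id := by simp [twist]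

@[simp] theorem twistV_zero : (twistV δ 0 : (I →₀ K) →ₗ[K] _) = LinearMap.id := by simp [twistV]

theorem twist_twist (p q : ℤ) (t : Tens K I) : twist δ p (twist δ q t) = twist δ (p + q) t := by
  rw [twist, twist, scale_scale, twist, zpow_add]

/-- Coderivations of the tensor coalgebra, homogeneous of degree `p`. -/
structure IsCoder (p : ℤ) (X : Tens K I →ₗ[K] Tens K I) : Prop where
  comul_apply : ∀ t, comul (X t) = TensorProduct.map X LinearMap.id (comul t) +
    TensorProduct.map (twist δ p) X (comul t)
  counit_apply : ∀ t, counit (X t) = 0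
  scale_apply : ∀ (c : Kˣ) t, scale δ c (X t) = ((c ^ p : Kˣ) : K) • X (scale δ c t)

/-- Coalgebra endomorphisms of degree zero. -/
structure IsCohom (F : Tens K I →ₗ[K] Tens K I) : Prop where
  comul_apply : ∀ t, comul (F t) = TensorProduct.map F F (comul t)
  counit_apply : ∀ t, counit (F t) = counit t
  scale_apply : ∀ (c : Kˣ) t, scale δ c (F t) = F (scale δ c t)
  nil : F (wd []) = wd []

variable {δ}

theorem map_apply_comp {M₁ M₂ M₃ N₁ N₂ N₃ : Type*} [AddCommMonoid M₁] [Module K M₁]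
    [AddCommMonoid M₂] [Module K M₂] [AddCommMonoid M₃] [Module K M₃] [AddCommMonoid N₁] [Module K N₁]
    [AddCommMonoid N₂] [Module K N₂] [AddCommMonoid N₃] [Module K N₃]
    (f : M₂ →ₗ[K] M₃) (g : N₂ →ₗ[K] N₃) (f' : M₁ →ₗ[K] M₂) (g' : N₁ →ₗ[K] N₂) (y : M₁ ⊗[K] N₁) :
    TensorProduct.map f g (TensorProduct.map f' g' y) =
      TensorProduct.map (f ∘ₗ f') (g ∘ₗ g') y := by
  rw [TensorProduct.map_comp]; rfl

theorem map_sub_left' {M₁ M₂ N₁ N₂ : Type*} [AddCommGroup M₁] [Module K M₁] [AddCommGroup M₂]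
    [Module K M₂] [AddCommGroup N₁] [Module K N₁] [AddCommGroup N₂] [Module K N₂]
    (f g : M₁ →ₗ[K] M₂) (h : N₁ →ₗ[K] N₂) (y : M₁ ⊗[K] N₁) :
    TensorProduct.map (f - g) h y = TensorProduct.map f h y - TensorProduct.map g h y := by
  have : TensorProduct.map (f - g) h = TensorProduct.map f h - TensorProduct.map g h :=
    TensorProduct.ext' fun x y => by simp [sub_tmul]
  rw [this]
  rfl

theorem map_sub_right' {M₁ M₂ N₁ N₂ : Type*} [AddCommGroup M₁] [Module K M₁] [AddCommGroup M₂]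
    [Module K M₂] [AddCommGroup N₁] [Module K N₁] [AddCommGroup N₂] [Module K N₂]
    (h : M₁ →ₗ[K] M₂) (f g : N₁ →ₗ[K] N₂) (y : M₁ ⊗[K] N₁) :
    TensorProduct.map h (f - g) y = TensorProduct.map h f y - TensorProduct.map h g y := by
  have : TensorProduct.map h (f - g) = TensorProduct.map h f - TensorProduct.map h g :=
    TensorProduct.ext' fun x y => by simp [tmul_sub]
  rw [this]
  rfl

theorem IsCoder.twist_apply {p : ℤ} {X : Tens K I →ₗ[K] Tens K I} (hX : IsCoder δ p X) (q : ℤ)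
    (t : Tens K I) : twist δ q (X t) = (((-1) ^ (q * p) : Kˣ) : K) • X (twist δ q t) := by
  rw [twist, hX.scale_apply, zpow_mul]

/-- In the coproduct of the two composites the mixed terms, with `X` on one factor and `Y` on the
other, cancel by the Koszul signs; what remains is the co-Leibniz rule. Induction on words later
rests on bracketing with coderivations that shuffle in one letter. -/
theorem IsCoder.bracket {p q : ℤ} {X Y : Tens K I →ₗ[K] Tens K I} (hX : IsCoder δ p X)
    (hY : IsCoder δ q Y) :
    IsCoder δ (p + q) (X ∘ₗ Y - (((-1) ^ (p * q) : Kˣ) : K) • Y ∘ₗ X) where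
  comul_apply t := by
    have h1 : X ∘ₗ twist δ q = (((-1) ^ (p * q) : Kˣ) : K) • twist δ q ∘ₗ X :=
      LinearMap.ext fun t => by
        simp only [LinearMap.comp_apply, LinearMap.smul_apply]
        rw [hX.twist_apply, smul_smul, ← Units.val_mul, ← zpow_add, mul_comm q p, ← two_mul,
          zpow_mul]
        simp
    have h2 : twist δ p ∘ₗ Y = (((-1) ^ (p * q) : Kˣ) : K) • Y ∘ₗ twist δ p :=
      LinearMap.ext fun t => by
        simp only [LinearMap.comp_apply, LinearMap.smul_apply]
        rw [hY.twist_apply]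
    have h3 : twist δ p ∘ₗ twist δ q = (twist δ (p + q) : Tens K I →ₗ[K] _) :=
      LinearMap.ext fun t => twist_twist δ p q t
    have h4 : twist δ q ∘ₗ twist δ p = (twist δ (p + q) : Tens K I →ₗ[K] _) :=
      LinearMap.ext fun t => by rw [add_comm]; exact twist_twist δ q p t
    simp only [LinearMap.sub_apply, LinearMap.smul_apply, LinearMap.comp_apply, map_sub, map_smul,
      hX.comul_apply, hY.comul_apply, map_add, map_apply_comp, map_sub_left',
      map_sub_right', LinearMap.id_comp, LinearMap.comp_id, h1, h2, h3, h4,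
      TensorProduct.map_smul_left, TensorProduct.map_smul_right, smul_add]
    abel
  counit_apply t := by simp [hX.counit_apply, hY.counit_apply]
  scale_apply c t := by
    simp only [LinearMap.sub_apply, LinearMap.smul_apply, LinearMap.comp_apply, map_sub, map_smul,
      hX.scale_apply, hY.scale_apply, smul_sub, smul_smul, zpow_add, Units.val_mul]
    congr 2
    ring

theorem IsCohom.symm {F : Tens K I ≃ₗ[K] Tens K I} (hF : IsCohom δ F.toLinearMap) :
    IsCohom δ F.symm.toLinearMap where
  comul_apply t := by
    obtain ⟨s, rfl⟩ := F.surjective t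
    have := hF.comul_apply s
    simp only [LinearEquiv.coe_coe] at this
    simp [this, map_apply_comp]
  counit_apply t := by
    obtain ⟨s, rfl⟩ := F.surjective t
    simpa using (hF.counit_apply s).symm
  scale_apply c t := by
    obtain ⟨s, rfl⟩ := F.surjective t
    have := hF.scale_apply c s
    simp only [LinearEquiv.coe_coe] at this ⊢
    simp [this]
  nil := by
    have := hF.nil
    simp only [LinearEquiv.coe_coe] at this ⊢
    rw [LinearEquiv.symm_apply_eq, this]

/-- Conjugation of a coderivation by a coalgebra automorphism. -/
theorem IsCoder.conj {p : ℤ} {X : Tens K I →ₗ[K] Tens K I} (hX : IsCoder δ p X)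
    {F : Tens K I ≃ₗ[K] Tens K I} (hF : IsCohom δ F.toLinearMap) :
    IsCoder δ p (F.toLinearMap ∘ₗ X ∘ₗ F.symm.toLinearMap) where
  comul_apply t := by
    have h : F.toLinearMap ∘ₗ twist δ p ∘ₗ F.symm.toLinearMap = twist δ p :=
      LinearMap.ext fun t => by
        have := hF.scale_apply ((-1) ^ p) (F.symm t)
        simp only [LinearEquiv.coe_coe, LinearEquiv.apply_symm_apply] at this
        simp [twist, ← this]
    have h1 : ∀ t, comul (F t) = _ := hF.comul_apply
    have h2 : ∀ t, comul (F.symm t) = _ := hF.symm.comul_apply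
    have h3 : F.toLinearMap ∘ₗ F.symm.toLinearMap = LinearMap.id := by ext; simp
    simp only [LinearMap.comp_apply, LinearEquiv.coe_coe, h1, hX.comul_apply, h2, map_add,
      map_apply_comp, h, LinearMap.id_comp, h3]
  counit_apply t := by
    have h1 : ∀ t, counit (F t) = _ := hF.counit_apply
    simp [h1, hX.counit_apply]
  scale_apply c t := by
    have := hF.symm.scale_apply c
    simp only [LinearEquiv.coe_coe] at this
    simp only [LinearMap.comp_apply, hF.scale_apply, hX.scale_apply, map_smul]
    simp [this]

/-- Words of length `n` span this submodule. -/
def lenSub (K I : Type*) [Field K] (n : ℕ) : Submodule K (Tens K I) :=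
  Submodule.span K (wd '' {w | w.length = n})

theorem wd_mem_lenSub (w : List I) : (wd w : Tens K I) ∈ lenSub K I w.length :=
  Submodule.subset_span ⟨w, rfl, rfl⟩

theorem lenSub_induction {n : ℕ} {N : Type*} [AddCommGroup N] [Module K N]
    {f g : Tens K I →ₗ[K] N} (h : ∀ w : List I, w.length = n → f (wd w) = g (wd w))
    {t : Tens K I} (ht : t ∈ lenSub K I n) : f t = g t := by
  refine LinearMap.eqOn_span (f := f) (g := g) ?_ ht
  rintro _ ⟨w, hw, rfl⟩
  exact h w hw

variable (δ) in
/-- A projection of the tensor coalgebra onto a subcoalgebra preserved by all coderivations and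
all coalgebra automorphisms. -/
structure IsSym (e : Tens K I →ₗ[K] Tens K I) : Prop where
  nil : e (wd []) = wd []
  single : ∀ i, e (wd [i]) = wd [i]
  idem : ∀ t, e (e t) = e t
  len : ∀ w : List I, e (wd w) ∈ lenSub K I w.length
  scale_apply : ∀ (c : Kˣ) t, scale δ c (e t) = e (scale δ c t)
  comul_apply : ∀ t, TensorProduct.map e e (comul (e t)) = comul (e t)
  coder : ∀ (p : ℤ) (X : Tens K I →ₗ[K] Tens K I), IsCoder δ p X → ∀ t, e (X (e t)) = X (e t)
  cohom : ∀ (F : Tens K I ≃ₗ[K] Tens K I), IsCohom δ F.toLinearMap → ∀ t, e (F (e t)) = F (e t)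

/-- Serves `Ass` and `Com`. The condition for `Com` is not the choice of a subcoalgebra but a
condition on corestrictions, and is carried along separately as `KillsShuffles`. -/
theorem isSym_id : IsSym δ (LinearMap.id : Tens K I →ₗ[K] _) where
  nil := rfl
  single _ := rfl
  idem _ := rfl
  len := wd_mem_lenSub
  scale_apply _ _ := rfl
  comul_apply t := by simp
  coder _ _ _ _ := rfl
  cohom _ _ _ := rfl

/-- A relative coderivation into a tensor coalgebra is determined by its corestriction. -/
theorem eq_zero_of_letter_eq_zero {e E F G : Tens K I →ₗ[K] Tens K I} (hnil : e (wd []) = wd [])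
    (hlen : ∀ w : List I, e (wd w) ∈ lenSub K I w.length)
    (hcomul : ∀ t, TensorProduct.map e e (comul (e t)) = comul (e t))
    (hE : ∀ t, comul (E t) = TensorProduct.map E F (comul t) + TensorProduct.map G E (comul t))
    (hcE : ∀ t, counit (E t) = 0) (hG : G (wd []) = wd []) (hl : ∀ t, letter (E (e t)) = 0)
    (t : Tens K I) : E (e t) = 0 := by
  have hl' : letter ∘ₗ E ∘ₗ e = 0 := LinearMap.ext hl
  have key : ∀ n : ℕ, ∀ w : List I, w.length = n → E (e (wd w)) = 0 := by
    intro n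
    induction n using Nat.strong_induction_on with
    | _ n ih =>
      intro w hw
      -- There is no constant term, so the value is its first letter followed by the rest. In the
      -- coproduct rule the summand with `E` on the left contributes no letter, and the other one
      -- has `E` on a suffix.
      have h1 := consT_head (E (e (wd w)))
      rw [hcE, zero_smul, sub_zero, head, LinearMap.comp_apply, hE, ← hcomul] at h1
      rw [← h1]
      simp only [map_add, map_apply_comp, hl', TensorProduct.map_zero_left, LinearMap.zero_apply,
        zero_add, LinearMap.id_comp]
      have : ∀ s ∈ lenSub K I n, consT (TensorProduct.map (letter ∘ₗ G ∘ₗ e) (E ∘ₗ e) (comul s)) =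
          0 := by
        intro s hs
        refine lenSub_induction (f := consT ∘ₗ TensorProduct.map (letter ∘ₗ G ∘ₗ e) (E ∘ₗ e) ∘ₗ
          comul) (g := 0) (fun u hu => ?_) hs
        simp only [LinearMap.comp_apply, comul_wd, map_sum, map_tmul, LinearMap.zero_apply]
        refine Finset.sum_eq_zero fun j hj => ?_
        -- The cut at zero is the only one whose suffix is not shorter; there the prefix is sent to
        -- the empty word, which has no letter.
        rcases Nat.eq_zero_or_pos j with rfl | hj0
        · simp [hnil, hG]
        · rw [ih (u.drop j).length (by have := Finset.mem_range.1 hj; simp; omega) _ rfl]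
          simp
      exact this _ (hw ▸ hlen w)
  have : E ∘ₗ e = 0 := tens_ext fun w => key _ w rfl
  exact LinearMap.congr_fun this t

theorem IsSym.eq_zero {e E F G : Tens K I →ₗ[K] Tens K I} (he : IsSym δ e)
    (hE : ∀ t, comul (E t) = TensorProduct.map E F (comul t) + TensorProduct.map G E (comul t))
    (hcE : ∀ t, counit (E t) = 0) (hG : G (wd []) = wd []) (hl : ∀ t, letter (E (e t)) = 0)
    (t : Tens K I) : E (e t) = 0 :=
  eq_zero_of_letter_eq_zero he.nil he.len he.comul_apply hE hcE hG hl t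

/-- Two coderivations with the same corestriction agree. -/
theorem IsCoder.ext_of_sym {e X Y : Tens K I →ₗ[K] Tens K I} {p : ℤ} (he : IsSym δ e)
    (hX : IsCoder δ p X) (hY : IsCoder δ p Y) (h : ∀ t, letter (X (e t)) = letter (Y (e t)))
    (t : Tens K I) : X (e t) = Y (e t) := by
  have := he.eq_zero (E := X - Y) (F := LinearMap.id) (G := twist δ p) (fun t => by
    simp only [LinearMap.sub_apply, map_sub, hX.comul_apply, hY.comul_apply, map_sub_left',
      map_sub_right']
    abel) (fun t => by simp [hX.counit_apply, hY.counit_apply]) (twist_nil δ p) (fun t => by simp [h]) t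
  simpa [sub_eq_zero] using this

theorem IsCoder.ext {X Y : Tens K I →ₗ[K] Tens K I} {p : ℤ}
    (hX : IsCoder δ p X) (hY : IsCoder δ p Y) (h : ∀ t, letter (X t) = letter (Y t)) : X = Y :=
  LinearMap.ext fun t => IsCoder.ext_of_sym isSym_id hX hY h t

variable (δ) in
/-- The values on words of the coderivation with corestriction `β`. -/
def hatWord (p : ℤ) (β : Tens K I →ₗ[K] (I →₀ K)) : List I → Tens K I
  | [] => cons (β (wd [])) (wd [])
  | i :: w => consT (TensorProduct.map β LinearMap.id (comul (wd (i :: w)))) +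
      cons (twistV δ p (Finsupp.single i 1)) (hatWord p β w)

variable (δ) in
/-- The coderivation with corestriction `β`. -/
def hat (p : ℤ) (β : Tens K I →ₗ[K] (I →₀ K)) : Tens K I →ₗ[K] Tens K I := ofWords (hatWord δ p β)

theorem hat_nil (p : ℤ) (β : Tens K I →ₗ[K] (I →₀ K)) :
    hat δ p β (wd []) = cons (β (wd [])) (wd []) := by simp [hat, hatWord]

/-- Either `β` is applied to an initial segment, possibly empty, or it acts behind `v` and passes
`v` with a Koszul sign. -/
theorem hat_cons (p : ℤ) (β : Tens K I →ₗ[K] (I →₀ K)) (v : I →₀ K) (t : Tens K I) :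
    hat δ p β (cons v t) = consT (TensorProduct.map β LinearMap.id (comul (cons v t))) +
      cons (twistV δ p v) (hat δ p β t) := by
  have : (cons : _ →ₗ[K] _ →ₗ[K] Tens K I).compr₂ (hat δ p β) =
      cons.compr₂ (consT ∘ₗ TensorProduct.map β LinearMap.id ∘ₗ comul) +
        cons.compl₁₂ (twistV δ p) (hat δ p β) := cons_ext fun i w => by
    simp [hat, hatWord]
  exact LinearMap.congr_fun₂ this v t

theorem counit_consT (y : (I →₀ K) ⊗[K] Tens K I) : counit (consT y) = 0 := by
  have : counit ∘ₗ consT = (0 : (I →₀ K) ⊗[K] Tens K I →ₗ[K] K) :=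
    TensorProduct.ext' fun v t => counit_cons v t
  exact LinearMap.congr_fun this y

theorem letter_consT (y : (I →₀ K) ⊗[K] Tens K I) :
    letter (consT y) = TensorProduct.rid K _ (TensorProduct.map LinearMap.id counit y) := by
  have : letter ∘ₗ consT = (TensorProduct.rid K (I →₀ K)).toLinearMap ∘ₗ
      TensorProduct.map LinearMap.id counit := TensorProduct.ext' fun v t => by
    simp [letter_cons]
  exact LinearMap.congr_fun this y

theorem comul_counit (t : Tens K I) :
    TensorProduct.map LinearMap.id counit (comul t) = t ⊗ₜ (1 : K) := by
  have : TensorProduct.map LinearMap.id counit ∘ₗ comul =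
      (TensorProduct.mk K (Tens K I) K).flip 1 := tens_ext fun w => by
    induction w with
    | nil => simp
    | cons i w ih =>
      simp only [LinearMap.comp_apply] at ih
      have h := map_apply_comp (LinearMap.id : Tens K I →ₗ[K] _) (counit (K := K) (I := I))
        (cons (Finsupp.single i 1)) LinearMap.id (comul (wd w))
      rw [LinearMap.comp_apply, comul_wd_cons, map_add, h]
      have h' := map_apply_comp (cons (Finsupp.single i (1 : K))) LinearMap.id
        (LinearMap.id : Tens K I →ₗ[K] _) (counit (K := K) (I := I)) (comul (wd w))
      simp only [LinearMap.id_comp, LinearMap.comp_id] at h' ⊢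
      rw [← h', ih]
      simp
  exact LinearMap.congr_fun this t

theorem counit_hat (p : ℤ) (β : Tens K I →ₗ[K] (I →₀ K)) (t : Tens K I) :
    counit (hat δ p β t) = 0 := by
  have : counit ∘ₗ hat δ p β = 0 := tens_ext fun w => by
    cases w with
    | nil => simp [hat_nil, counit_cons]
    | cons i w =>
      rw [LinearMap.comp_apply, ← cons_single_wd, hat_cons, map_add, counit_consT, counit_cons]
      simp
  exact LinearMap.congr_fun this t

/-- A single letter results only if `β` consumes everything, which is the right counit law. -/
theorem letter_consT_map (β : Tens K I →ₗ[K] (I →₀ K)) (t : Tens K I) :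
    letter (consT (TensorProduct.map β LinearMap.id (comul t))) = β t := by
  rw [letter_consT, map_apply_comp]
  have h := map_apply_comp β LinearMap.id (LinearMap.id : Tens K I →ₗ[K] _)
    (counit (K := K) (I := I)) (comul t)
  simp only [LinearMap.id_comp, LinearMap.comp_id] at h ⊢
  rw [← h, comul_counit]
  simp

@[simp]
theorem letter_hat (p : ℤ) (β : Tens K I →ₗ[K] (I →₀ K)) (t : Tens K I) :
    letter (hat δ p β t) = β t := by
  have : letter ∘ₗ hat δ p β = β := tens_ext fun w => by
    cases w with
    | nil => simp [hat_nil, letter_cons]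
    | cons i w =>
      rw [LinearMap.comp_apply, ← cons_single_wd, hat_cons, map_add, letter_consT_map, letter_cons,
        counit_hat]
      simp
  exact LinearMap.congr_fun this t

theorem comul_consT (y : (I →₀ K) ⊗[K] Tens K I) : comul (consT y) = wd [] ⊗ₜ consT y +
    TensorProduct.map consT LinearMap.id ((TensorProduct.assoc K _ _ _).symm
      (TensorProduct.map LinearMap.id comul y)) := by
  induction y with
  | zero => simp
  | add a b ha hb => simp only [map_add, tmul_add, ha, hb]; abel
  | tmul v t =>
    rw [consT_tmul, comul_cons, map_tmul]
    congr 1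
    generalize comul t = z
    induction z with
    | zero => simp
    | add a b ha hb => simp only [map_add, tmul_add, ha, hb]
    | tmul a b => simp

/-- Coassociativity: cutting after `β` has consumed a prefix is the same as cutting first and
letting `β` consume a prefix of the left part. -/
theorem comul_consT_map (β : Tens K I →ₗ[K] (I →₀ K)) (t : Tens K I) :
    comul (consT (TensorProduct.map β LinearMap.id (comul t))) =
      wd [] ⊗ₜ consT (TensorProduct.map β LinearMap.id (comul t)) +
      TensorProduct.map (consT ∘ₗ TensorProduct.map β LinearMap.id ∘ₗ comul) LinearMap.id
        (comul t) := by
  rw [comul_consT, map_apply_comp]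
  congr 1
  have h1 := map_apply_comp β LinearMap.id (LinearMap.id : Tens K I →ₗ[K] _) comul (comul t)
  simp only [LinearMap.id_comp, LinearMap.comp_id] at h1 ⊢
  rw [← h1, ← comul_coassoc]
  have h2 := map_apply_comp (TensorProduct.map β LinearMap.id) LinearMap.id comul
    (LinearMap.id : Tens K I →ₗ[K] _) (comul t)
  have h3 := map_apply_comp consT LinearMap.id (TensorProduct.map β LinearMap.id ∘ₗ comul)
    (LinearMap.id : Tens K I →ₗ[K] _) (comul t)
  rw [LinearMap.id_comp] at h2 h3
  rw [← h3, ← h2]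
  congr 1
  generalize TensorProduct.map comul (LinearMap.id : Tens K I →ₗ[K] _) (comul t) = z
  induction z with
  | zero => simp
  | add a b ha hb => simp only [map_add, ha, hb]
  | tmul a b =>
    induction a with
    | zero => simp
    | add a c ha hc => simp only [map_add, ha, hc, add_tmul]
    | tmul a c => simp

/-- A cut of the result lies behind or in front of the letter produced by `β`. Induction on the
word, with `hat_cons` separating the two cases. -/
theorem comul_hat (p : ℤ) (β : Tens K I →ₗ[K] (I →₀ K)) (t : Tens K I) :
    comul (hat δ p β t) = TensorProduct.map (hat δ p β) LinearMap.id (comul t) +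
      TensorProduct.map (twist δ p) (hat δ p β) (comul t) := by
  have : comul ∘ₗ hat δ p β = TensorProduct.map (hat δ p β) LinearMap.id ∘ₗ comul +
      TensorProduct.map (twist δ p) (hat δ p β) ∘ₗ comul := tens_ext fun w => by
    induction w with
    | nil => simp [hat_nil, comul_cons]; abel
    | cons i w ih =>
      simp only [LinearMap.comp_apply, LinearMap.add_apply] at ih ⊢
      rw [← cons_single_wd, hat_cons, map_add, comul_consT_map, comul_cons (twistV δ p _), ih]
      have h1 : hat δ p β ∘ₗ cons (Finsupp.single i (1 : K)) =
          consT ∘ₗ TensorProduct.map β LinearMap.id ∘ₗ comul ∘ₗ cons (Finsupp.single i (1 : K)) +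
          cons (twistV δ p (Finsupp.single i (1 : K))) ∘ₗ hat δ p β :=
        LinearMap.ext fun t => hat_cons p β _ t
      have h2 : twist δ p ∘ₗ cons (Finsupp.single i (1 : K)) =
          cons (twistV δ p (Finsupp.single i (1 : K))) ∘ₗ twist δ p :=
        LinearMap.ext fun t => scale_cons δ _ _ t
      simp only [map_add, map_apply_comp, h1, h2, LinearMap.id_comp, LinearMap.comp_id, map_tmul,
        LinearMap.id_apply, hat_nil, twist_nil, TensorProduct.map_add_left, LinearMap.add_apply,
        hat_cons, comul_cons, tmul_add, LinearMap.comp_apply, comul_nil, consT_tmul,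
        LinearMap.comp_assoc]
      abel
  exact LinearMap.congr_fun this t

theorem scale_consT (c : Kˣ) (y : (I →₀ K) ⊗[K] Tens K I) :
    scale δ c (consT y) = consT (TensorProduct.map (scaleV δ c) (scale δ c) y) := by
  have : scale δ c ∘ₗ consT = consT ∘ₗ TensorProduct.map (scaleV δ c) (scale δ c) :=
    TensorProduct.ext' fun v t => by simp [scale_cons]
  exact LinearMap.congr_fun this y

theorem scaleV_twistV (c : Kˣ) (p : ℤ) (v : I →₀ K) :
    scaleV δ c (twistV δ p v) = twistV δ p (scaleV δ c v) := by
  rw [twistV, scaleV_scaleV, scaleV_scaleV, mul_comm]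

theorem isCoder_hat {p : ℤ} {β : Tens K I →ₗ[K] (I →₀ K)}
    (hβ : ∀ (c : Kˣ) t, scaleV δ c (β t) = ((c ^ p : Kˣ) : K) • β (scale δ c t)) :
    IsCoder δ p (hat δ p β) where
  comul_apply := comul_hat p β
  counit_apply := counit_hat p β
  scale_apply c t := by
    have h : scaleV δ c ∘ₗ β = ((c ^ p : Kˣ) : K) • β ∘ₗ scale δ c := LinearMap.ext (hβ c)
    have : scale δ c ∘ₗ hat δ p β = ((c ^ p : Kˣ) : K) • hat δ p β ∘ₗ scale δ c :=
      tens_ext fun w => by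
        induction w with
        | nil => simp [hat_nil, scale_cons, hβ]
        | cons i w ih =>
          simp only [LinearMap.comp_apply, LinearMap.smul_apply] at ih ⊢
          rw [← cons_single_wd, hat_cons, map_add, scale_consT, scale_cons, ih, scale_cons,
            hat_cons, map_apply_comp, h, scaleV_twistV, ← scale_cons, comul_scale]
          simp only [map_apply_comp, LinearMap.comp_id, LinearMap.id_comp,
            TensorProduct.map_smul_left, LinearMap.smul_apply, map_smul, smul_add]
    exact LinearMap.congr_fun this t

/-- Cofreeness: `hat` and the corestriction `letter ∘ₗ X` are mutually inverse, so coderivations are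
the same as graded families of operations. -/
theorem IsCoder.eq_hat {p : ℤ} {X : Tens K I →ₗ[K] Tens K I} (hX : IsCoder δ p X) :
    X = hat δ p (letter ∘ₗ X) :=
  hX.ext (isCoder_hat fun c t => by
    simp only [LinearMap.comp_apply]
    rw [← letter_scale, hX.scale_apply, map_smul]) fun t => by simp

end Graded

/-! ### Cofree coalgebra maps and their invertibility. -/

section Lift

variable {K I : Type*} [Field K] {δ : I → ℤ}

/-- The values on words of the coalgebra map with corestriction `φ`. -/
def liftWord (φ : Tens K I →ₗ[K] (I →₀ K)) (w : List I) : Tens K I :=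
  if w = [] then wd [] else
    ∑ j : Fin w.length, cons (φ (wd (w.take (j + 1)))) (liftWord φ (w.drop (j + 1)))
termination_by w.length
decreasing_by
  have := j.isLt
  rw [List.length_drop]
  omega

/-- The coalgebra map with corestriction `φ`, where `φ` vanishes on the empty word. -/
def lift (φ : Tens K I →ₗ[K] (I →₀ K)) : Tens K I →ₗ[K] Tens K I := ofWords (liftWord φ)

@[simp]
theorem lift_nil (φ : Tens K I →ₗ[K] (I →₀ K)) : lift φ (wd []) = wd [] := by
  simp [lift, liftWord]

theorem lift_wd_cons (φ : Tens K I →ₗ[K] (I →₀ K)) (i : I) (w : List I) :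
    lift φ (wd (i :: w)) = ∑ j ∈ Finset.range (w.length + 1),
      cons (φ (wd (i :: w.take j))) (lift φ (wd (w.drop j))) := by
  rw [lift, ofWords_wd, liftWord, if_neg (by simp), Finset.sum_range]
  simp

variable {φ : Tens K I →ₗ[K] (I →₀ K)}

/-- Recursion on the first block. As `φ` kills the empty word, the empty prefix contributes nothing.
-/
theorem lift_eq (hφ : φ (wd []) = 0) (t : Tens K I) :
    lift φ t = counit t • wd [] + consT (TensorProduct.map φ (lift φ) (comul t)) := by
  have : lift φ = LinearMap.toSpanSingleton K _ (wd []) ∘ₗ counit +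
      consT ∘ₗ TensorProduct.map φ (lift φ) ∘ₗ comul := tens_ext fun w => by
    cases w with
    | nil => simp [hφ]
    | cons i w =>
      simp only [LinearMap.add_apply, LinearMap.comp_apply, comul_wd, map_sum, map_tmul,
        consT_tmul, counit_cons_wd, map_zero, zero_add]
      rw [lift_wd_cons, List.length_cons, Finset.sum_range_succ' _ (w.length + 1)]
      simp [hφ]
  conv_lhs => rw [this]
  simp

/-- With `ψ` vanishing on the empty word, the right tensor factor is only evaluated on proper
suffixes. This is what makes strong induction on the length work for `lift`. -/
theorem map_congr_of_shorter {M N : Type*} [AddCommMonoid M] [Module K M] [AddCommMonoid N]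
    [Module K N] {ψ : Tens K I →ₗ[K] N} (hψ : ψ (wd []) = 0) {f g : Tens K I →ₗ[K] M} {w : List I}
    (h : ∀ u : List I, u.length < w.length → f (wd u) = g (wd u)) :
    TensorProduct.map ψ f (comul (wd w)) = TensorProduct.map ψ g (comul (wd w)) := by
  simp only [comul_wd, map_sum, map_tmul]
  refine Finset.sum_congr rfl fun j hj => ?_
  rcases Nat.eq_zero_or_pos j with rfl | hj0
  · simp [hψ]
  · rw [h _ (by have := Finset.mem_range.1 hj; simp; omega)]

/-- Strong induction: after the first block is split off, the remainder is a proper suffix, and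
coassociativity moves the cut from the image back to the word. -/
theorem comul_lift (hφ : φ (wd []) = 0) (t : Tens K I) :
    comul (lift φ t) = TensorProduct.map (lift φ) (lift φ) (comul t) := by
  have key : ∀ n : ℕ, ∀ w : List I, w.length = n →
      comul (lift φ (wd w)) = TensorProduct.map (lift φ) (lift φ) (comul (wd w)) := by
    intro n
    induction n using Nat.strong_induction_on with
    | _ n ih =>
      intro w hw
      have h1 : TensorProduct.map (LinearMap.id : (I →₀ K) →ₗ[K] _) comul
          (TensorProduct.map φ (lift φ) (comul (wd w))) =
          TensorProduct.map φ (TensorProduct.map (lift φ) (lift φ))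
            (TensorProduct.map LinearMap.id comul (comul (wd w))) := by
        rw [map_apply_comp, map_apply_comp, LinearMap.id_comp, LinearMap.comp_id]
        refine map_congr_of_shorter hφ fun u hu => ?_
        exact ih _ (hw ▸ hu) u rfl
      have h2 : ∀ z : Tens K I ⊗[K] (Tens K I ⊗[K] Tens K I),
          TensorProduct.map consT LinearMap.id ((TensorProduct.assoc K _ _ _).symm
            (TensorProduct.map φ (TensorProduct.map (lift φ) (lift φ)) z)) =
          TensorProduct.map (consT ∘ₗ TensorProduct.map φ (lift φ)) (lift φ)
            ((TensorProduct.assoc K _ _ _).symm z) := by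
        intro z
        induction z with
        | zero => simp
        | add a b ha hb => simp only [map_add, ha, hb]
        | tmul a b =>
          induction b with
          | zero => simp
          | add b c hb hc => simp only [map_add, hb, hc, tmul_add]
          | tmul b c => simp
      have h3 : lift φ - LinearMap.toSpanSingleton K _ (wd []) ∘ₗ counit =
          consT ∘ₗ TensorProduct.map φ (lift φ) ∘ₗ comul := LinearMap.ext fun t => by
        conv_lhs => rw [LinearMap.sub_apply, lift_eq hφ]
        simp
      have h4 : TensorProduct.map (LinearMap.toSpanSingleton K (Tens K I) (wd []) ∘ₗ counit) (lift φ)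
          (comul (wd w)) = wd [] ⊗ₜ lift φ (wd w) := by
        cases w with
        | nil => simp
        | cons i w =>
          rw [comul_wd_cons, map_add, map_apply_comp]
          have : (counit : Tens K I →ₗ[K] K) ∘ₗ cons (Finsupp.single i 1) = 0 :=
            LinearMap.ext fun t => counit_cons _ t
          rw [LinearMap.comp_assoc, this]
          simp
      conv_lhs => rw [lift_eq hφ, map_add, comul_consT, h1, ← comul_coassoc, h2]
      rw [LinearEquiv.symm_apply_apply, map_apply_comp, LinearMap.comp_assoc, ← h3,
        LinearMap.comp_id, map_sub_left', h4, map_smul, comul_nil]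
      conv_lhs => rw [lift_eq hφ (wd w), tmul_add, tmul_smul]
      abel
  have : comul ∘ₗ lift φ = TensorProduct.map (lift φ) (lift φ) ∘ₗ comul :=
    tens_ext fun w => key _ w rfl
  exact LinearMap.congr_fun this t

theorem counit_lift (hφ : φ (wd []) = 0) (t : Tens K I) : counit (lift φ t) = counit t := by
  rw [lift_eq hφ, map_add, counit_consT]
  simp

theorem letter_lift (hφ : φ (wd []) = 0) (t : Tens K I) : letter (lift φ t) = φ t := by
  rw [lift_eq hφ, map_add, letter_consT, map_apply_comp]
  have h : counit ∘ₗ lift φ = counit := LinearMap.ext (counit_lift hφ)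
  have h' := map_apply_comp φ LinearMap.id LinearMap.id counit (comul t)
  rw [LinearMap.id_comp, LinearMap.comp_id] at h'
  rw [h, LinearMap.id_comp, ← h', comul_counit]
  simp

theorem isCohom_lift (hφ : φ (wd []) = 0)
    (hs : ∀ (c : Kˣ) t, scaleV δ c (φ t) = φ (scale δ c t)) : IsCohom δ (lift φ) where
  comul_apply := comul_lift hφ
  counit_apply := counit_lift hφ
  nil := lift_nil φ
  scale_apply c t := by
    have h : scaleV δ c ∘ₗ φ = φ ∘ₗ scale δ c := LinearMap.ext (hs c)
    have key : ∀ n : ℕ, ∀ w : List I, w.length = n →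
        scale δ c (lift φ (wd w)) = lift φ (scale δ c (wd w)) := by
      intro n
      induction n using Nat.strong_induction_on with
      | _ n ih =>
        intro w hw
        conv_lhs => rw [lift_eq hφ, map_add, scale_consT, map_apply_comp, h]
        conv_rhs => rw [lift_eq hφ, comul_scale, map_apply_comp]
        rw [map_congr_of_shorter (g := lift φ ∘ₗ scale δ c) (by simp [hφ]) fun u hu => by
          simpa using ih _ (hw ▸ hu) u rfl]
        rw [counit_scale]
        simp
    have : scale δ c ∘ₗ lift φ = lift φ ∘ₗ scale δ c := tens_ext fun w => key _ w rfl
    exact LinearMap.congr_fun this t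

/-- The span of the words of length less than `n`. -/
def lenLT (K I : Type*) [Field K] (n : ℕ) : Submodule K (Tens K I) :=
  Submodule.span K (wd '' {w | w.length < n})

theorem wd_mem_lenLT {w : List I} {n : ℕ} (h : w.length < n) : (wd w : Tens K I) ∈ lenLT K I n :=
  Submodule.subset_span ⟨w, h, rfl⟩

theorem map_mem_of_lenLT {n : ℕ} {N : Type*} [AddCommGroup N] [Module K N] {S : Submodule K N}
    {f : Tens K I →ₗ[K] N} (h : ∀ w : List I, w.length < n → f (wd w) ∈ S)
    {t : Tens K I} (ht : t ∈ lenLT K I n) : f t ∈ S := by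
  have : lenLT K I n ≤ S.comap f := by
    rw [lenLT, Submodule.span_le]
    rintro _ ⟨w, hw, rfl⟩
    exact h w hw
  exact this ht

theorem lenLT_mono {m n : ℕ} (h : m ≤ n) : lenLT K I m ≤ lenLT K I n :=
  Submodule.span_mono (Set.image_mono fun _ hw => lt_of_lt_of_le hw h)

theorem cons_mem_lenLT {n : ℕ} (v : I →₀ K) {t : Tens K I} (ht : t ∈ lenLT K I n) :
    cons v t ∈ lenLT K I (n + 1) := by
  refine map_mem_of_lenLT (fun w hw => ?_) ht
  have : ∀ v : I →₀ K, cons v (wd w) ∈ lenLT K I (n + 1) := fun v => by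
    induction v using Finsupp.induction_linear with
    | zero => simp
    | add f g hf hg => simpa using Submodule.add_mem _ hf hg
    | single i a =>
      have : (Finsupp.single i a : I →₀ K) = a • Finsupp.single i 1 := by simp
      rw [this, map_smul, LinearMap.smul_apply, cons_single_wd]
      exact Submodule.smul_mem _ _ (wd_mem_lenLT (by simpa using hw))
  exact this v

theorem exists_mem_lenLT (t : Tens K I) : ∃ n, t ∈ lenLT K I n := by
  have : LinearMap.id = ofWords (K := K) (wd (I := I)) := tens_ext fun w => by simp
  have ht : t = ofWords wd t := LinearMap.congr_fun this t
  have ht' : t = (t : List I →₀ K).sum fun w a => a • wd w := ht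
  refine ⟨(Finsupp.support (t : List I →₀ K)).sup List.length + 1, ?_⟩
  have h : ((t : List I →₀ K).sum fun w a => a • (wd w : Tens K I)) ∈
      lenLT K I ((Finsupp.support (t : List I →₀ K)).sup List.length + 1) :=
    Submodule.sum_mem _ fun w hw => Submodule.smul_mem _ _
      (wd_mem_lenLT (Nat.lt_succ_of_le (Finset.le_sup hw)))
  rwa [← ht'] at h

/-- `N` lowers the length filtration, so it is locally nilpotent: the geometric series for the
inverse stops on every element. -/
theorem bijective_one_add {N : Tens K I →ₗ[K] Tens K I}
    (hN : ∀ w : List I, N (wd w) ∈ lenLT K I w.length) :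
    Function.Bijective (LinearMap.id + N : Tens K I →ₗ[K] Tens K I) := by
  constructor
  · rw [injective_iff_map_eq_zero]
    intro t ht
    have ht' : t = -N t := by
      rw [LinearMap.add_apply, LinearMap.id_apply] at ht
      exact eq_neg_of_add_eq_zero_left ht
    have : ∀ n, t ∈ lenLT K I n → t = 0 := by
      intro n
      induction n with
      | zero => intro h; simpa [lenLT] using h
      | succ n ih =>
        intro h
        refine ih ?_
        rw [ht']
        exact Submodule.neg_mem _ (map_mem_of_lenLT
          (fun w hw => lenLT_mono (Nat.lt_succ_iff.1 hw) (hN w)) h)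
    obtain ⟨n, hn⟩ := exists_mem_lenLT t
    exact this n hn
  · rw [← LinearMap.range_eq_top, eq_top_iff]
    have key : ∀ n : ℕ, lenLT K I n ≤ LinearMap.range (LinearMap.id + N : Tens K I →ₗ[K] Tens K I) := by
      intro n
      induction n with
      | zero => simp [lenLT]
      | succ n ih =>
        rw [lenLT, Submodule.span_le]
        rintro _ ⟨w, hw, rfl⟩
        have h1 : (wd w : Tens K I) = (LinearMap.id + N : Tens K I →ₗ[K] Tens K I) (wd w) - N (wd w) := by simp
        rw [h1]
        exact Submodule.sub_mem _ (LinearMap.mem_range_self _ _)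
          (ih (lenLT_mono (Nat.lt_succ_iff.1 hw) (hN w)))
    intro t _
    obtain ⟨n, hn⟩ := exists_mem_lenLT t
    exact key n hn

/-- The algebra map induced by a linear map on letters. -/
def mapWords (L : (I →₀ K) →ₗ[K] (I →₀ K)) : Tens K I →ₗ[K] Tens K I :=
  ofWords (List.foldr (fun i t => cons (L (Finsupp.single i 1)) t) (wd []))

theorem mapWords_nil (L : (I →₀ K) →ₗ[K] (I →₀ K)) : mapWords L (wd []) = wd [] := by
  simp [mapWords]

theorem mapWords_cons (L : (I →₀ K) →ₗ[K] (I →₀ K)) (v : I →₀ K) (t : Tens K I) :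
    mapWords L (cons v t) = cons (L v) (mapWords L t) := by
  have : (cons : _ →ₗ[K] _ →ₗ[K] Tens K I).compr₂ (mapWords L) =
      cons.compl₁₂ L (mapWords L) := cons_ext fun i w => by simp [mapWords]
  exact LinearMap.congr_fun₂ this v t

theorem mapWords_mapWords {L L' : (I →₀ K) →ₗ[K] (I →₀ K)} (h : ∀ v, L (L' v) = v)
    (t : Tens K I) : mapWords L (mapWords L' t) = t := by
  have : mapWords L ∘ₗ mapWords L' = LinearMap.id := tens_ext fun w => by
    induction w with
    | nil => simp [mapWords_nil]
    | cons i w ih =>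
      rw [← cons_single_wd, LinearMap.comp_apply, mapWords_cons, mapWords_cons, h]
      rw [LinearMap.comp_apply] at ih
      rw [ih]
      simp
  exact LinearMap.congr_fun this t

theorem mapWords_mem_lenLT (L : (I →₀ K) →ₗ[K] (I →₀ K)) {n : ℕ} {t : Tens K I}
    (ht : t ∈ lenLT K I n) : mapWords L t ∈ lenLT K I n := by
  refine map_mem_of_lenLT (fun w hw => ?_) ht
  refine lenLT_mono hw ?_
  clear hw ht
  induction w with
  | nil => rw [mapWords_nil]; exact wd_mem_lenLT (by simp)
  | cons i w ih =>
    rw [← cons_single_wd, mapWords_cons]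
    exact cons_mem_lenLT _ ih

theorem lift_mem_lenLT (φ : Tens K I →ₗ[K] (I →₀ K)) {n : ℕ} :
    ∀ w : List I, w.length < n → lift φ (wd w) ∈ lenLT K I n := by
  induction n using Nat.strong_induction_on with
  | _ n ih =>
    intro w hw
    cases w with
    | nil => rw [lift_nil]; exact wd_mem_lenLT hw
    | cons i w =>
      rw [lift_wd_cons]
      rw [List.length_cons] at hw
      obtain ⟨n, rfl⟩ : ∃ m, n = m + 1 := ⟨n - 1, by omega⟩
      refine Submodule.sum_mem _ fun j _ => cons_mem_lenLT _ (ih n (by omega) _ (by simp; omega))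

/-- Modulo shorter words only the decomposition into single letters survives, and it acts by `L` on
every letter. Up to this invertible map, `lift φ` is the identity plus a length-lowering map. -/
theorem bijective_lift {φ : Tens K I →ₗ[K] (I →₀ K)} (L : (I →₀ K) ≃ₗ[K] (I →₀ K))
    (hL : ∀ i, φ (wd [i]) = L (Finsupp.single i 1)) : Function.Bijective (lift φ) := by
  have h1 : ∀ w : List I, (lift φ - mapWords L.toLinearMap) (wd w) ∈ lenLT K I w.length := by
    intro w
    induction w with
    | nil => simp [mapWords_nil]
    | cons i w ih =>
      rw [LinearMap.sub_apply, lift_wd_cons, ← cons_single_wd, mapWords_cons,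
        Finset.sum_range_succ', add_sub_assoc, List.length_cons]
      refine Submodule.add_mem _ (Submodule.sum_mem _ fun j hj => ?_) ?_
      · exact cons_mem_lenLT _ (lift_mem_lenLT φ _ (by
          have := Finset.mem_range.1 hj; simp; omega))
      · simp only [List.take_zero, List.drop_zero, hL, LinearEquiv.coe_coe]
        rw [← map_sub]
        exact cons_mem_lenLT _ ih
  have h2 : ∀ w : List I, (mapWords L.symm.toLinearMap ∘ₗ (lift φ - mapWords L.toLinearMap)) (wd w)
      ∈ lenLT K I w.length := fun w => mapWords_mem_lenLT _ (h1 w)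
  have h3 := bijective_one_add h2
  have hA : Function.Bijective (mapWords L.toLinearMap) :=
    Function.bijective_iff_has_inverse.2 ⟨mapWords L.symm.toLinearMap,
      mapWords_mapWords (by simp), mapWords_mapWords (by simp)⟩
  have : (lift φ : Tens K I → Tens K I) = mapWords L.toLinearMap ∘ (LinearMap.id +
      mapWords L.symm.toLinearMap ∘ₗ (lift φ - mapWords L.toLinearMap) :
        Tens K I →ₗ[K] Tens K I) := by
    funext t
    simp only [Function.comp_apply, LinearMap.add_apply, LinearMap.id_apply, LinearMap.comp_apply,
      map_add]
    rw [mapWords_mapWords (by simp)]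
    simp
  rw [this]
  exact hA.comp h3

end Lift

/-! ### The signed shuffle product and its compatibility with the coproduct. -/

section Shuffle

variable {K I : Type*} [Field K] (δ : I → ℤ)

/-- The signed shuffle product of two words. -/
def shWord : List I → List I → Tens K I
  | [], v => wd v
  | i :: u, [] => wd (i :: u)
  | i :: u, j :: v => cons (Finsupp.single i 1) (shWord u (j :: v)) +
      (((-1) ^ (δ j * wdeg δ (i :: u)) : Kˣ) : K) • cons (Finsupp.single j 1) (shWord (i :: u) v)
termination_by u v => u.length + v.length

/-- The signed shuffle product. -/
def sh : Tens K I →ₗ[K] Tens K I →ₗ[K] Tens K I := ofWords fun u => ofWords (shWord δ u)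

@[simp] theorem sh_nil_left : sh δ (wd [] : Tens K I) = LinearMap.id :=
  tens_ext fun v => by simp [sh, shWord]

@[simp] theorem sh_nil_right (t : Tens K I) : sh δ t (wd []) = t := by
  have : (sh δ).flip (wd []) = (LinearMap.id : Tens K I →ₗ[K] _) :=
    tens_ext fun v => by cases v <;> simp [sh, shWord]
  exact LinearMap.congr_fun this t

/-- The first letter of a shuffle comes from one of the two factors; coming from the second, it
crosses the whole left word. -/
theorem sh_cons (i : I) (u : List I) (v : I →₀ K) (t : Tens K I) :
    sh δ (wd (i :: u)) (cons v t) =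
      cons (Finsupp.single i 1) (sh δ (wd u) (cons v t)) +
      cons (twistV δ (wdeg δ (i :: u)) v) (sh δ (wd (i :: u)) t) := by
  have : (cons : _ →ₗ[K] _ →ₗ[K] Tens K I).compr₂ (sh δ (wd (i :: u))) =
      cons.compr₂ (cons (Finsupp.single i 1) ∘ₗ sh δ (wd u)) +
      cons.compl₁₂ (twistV δ (wdeg δ (i :: u))) (sh δ (wd (i :: u))) := cons_ext fun j v => by
    simp only [LinearMap.compr₂_apply, cons_single_wd, LinearMap.add_apply,
      LinearMap.compl₁₂_apply, LinearMap.comp_apply, twistV, scaleV_single, map_smul,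
      LinearMap.smul_apply, ← zpow_mul]
    simp [sh, shWord, mul_comm (δ j)]
  exact LinearMap.congr_fun₂ this v t

theorem counit_sh (s t : Tens K I) : counit (sh δ s t) = counit s * counit t := by
  have : (sh δ).compr₂ counit = (LinearMap.mul K K).compl₁₂ (counit (I := I)) counit :=
    tens_ext fun u => tens_ext fun v => by
      match u, v with
      | [], v => simp
      | i :: u, [] => simp
      | i :: u, j :: v =>
        simp only [LinearMap.compr₂_apply, LinearMap.compl₁₂_apply]
        rw [← cons_single_wd j, sh_cons, map_add, counit_cons, counit_cons]
        simp
  exact LinearMap.congr_fun₂ this s t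

theorem letter_sh (s t : Tens K I) :
    letter (sh δ s t) = counit s • letter t + counit t • letter s := by
  have : (sh δ).compr₂ letter = (LinearMap.lsmul K (I →₀ K)).compl₁₂ counit letter +
      ((LinearMap.lsmul K (I →₀ K)).compl₁₂ counit letter).flip :=
    tens_ext fun u => tens_ext fun v => by
      match u, v with
      | [], v => cases v <;> simp
      | i :: u, [] => simp
      | i :: u, j :: v =>
        simp only [LinearMap.compr₂_apply, LinearMap.compl₁₂_apply, LinearMap.add_apply,
          LinearMap.flip_apply]
        rw [← cons_single_wd j, sh_cons, map_add, letter_cons, letter_cons, counit_sh, counit_sh]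
        simp
  exact LinearMap.congr_fun₂ this s t

theorem scale_sh (c : Kˣ) (s t : Tens K I) :
    scale δ c (sh δ s t) = sh δ (scale δ c s) (scale δ c t) := by
  have key : ∀ u v : List I, scale δ c (sh δ (wd u) (wd v)) =
      sh δ (scale δ c (wd u)) (scale δ c (wd v)) := by
    intro u
    induction u with
    | nil => intro v; simp
    | cons i u ihu =>
      intro v
      induction v with
      | nil => simp
      | cons j v ihv =>
        have h : scale δ c (wd (i :: u)) = ((c ^ wdeg δ (i :: u) : Kˣ) : K) • wd (i :: u) :=
          scale_wd δ c _
        rw [← cons_single_wd j, sh_cons, map_add, scale_cons, scale_cons, cons_single_wd, ihu, ihv,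
          twistV, scaleV_scaleV, mul_comm c, ← scaleV_scaleV, h, ← cons_single_wd j v,
          scale_cons, map_smul, LinearMap.smul_apply, LinearMap.smul_apply, sh_cons,
          ← scale_cons, smul_add]
        rw [scale_wd, map_smul, LinearMap.smul_apply, map_smul, scaleV_single, map_smul,
          LinearMap.smul_apply, smul_smul]
        simp only [wdeg_cons, zpow_add, Units.val_mul, map_smul, twistV, mul_comm]
  have : (sh δ).compr₂ (scale δ c) = (sh δ).compl₁₂ (scale δ c) (scale δ c) :=
    tens_ext fun u => tens_ext fun v => key u v
  exact LinearMap.congr_fun₂ this s t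

theorem twist_sh (p : ℤ) (u : List I) (t : Tens K I) :
    twist δ p (sh δ (wd u) t) =
      (((-1) ^ (p * wdeg δ u) : Kˣ) : K) • sh δ (wd u) (twist δ p t) := by
  rw [twist, scale_sh, scale_wd, ← zpow_mul, map_smul, LinearMap.smul_apply]

/-- The action of `u ⊗ u'` on a tensor product by shuffling, with Koszul sign. -/
def shPairAux (u : List I) : Tens K I →ₗ[K] (Tens K I ⊗[K] Tens K I →ₗ[K] Tens K I ⊗[K] Tens K I)
    where
  toFun a := TensorProduct.map (sh δ a ∘ₗ twist δ (wdeg δ u)) (sh δ (wd u))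
  map_add' a b := by rw [map_add, LinearMap.add_comp, TensorProduct.map_add_left]
  map_smul' c a := by
    rw [map_smul, LinearMap.smul_comp, TensorProduct.map_smul_left, RingHom.id_apply]

/-- The componentwise shuffle product on a tensor product, with Koszul sign. -/
def shPair : Tens K I ⊗[K] Tens K I →ₗ[K]
    (Tens K I ⊗[K] Tens K I →ₗ[K] Tens K I ⊗[K] Tens K I) :=
  TensorProduct.lift (ofWords (shPairAux δ)).flip

theorem shPair_tmul (a : Tens K I) (u : List I) : shPair δ (a ⊗ₜ[K] wd u) =
    TensorProduct.map (sh δ a ∘ₗ twist δ (wdeg δ u)) (sh δ (wd u)) := by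
  simp [shPair, shPairAux]

theorem shPair_step (i : I) (u u' : List I) (j : I) (z : Tens K I ⊗[K] Tens K I) :
    shPair δ (wd (i :: u) ⊗ₜ[K] wd u') (TensorProduct.map (cons (Finsupp.single j 1)) .id z) =
      TensorProduct.map (cons (Finsupp.single i 1)) .id (shPair δ (wd u ⊗ₜ[K] wd u')
        (TensorProduct.map (cons (Finsupp.single j 1)) .id z)) +
      TensorProduct.map (cons (twistV δ (wdeg δ (i :: (u ++ u'))) (Finsupp.single j 1))) .id
        (shPair δ (wd (i :: u) ⊗ₜ[K] wd u') z) := by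
  induction z with
  | zero => simp
  | add a b ha hb => simp only [map_add, ha, hb]; abel
  | tmul a b =>
    simp only [shPair_tmul, map_tmul, LinearMap.comp_apply, LinearMap.id_apply]
    rw [← add_tmul, twist, scale_cons, sh_cons]
    congr 3
    rw [twistV, twistV, scaleV_scaleV, ← zpow_add]
    congr 3
    simp [wdeg, add_assoc]

/-- Shuffle product and deconcatenation form a graded bialgebra: cutting a shuffle amounts to
cutting both words and shuffling the corresponding parts. Double induction on the words. -/
theorem comul_sh (s t : Tens K I) : comul (sh δ s t) = shPair δ (comul s) (comul t) := by
  have key : ∀ u v : List I, comul (sh δ (wd u) (wd v)) =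
      shPair δ (comul (wd u : Tens K I)) (comul (wd v)) := by
    intro u
    induction u with
    | nil => intro v; simp [shPair_tmul]
    | cons i u ihu =>
      intro v
      induction v with
      | nil =>
        rw [sh_nil_right, comul_nil, comul_wd (i :: u), map_sum, LinearMap.sum_apply]
        simp [shPair_tmul]
      | cons j v ihv =>
        have h1 : shPair δ (TensorProduct.map (cons (Finsupp.single i 1)) .id (comul (wd u)))
            (TensorProduct.map (cons (Finsupp.single j 1)) .id (comul (wd v))) =
            TensorProduct.map (cons (Finsupp.single i 1)) .id (shPair δ (comul (wd u))
              (TensorProduct.map (cons (Finsupp.single j 1)) .id (comul (wd v)))) +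
            TensorProduct.map (cons (twistV δ (wdeg δ (i :: u)) (Finsupp.single j (1 : K)))) .id
              (shPair δ (TensorProduct.map (cons (Finsupp.single i 1)) .id (comul (wd u)))
                (comul (wd v))) := by
          simp only [comul_wd u, map_sum, LinearMap.sum_apply, map_tmul, LinearMap.id_apply,
            cons_single_wd, ← Finset.sum_add_distrib]
          refine Finset.sum_congr rfl fun k _ => ?_
          rw [shPair_step, List.take_append_drop]
        have h2 : ∀ z, shPair δ (wd [] ⊗ₜ[K] wd (i :: u))
            (TensorProduct.map (cons (Finsupp.single j (1 : K))) .id z) =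
            TensorProduct.map (cons (twistV δ (wdeg δ (i :: u)) (Finsupp.single j (1 : K)))) .id
              (shPair δ (wd [] ⊗ₜ[K] wd (i :: u)) z) := by
          intro z
          simp only [shPair_tmul, sh_nil_left, LinearMap.id_comp]
          rw [map_apply_comp, map_apply_comp]
          congr 2
          exact LinearMap.ext fun t => scale_cons δ _ _ t
        have h3 : shPair δ (TensorProduct.map (cons (Finsupp.single i 1)) .id (comul (wd u)))
            (wd [] ⊗ₜ wd (j :: v)) = TensorProduct.map (cons (Finsupp.single i (1 : K))) .id
              (shPair δ (comul (wd u)) (wd [] ⊗ₜ wd (j :: v))) := by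
          simp only [comul_wd u, map_sum, LinearMap.sum_apply, map_tmul, LinearMap.id_apply,
            cons_single_wd]
          refine Finset.sum_congr rfl fun k _ => ?_
          simp [shPair_tmul]
        have h4 : shPair δ (wd [] ⊗ₜ[K] wd (i :: u)) (wd [] ⊗ₜ wd (j :: v)) =
            wd [] ⊗ₜ sh δ (wd (i :: u) : Tens K I) (wd (j :: v)) := by
          simp [shPair_tmul]
        rw [comul_wd_cons j v, comul_wd_cons i u]
        simp only [map_add, LinearMap.add_apply]
        rw [h1, h2, h3, h4, ← cons_single_wd j v, sh_cons, map_add, comul_cons, comul_cons,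
          cons_single_wd, ihu, ihv, comul_wd_cons j v, comul_wd_cons i u]
        simp only [map_add, LinearMap.add_apply, tmul_add]
        abel
  have : (sh δ).compr₂ comul = (shPair δ).compl₁₂ comul comul :=
    tens_ext fun u => tens_ext fun v => key u v
  exact LinearMap.congr_fun₂ this s t

/-- A single letter is primitive, so multiplicativity of the coproduct becomes the co-Leibniz rule.
Graded symmetrization is an iteration of these coderivations. -/
theorem isCoder_letter (i : I) : IsCoder δ (δ i) (sh δ (wd [i] : Tens K I)) where
  comul_apply t := by
    rw [comul_sh]
    have : comul (wd [i] : Tens K I) = wd [] ⊗ₜ wd [i] + wd [i] ⊗ₜ wd [] := by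
      rw [comul_wd_cons]
      simp
    rw [this, map_add, LinearMap.add_apply, shPair_tmul, shPair_tmul]
    simp [add_comm]
  counit_apply t := by rw [counit_sh]; simp
  scale_apply c t := by
    rw [scale_sh, scale_wd, map_smul, LinearMap.smul_apply]
    simp

variable {δ}

/-- The sign in `shPair` depends only on the parity of the right factor. Hence the formula for words
extends to any tensor of definite parity, such as the image of a word under a homogeneous map. -/
theorem shPair_tmul_of_twist [CharZero K] (a : Tens K I) {s : Tens K I} {d : ℤ}
    (hs : twist δ 1 s = (((-1) ^ d : Kˣ) : K) • s) : shPair δ (a ⊗ₜ[K] s) =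
    TensorProduct.map (sh δ a ∘ₗ twist δ d) (sh δ s) := by
  let f : Tens K I →ₗ[K] (Tens K I ⊗[K] Tens K I →ₗ[K] Tens K I ⊗[K] Tens K I) :=
    shPair δ ∘ₗ TensorProduct.mk K _ _ a -
      TensorProduct.mapBilinear (.id K) _ _ _ _ (sh δ a ∘ₗ twist δ d) ∘ₗ sh δ
  -- The operator in parentheses kills the words of the wrong parity and doubles `s`, while `f`
  -- vanishes on the words of the right parity. Dividing by two gives `f s = 0`.
  have hf : f ∘ₗ (LinearMap.id + (((-1) ^ d : Kˣ) : K) • twist δ 1) = 0 := tens_ext fun w => by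
    have h1 : (LinearMap.id + (((-1) ^ d : Kˣ) : K) • twist δ 1 : Tens K I →ₗ[K] Tens K I) (wd w) =
        (1 + (((-1) ^ (d + wdeg δ w) : Kˣ) : K)) • (wd w : Tens K I) := by
      simp only [LinearMap.add_apply, LinearMap.smul_apply, LinearMap.id_apply, twist, scale_wd,
        smul_smul, add_smul, one_smul, zpow_add, Units.val_mul, zpow_one]
    rw [LinearMap.comp_apply, h1, map_smul, LinearMap.zero_apply]
    rcases Int.even_or_odd (d + wdeg δ w) with h | h
    · have : (twist δ d : Tens K I →ₗ[K] _) = twist δ (wdeg δ w) := by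
        have h2 : ((-1 : Kˣ) ^ d) = (-1) ^ wdeg δ w := by
          have := h.neg_one_zpow (α := Kˣ)
          rw [zpow_add] at this
          rw [eq_inv_of_mul_eq_one_left this, ← zpow_neg]
          rcases Int.even_or_odd (wdeg δ w) with h | h
          · rw [h.neg_one_zpow, h.neg.neg_one_zpow]
          · rw [h.neg_one_zpow, h.neg.neg_one_zpow]
        rw [twist, twist, h2]
      have : f (wd w) = 0 := by
        simp only [f, LinearMap.sub_apply, LinearMap.comp_apply, TensorProduct.mk_apply,
          shPair_tmul, this]
        simp
      rw [this, smul_zero]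
    · rw [h.neg_one_zpow]
      simp
  have h2 := LinearMap.congr_fun hf s
  simp only [LinearMap.comp_apply, LinearMap.add_apply, LinearMap.id_apply, LinearMap.smul_apply,
    hs, smul_smul, ← Units.val_mul, ← mul_zpow] at h2
  have h3 : f s = 0 := by
    have h4 : (2 : K) • f s = 0 := by
      rw [← map_smul, two_smul]
      simpa using h2
    exact (smul_eq_zero.1 h4).resolve_left two_ne_zero
  simpa [f, sub_eq_zero] using h3

variable (δ) in
/-- Functionals vanishing on signed shuffle products of nonempty words. -/
def KillsShuffles (β : Tens K I →ₗ[K] (I →₀ K)) : Prop :=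
  ∀ u v : List I, u ≠ [] → v ≠ [] → β (sh δ (wd u) (wd v)) = 0

/-- A coderivation whose corestriction vanishes on shuffles is a derivation for the shuffle
product. -/
theorem IsCoder.apply_sh [CharZero K] {p : ℤ} {X : Tens K I →ₗ[K] Tens K I} (hX : IsCoder δ p X)
    (hX0 : X (wd []) = 0) (hs : KillsShuffles δ (letter ∘ₗ X)) (u : List I) (t : Tens K I) :
    X (sh δ (wd u) t) = sh δ (X (wd u)) t +
      (((-1) ^ (p * wdeg δ u) : Kˣ) : K) • sh δ (wd u) (X t) := by
  -- `E u` is the defect of the Leibniz rule. It is shown to obey a co-Leibniz rule and to have zero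
  -- corestriction, so that it vanishes.
  let E : List I → Tens K I →ₗ[K] Tens K I := fun u => X ∘ₗ sh δ (wd u) - sh δ (X (wd u)) -
    (((-1) ^ (p * wdeg δ u) : Kˣ) : K) • sh δ (wd u) ∘ₗ X
  suffices h : ∀ n : ℕ, ∀ u : List I, u.length = n → E u = 0 by
    have := LinearMap.congr_fun (h _ u rfl) t
    simp only [E, LinearMap.sub_apply, LinearMap.comp_apply,
      LinearMap.zero_apply, sub_sub, sub_eq_zero] at this
    exact this
  intro n
  induction n using Nat.strong_induction_on with
  | _ n ih =>
    intro u hu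
    by_cases hu0 : u = []
    · subst hu0
      simp [E, hX0]
    -- For each cut of `u`, the coproduct of the defect splits into the defect of the prefix and
    -- that of the suffix.
    have hstep : ∀ (u' u'' : List I), wdeg δ u = wdeg δ u' + wdeg δ u'' →
        ∀ z, TensorProduct.map X .id (shPair δ (wd u' ⊗ₜ wd u'') z) +
          TensorProduct.map (twist δ p) X (shPair δ (wd u' ⊗ₜ wd u'') z) -
          shPair δ (TensorProduct.map X .id (wd u' ⊗ₜ wd u'') +
            TensorProduct.map (twist δ p) X (wd u' ⊗ₜ wd u'')) z -
          (((-1) ^ (p * wdeg δ u) : Kˣ) : K) • shPair δ (wd u' ⊗ₜ wd u'')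
            (TensorProduct.map X .id z + TensorProduct.map (twist δ p) X z) =
        TensorProduct.map (E u' ∘ₗ twist δ (wdeg δ u'')) (sh δ (wd u'')) z +
          (((-1) ^ (p * wdeg δ u') : Kˣ) : K) •
            TensorProduct.map (sh δ (wd u') ∘ₗ twist δ (wdeg δ u'' + p)) (E u'') z := by
      intro u' u'' hdeg z
      have h1 : twist δ 1 (X (wd u'')) = (((-1) ^ (wdeg δ u'' + p) : Kˣ) : K) • X (wd u'') := by
        rw [hX.twist_apply, twist, scale_wd, map_smul, smul_smul, ← Units.val_mul, ← zpow_mul,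
          ← zpow_add]
        congr 3
        ring
      simp only [map_tmul, map_add, LinearMap.add_apply, LinearMap.id_apply]
      rw [shPair_tmul_of_twist _ h1, shPair_tmul, shPair_tmul]
      induction z with
      | zero => simp
      | add a b ha hb =>
        simp only [map_add, smul_add] at ha hb ⊢
        rw [← sub_eq_zero] at ha hb ⊢
        rw [← add_zero (0 : Tens K I ⊗[K] Tens K I)]
        nth_rewrite 1 [← ha]
        rw [← hb]
        abel
      | tmul a b =>
        have h2 : twist δ p (wd u') = (((-1) ^ (p * wdeg δ u') : Kˣ) : K) • (wd u' : Tens K I) := by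
          rw [twist, scale_wd, ← zpow_mul]
        have h3 : (((-1) ^ (p * wdeg δ u) : Kˣ) : K) * (((-1) ^ (wdeg δ u'' * p) : Kˣ) : K) =
            (((-1) ^ (p * wdeg δ u') : Kˣ) : K) := by
          rw [← Units.val_mul, ← zpow_add, hdeg, mul_add, mul_comm p (wdeg δ u''), add_assoc,
            ← two_mul, zpow_add, zpow_mul (-1 : Kˣ) 2]
          simp
        have h4 : (((-1) ^ (p * wdeg δ u) : Kˣ) : K) =
            (((-1) ^ (p * wdeg δ u') : Kˣ) : K) * (((-1) ^ (p * wdeg δ u'') : Kˣ) : K) := by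
          rw [← Units.val_mul, ← zpow_add, hdeg, mul_add]
        simp only [map_tmul, LinearMap.comp_apply, LinearMap.id_apply, E, LinearMap.sub_apply,
          LinearMap.smul_apply, twist_sh, sub_tmul, tmul_sub, h2, map_smul, tmul_smul,
          smul_tmul', hX.twist_apply, twist_twist, smul_add, smul_sub, smul_smul, h3]
        rw [add_comm p (wdeg δ u''), h4]
        abel
    -- Proper prefixes and suffixes have zero defect by induction, so only the two extreme cuts
    -- remain.
    have hE : ∀ t, comul (E u t) = TensorProduct.map (E u) .id (comul t) +
        TensorProduct.map (twist δ (wdeg δ u + p)) (E u) (comul t) := by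
      intro t
      have e1 : comul (E u t) = ∑ k ∈ Finset.range (u.length + 1),
          (TensorProduct.map (E (u.take k) ∘ₗ twist δ (wdeg δ (u.drop k)))
            (sh δ (wd (u.drop k))) (comul t) + (((-1) ^ (p * wdeg δ (u.take k)) : Kˣ) : K) •
            TensorProduct.map (sh δ (wd (u.take k)) ∘ₗ twist δ (wdeg δ (u.drop k) + p))
              (E (u.drop k)) (comul t)) := by
        simp only [E, LinearMap.sub_apply, LinearMap.comp_apply, LinearMap.smul_apply, map_sub,
          map_smul, hX.comul_apply, comul_sh]
        rw [comul_wd u]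
        simp only [map_sum, LinearMap.sum_apply, ← Finset.sum_add_distrib, Finset.smul_sum,
          ← Finset.sum_sub_distrib]
        refine Finset.sum_congr rfl fun k _ => ?_
        refine Eq.trans ?_ (hstep (u.take k) (u.drop k) ?_ (comul t))
        · simp only [map_add, LinearMap.add_apply]
        · conv_lhs => rw [← List.take_append_drop k u]
          simp [wdeg]
      rw [e1, Finset.sum_add_distrib]
      congr 1
      · rw [Finset.sum_eq_single u.length]
        · simp
        · intro k hk hk'
          rw [ih (u.take k).length (by have := Finset.mem_range.1 hk; simp; omega) _ rfl]
          simp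
        · simp
      · rw [Finset.sum_eq_single 0]
        · simp
        · intro k hk hk'
          rw [ih (u.drop k).length (by have := Finset.mem_range.1 hk; simp; omega) _ rfl]
          simp
        · simp
    refine LinearMap.ext fun t => (isSym_id (δ := δ)).eq_zero hE ?_ (twist_nil δ _) ?_ t
    · intro t
      simp [E, hX.counit_apply, counit_sh]
    · intro t
      -- On nonempty words the first term is killed by hypothesis, and the other two are shuffles of
      -- tensors without constant term, which contain no letter.
      have : letter ∘ₗ E u = 0 := tens_ext fun v => by
        obtain ⟨i, u, rfl⟩ := List.exists_cons_of_ne_nil hu0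
        by_cases hv : v = []
        · subst hv
          simp [E, hX0]
        · have := hs (i :: u) v hu0 hv
          rw [LinearMap.comp_apply] at this
          simp [E, this, letter_sh, hX.counit_apply]
          obtain ⟨j, v, rfl⟩ := List.exists_cons_of_ne_nil hv
          simp
      exact LinearMap.congr_fun this t

/-- A coalgebra map whose corestriction vanishes on shuffles is multiplicative for the shuffle
product. -/
theorem IsCohom.apply_sh [CharZero K] {F : Tens K I →ₗ[K] Tens K I} (hF : IsCohom δ F)
    (hs : KillsShuffles δ (letter ∘ₗ F)) (s t : Tens K I) :
    F (sh δ s t) = sh δ (F s) (F t) := by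
  let E : List I → Tens K I →ₗ[K] Tens K I := fun u => F ∘ₗ sh δ (wd u) - sh δ (F (wd u)) ∘ₗ F
  suffices h : ∀ n : ℕ, ∀ u : List I, u.length = n → E u = 0 by
    have : (sh δ).compr₂ F = (sh δ).compl₁₂ F F := tens_ext fun u => by
      have := h _ u rfl
      simp only [E, sub_eq_zero] at this
      exact this
    exact LinearMap.congr_fun₂ this s t
  intro n
  induction n using Nat.strong_induction_on with
  | _ n ih =>
    intro u hu
    by_cases hu0 : u = []
    · subst hu0
      simp [E, hF.nil]
    have hstep : ∀ (u' u'' : List I) (z), TensorProduct.map F F (shPair δ (wd u' ⊗ₜ wd u'') z) -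
          shPair δ (TensorProduct.map F F (wd u' ⊗ₜ wd u'')) (TensorProduct.map F F z) =
        TensorProduct.map (E u' ∘ₗ twist δ (wdeg δ u'')) (F ∘ₗ sh δ (wd u'')) z +
            TensorProduct.map (sh δ (F (wd u')) ∘ₗ F ∘ₗ twist δ (wdeg δ u'')) (E u'') z := by
      intro u' u'' z
      -- `F` preserves degrees, hence parity, so the image of a word may be used in `shPair` like a
      -- word.
      have h1 : twist δ 1 (F (wd u'')) = (((-1) ^ wdeg δ u'' : Kˣ) : K) • F (wd u'') := by
        rw [twist, hF.scale_apply, scale_wd, map_smul, zpow_one]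
      rw [map_tmul, shPair_tmul_of_twist _ h1, shPair_tmul]
      induction z with
      | zero => simp
      | add a b ha hb =>
        simp only [map_add] at ha hb ⊢
        rw [← sub_eq_zero] at ha hb ⊢
        rw [← add_zero (0 : Tens K I ⊗[K] Tens K I)]
        nth_rewrite 1 [← ha]
        rw [← hb]
        abel
      | tmul a b =>
        have h2 : ∀ q t, twist δ q (F t) = F (twist δ q t) := fun q t => hF.scale_apply _ t
        simp only [map_tmul, LinearMap.comp_apply, E, LinearMap.sub_apply,
          sub_tmul, tmul_sub, h2]
        abel
    have hE : ∀ t, comul (E u t) = TensorProduct.map (E u) F (comul t) +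
        TensorProduct.map (F ∘ₗ twist δ (wdeg δ u)) (E u) (comul t) := by
      intro t
      have e1 : comul (E u t) = ∑ k ∈ Finset.range (u.length + 1),
          (TensorProduct.map (E (u.take k) ∘ₗ twist δ (wdeg δ (u.drop k)))
            (F ∘ₗ sh δ (wd (u.drop k))) (comul t) +
            TensorProduct.map (sh δ (F (wd (u.take k))) ∘ₗ F ∘ₗ twist δ (wdeg δ (u.drop k)))
              (E (u.drop k)) (comul t)) := by
        simp only [E, LinearMap.sub_apply, LinearMap.comp_apply, map_sub, hF.comul_apply, comul_sh]
        rw [comul_wd u]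
        simp only [map_sum, LinearMap.sum_apply, ← Finset.sum_sub_distrib]
        exact Finset.sum_congr rfl fun k _ => hstep (u.take k) (u.drop k) (comul t)
      rw [e1, Finset.sum_add_distrib]
      congr 1
      · rw [Finset.sum_eq_single u.length]
        · simp
        · intro k hk hk'
          rw [ih (u.take k).length (by have := Finset.mem_range.1 hk; simp; omega) _ rfl]
          simp
        · simp
      · rw [Finset.sum_eq_single 0]
        · simp [hF.nil]
        · intro k hk hk'
          rw [ih (u.drop k).length (by have := Finset.mem_range.1 hk; simp; omega) _ rfl]
          simp
        · simp
    refine LinearMap.ext fun t => (isSym_id (δ := δ)).eq_zero hE ?_ (by simp [hF.nil]) ?_ t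
    · intro t
      simp [E, hF.counit_apply, counit_sh]
    · intro t
      have : letter ∘ₗ E u = 0 := tens_ext fun v => by
        obtain ⟨i, u, rfl⟩ := List.exists_cons_of_ne_nil hu0
        by_cases hv : v = []
        · subst hv
          simp [E, hF.nil]
        · have := hs (i :: u) v hu0 hv
          rw [LinearMap.comp_apply] at this
          simp [E, this, letter_sh, hF.counit_apply]
          obtain ⟨j, v, rfl⟩ := List.exists_cons_of_ne_nil hv
          simp
      exact LinearMap.congr_fun this t

end Shuffle

/-! ### Graded symmetric tensors inside the tensor coalgebra. -/

section Symmetrization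

variable {K I : Type*} [Field K] (δ : I → ℤ)

/-- The signed sum of all permutations of a word. -/
def symWord : List I → Tens K I
  | [] => wd []
  | i :: w => sh δ (wd [i]) (symWord w)

/-- Graded symmetrization, without normalization. -/
def symm : Tens K I →ₗ[K] Tens K I := ofWords (symWord δ)

/-- The projection to graded symmetric tensors. -/
def symProj : Tens K I →ₗ[K] Tens K I :=
  ofWords fun w => ((w.length.factorial : ℕ) : K)⁻¹ • symWord δ w

@[simp] theorem symm_nil : symm δ (wd [] : Tens K I) = wd [] := by simp [symm, symWord]

theorem symm_wd_cons (i : I) (w : List I) :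
    symm δ (wd (i :: w) : Tens K I) = sh δ (wd [i]) (symm δ (wd w)) := by simp [symm, symWord]

theorem symProj_wd (w : List I) : symProj δ (wd w : Tens K I) =
    ((w.length.factorial : ℕ) : K)⁻¹ • symm δ (wd w) := by simp [symProj, symm]

/-- The graded commutator of the two letter coderivations is again a coderivation and has zero
corestriction, so it vanishes. This replaces a general proof that the shuffle product is commutative
and associative. -/
theorem sh_letter_comm (i j : I) (t : Tens K I) : sh δ (wd [i]) (sh δ (wd [j]) t) =
    (((-1) ^ (δ i * δ j) : Kˣ) : K) • sh δ (wd [j]) (sh δ (wd [i]) t) := by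
  have h := (isCoder_letter (K := K) δ i).bracket (isCoder_letter (K := K) δ j)
  have := IsCoder.ext_of_sym isSym_id h (Y := 0) ⟨fun t => by simp, fun t => by simp,
    fun c t => by simp⟩ (fun t => by simp [letter_sh, counit_sh]) t
  simpa [sub_eq_zero] using this

theorem sh_letter_cons (i j : I) (w : List I) : sh δ (wd [i] : Tens K I) (wd (j :: w)) =
    wd (i :: j :: w) + (((-1) ^ (δ i * δ j) : Kˣ) : K) •
      cons (Finsupp.single j 1) (sh δ (wd [i]) (wd w)) := by
  rw [← cons_single_wd j w, sh_cons]
  simp [twistV, -map_zpow₀, ← zpow_mul, -Finsupp.smul_single]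

theorem symm_cons (v : I →₀ K) (t : Tens K I) :
    symm δ (cons v t) = sh δ (cons v (wd [])) (symm δ t) := by
  have : (cons : _ →ₗ[K] _ →ₗ[K] Tens K I).compr₂ (symm δ) =
      (sh δ).compl₁₂ (cons.flip (wd [])) (symm δ) := cons_ext fun i w => by
    simp [symm_wd_cons]
  exact LinearMap.congr_fun₂ this v t

theorem sh_letter_mem_lenSub (i : I) {n : ℕ} {t : Tens K I} (ht : t ∈ lenSub K I n) :
    sh δ (wd [i]) t ∈ lenSub K I (n + 1) := by
  have hc : ∀ (j : I) {n : ℕ} {t : Tens K I}, t ∈ lenSub K I n →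
      cons (Finsupp.single j 1) t ∈ lenSub K I (n + 1) := by
    intro j n t ht
    have : lenSub K I n ≤ (lenSub K I (n + 1)).comap (cons (Finsupp.single j (1 : K))) := by
      rw [lenSub, Submodule.span_le]
      rintro _ ⟨w, hw, rfl⟩
      simp only [Submodule.comap_coe, Set.mem_preimage, cons_single_wd]
      have hw' : w.length = n := hw
      exact hw' ▸ wd_mem_lenSub (j :: w)
    exact this ht
  have hw : ∀ w : List I, sh δ (wd [i] : Tens K I) (wd w) ∈ lenSub K I (w.length + 1) := by
    intro w
    induction w with
    | nil => simpa using wd_mem_lenSub [i]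
    | cons j w ih =>
      rw [sh_letter_cons]
      exact Submodule.add_mem _ (wd_mem_lenSub (i :: j :: w)) (Submodule.smul_mem _ _ (hc j ih))
  have : lenSub K I n ≤ (lenSub K I (n + 1)).comap (sh δ (wd [i])) := by
    rw [lenSub, Submodule.span_le]
    rintro _ ⟨w, hw', rfl⟩
    have hw' : w.length = n := hw'
    exact hw' ▸ hw w
  exact this ht

theorem symm_mem_lenSub (w : List I) : symm δ (wd w : Tens K I) ∈ lenSub K I w.length := by
  induction w with
  | nil => simpa using wd_mem_lenSub []
  | cons i w ih =>
    rw [symm_wd_cons]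
    exact sh_letter_mem_lenSub δ i ih

/-- Each of the `n + 1` places where the letter can be inserted gives the same symmetrization once
the Koszul sign is taken into account. -/
theorem symm_sh_letter (i : I) (w : List I) : symm δ (sh δ (wd [i]) (wd w) : Tens K I) =
    ((w.length + 1 : ℕ) : K) • symm δ (wd (i :: w)) := by
  induction w with
  | nil => simp
  | cons j w ih =>
    rw [sh_letter_cons, map_add, map_smul, symm_cons, ih, cons_single_wd, symm_wd_cons δ i w,
      map_smul, smul_comm, ← sh_letter_comm, symm_wd_cons δ i, symm_wd_cons δ j, List.length_cons]
    push_cast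
    module

/-- To check a linear identity on symmetric tensors it suffices to check it on symmetrized
words. -/
theorem symProj_induction {N : Type*} [AddCommGroup N] [Module K N] {f g : Tens K I →ₗ[K] N}
    (h : ∀ w : List I, f (symm δ (wd w)) = g (symm δ (wd w))) (t : Tens K I) :
    f (symProj δ t) = g (symProj δ t) := by
  have : f ∘ₗ symProj δ = g ∘ₗ symProj δ := tens_ext fun w => by
    simp only [LinearMap.comp_apply, symProj_wd, map_smul, h]
  exact LinearMap.congr_fun this t

theorem scale_symProj (c : Kˣ) (t : Tens K I) :
    scale δ c (symProj δ t) = symProj δ (scale δ c t) := by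
  have h : ∀ w : List I, scale δ c (symm δ (wd w) : Tens K I) = symm δ (scale δ c (wd w)) := by
    intro w
    induction w with
    | nil => simp
    | cons i w ih =>
      rw [symm_wd_cons, scale_sh, ih, scale_wd, scale_wd, scale_wd, map_smul, map_smul, map_smul,
        map_smul, LinearMap.smul_apply, smul_smul, symm_wd_cons, ← Units.val_mul, ← zpow_add,
        add_comm, wdeg_cons, wdeg_cons, wdeg_nil, add_zero]
  have : scale δ c ∘ₗ symProj δ = symProj δ ∘ₗ scale (K := K) δ c := tens_ext fun w => by
    rw [LinearMap.comp_apply, symProj_wd, map_smul, h, LinearMap.comp_apply, scale_wd, map_smul,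
      map_smul, symProj_wd, smul_comm]
  exact LinearMap.congr_fun this t

/-- On symmetric tensors, a coderivation is given by the unshuffle formula. -/
theorem hat_symm {p : ℤ} {β : Tens K I →ₗ[K] (I →₀ K)}
    (hβ : ∀ (c : Kˣ) t, scaleV δ c (β t) = ((c ^ p : Kˣ) : K) • β (scale δ c t)) (t : Tens K I) :
    hat δ p β (symm δ t) = TensorProduct.lift ((sh δ).comp (cons.flip (wd [])))
      (TensorProduct.map β LinearMap.id (comul (symm δ t))) := by
  have key : ∀ w : List I, hat δ p β (symm δ (wd w)) =
      TensorProduct.lift ((sh δ).comp (cons.flip (wd [])))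
        (TensorProduct.map β LinearMap.id (comul (symm δ (wd w)))) := by
    intro w
    induction w generalizing p β with
    | nil => simp [hat_nil]
    | cons i w ih =>
      set J : Tens K I →ₗ[K] Tens K I := sh δ (wd [i]) with hJ
      have hJc : IsCoder δ (δ i) J := isCoder_letter δ i
      have hβ' : ∀ (c : Kˣ) t, scaleV δ c ((β ∘ₗ J) t) =
          ((c ^ (p + δ i) : Kˣ) : K) • (β ∘ₗ J) (scale δ c t) := fun c t => by
        rw [LinearMap.comp_apply, hβ, hJc.scale_apply, map_smul, smul_smul, zpow_add,
          Units.val_mul]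
        rfl
      -- The bracket of `hat β` with shuffling in a letter is `hat (β ∘ J)`. The induction therefore
      -- runs over the word with `β` and `p` varying.
      have hbr := ((isCoder_hat hβ).bracket hJc).ext (isCoder_hat hβ') fun t => by
        rw [letter_hat]
        simp [hJ, letter_sh, counit_hat]
      have h1 := LinearMap.congr_fun hbr (symm δ (wd w))
      rw [ih hβ', LinearMap.sub_apply, LinearMap.smul_apply, LinearMap.comp_apply,
        LinearMap.comp_apply, ih hβ, sub_eq_iff_eq_add] at h1
      rw [symm_wd_cons, ← hJ, h1, hJc.comul_apply, map_add, map_add, map_apply_comp,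
        map_apply_comp, LinearMap.id_comp]
      congr 1
      have h2 : β ∘ₗ twist δ (δ i) = (((-1) ^ (p * δ i) : Kˣ) : K) • twistV δ (δ i) ∘ₗ β :=
        LinearMap.ext fun t => by
          simp only [LinearMap.comp_apply, LinearMap.smul_apply]
          rw [twistV, hβ, smul_smul, ← Units.val_mul, ← zpow_mul, ← zpow_add, mul_comm (δ i),
            ← two_mul, zpow_mul]
          simp [twist]
      rw [h2, TensorProduct.map_smul_left, LinearMap.smul_apply, map_smul]
      congr 1
      generalize comul (symm δ (wd w : Tens K I)) = z
      induction z with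
      | zero => simp
      | add a b ha hb => simp only [map_add, ha, hb]
      | tmul a b =>
        simp only [map_tmul, LinearMap.comp_apply, LinearMap.id_apply, TensorProduct.lift.tmul,
          LinearMap.flip_apply]
        generalize β a = v
        have : (((sh δ).comp (cons.flip (wd []))).compr₂ J :
            (I →₀ K) →ₗ[K] Tens K I →ₗ[K] Tens K I) =
            ((sh δ).comp (cons.flip (wd [] : Tens K I))).compl₁₂ (twistV δ (δ i)) J := cons_ext fun j u => by
          simp only [LinearMap.compr₂_apply, LinearMap.comp_apply, LinearMap.flip_apply,
            LinearMap.compl₁₂_apply, twistV, scaleV_single, map_smul, LinearMap.smul_apply,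
            cons_single_wd, hJ, sh_letter_comm δ i j, ← zpow_mul]
        exact LinearMap.congr_fun₂ this v b
  have : hat δ p β ∘ₗ symm δ = TensorProduct.lift ((sh δ).comp (cons.flip (wd []))) ∘ₗ
      TensorProduct.map β LinearMap.id ∘ₗ comul ∘ₗ symm δ := tens_ext key
  exact LinearMap.congr_fun this t

variable [CharZero K]

theorem symProj_sh_letter (i : I) (t : Tens K I) :
    symProj δ (sh δ (wd [i]) t) = sh δ (wd [i]) (symProj δ t) := by
  have : symProj δ ∘ₗ sh δ (wd [i]) = sh δ (wd [i]) ∘ₗ symProj (K := K) δ := tens_ext fun w => by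
    have h1 : symProj δ (sh δ (wd [i] : Tens K I) (wd w)) =
        (((w.length + 1).factorial : ℕ) : K)⁻¹ • symm δ (sh δ (wd [i]) (wd w)) :=
      (lenSub_induction (f := (symProj δ : Tens K I →ₗ[K] _))
        (g := (((w.length + 1).factorial : ℕ) : K)⁻¹ • symm δ)
        (fun u hu => by rw [symProj_wd, hu]; rfl)
        (sh_letter_mem_lenSub δ i (wd_mem_lenSub w))).trans (LinearMap.smul_apply _ _ _)
    rw [LinearMap.comp_apply, h1, symm_sh_letter, LinearMap.comp_apply, symProj_wd, map_smul,
      ← symm_wd_cons, smul_smul]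
    congr 1
    have h2 : ((w.length + 1 : ℕ) : K) ≠ 0 := Nat.cast_ne_zero.2 (Nat.succ_ne_zero _)
    have h3 : ((w.length.factorial : ℕ) : K) ≠ 0 := Nat.cast_ne_zero.2 (Nat.factorial_ne_zero _)
    rw [Nat.factorial_succ, Nat.cast_mul]
    field_simp
  exact LinearMap.congr_fun this t

theorem symProj_symm (t : Tens K I) : symProj δ (symm δ t) = symm δ t := by
  have : symProj δ ∘ₗ symm δ = symm (K := K) δ := tens_ext fun w => by
    rw [LinearMap.comp_apply]
    induction w with
    | nil => simp [symProj, symWord]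
    | cons i w ih => rw [symm_wd_cons, symProj_sh_letter, ih]
  exact LinearMap.congr_fun this t

/-- Symmetric words are built by the letter coderivations, which commute with `symProj`, so the
subcoalgebra property spreads from the empty word. -/
theorem map_symProj_comul (w : List I) :
    TensorProduct.map (symProj δ) (symProj δ) (comul (symm δ (wd w) : Tens K I)) =
      comul (symm δ (wd w)) := by
  have h1 : ∀ i, symProj (K := K) δ ∘ₗ sh δ (wd [i]) = sh δ (wd [i]) ∘ₗ symProj δ := fun i =>
    LinearMap.ext (symProj_sh_letter δ i)
  have h2 : ∀ i, symProj (K := K) δ ∘ₗ twist δ (δ i) = twist δ (δ i) ∘ₗ symProj δ := fun i =>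
    LinearMap.ext fun t => (scale_symProj δ _ t).symm
  induction w with
  | nil => simp [symProj_wd]
  | cons i w ih =>
    rw [symm_wd_cons, (isCoder_letter δ i).comul_apply, map_add, map_apply_comp, map_apply_comp,
      LinearMap.comp_id, h1, h2]
    have h3 := map_apply_comp (sh δ (wd [i] : Tens K I)) LinearMap.id (symProj δ) (symProj δ)
      (comul (symm δ (wd w)))
    rw [LinearMap.id_comp] at h3
    rw [← h3, ← map_apply_comp, ih]

/-- Moving `X` past the coderivation that shuffles in a letter costs their bracket, again a
coderivation. Induction on the word with `X` arbitrary thus reduces to the empty word. -/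
theorem symProj_coder {p : ℤ} {X : Tens K I →ₗ[K] Tens K I} (hX : IsCoder δ p X) (t : Tens K I) :
    symProj δ (X (symProj δ t)) = X (symProj δ t) := by
  refine symProj_induction (f := symProj δ ∘ₗ X) (g := X) δ (fun w => ?_) t
  rw [LinearMap.comp_apply]
  induction w generalizing p X with
  | nil =>
    rw [symm_nil, hX.eq_hat, hat_nil]
    generalize (letter ∘ₗ X) (wd []) = v
    have : symProj δ ∘ₗ cons.flip (wd []) = cons.flip (wd [] : Tens K I) :=
      Finsupp.lhom_ext' fun i => LinearMap.ext_ring (by simp [symProj_wd, symm_wd_cons])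
    exact LinearMap.congr_fun this v
  | cons i w ih =>
    have h := ih (hX.bracket (isCoder_letter δ i))
    have h' := ih hX
    rw [symm_wd_cons]
    have e : X (sh δ (wd [i]) (symm δ (wd w))) =
        (X ∘ₗ sh δ (wd [i]) - (((-1) ^ (p * δ i) : Kˣ) : K) • sh δ (wd [i]) ∘ₗ X)
          (symm δ (wd w)) + (((-1) ^ (p * δ i) : Kˣ) : K) • sh δ (wd [i]) (X (symm δ (wd w))) := by
      simp
    rw [e, map_add, map_smul, h, symProj_sh_letter, h']

/-- Conjugating a letter coderivation by `F` gives a coderivation, which preserves symmetric tensors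
by `symProj_coder`. Each further letter is added by such a conjugate applied to a tensor already
known to be symmetric. -/
theorem symProj_cohom {F : Tens K I ≃ₗ[K] Tens K I} (hF : IsCohom δ F.toLinearMap)
    (t : Tens K I) : symProj δ (F (symProj δ t)) = F (symProj δ t) := by
  refine symProj_induction (f := symProj δ ∘ₗ F.toLinearMap) (g := F.toLinearMap) δ
    (fun w => ?_) t
  rw [LinearMap.comp_apply]
  induction w with
  | nil => rw [symm_nil, hF.nil, symProj_wd]; simp
  | cons i w ih =>
    have h := symProj_coder δ ((isCoder_letter δ i).conj hF) (F (symm δ (wd w)))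
    simp only [LinearEquiv.coe_coe] at ih ⊢
    rw [ih] at h
    simpa [← symm_wd_cons] using h

theorem isSym_symProj : IsSym δ (symProj δ : Tens K I →ₗ[K] _) where
  nil := by simp [symProj_wd]
  single i := by simp [symProj_wd, symm_wd_cons]
  idem := symProj_induction (f := symProj δ) (g := LinearMap.id) δ fun w => symProj_symm δ _
  len w := by
    rw [symProj_wd]
    exact Submodule.smul_mem _ _ (symm_mem_lenSub δ w)
  scale_apply := scale_symProj δ
  comul_apply := symProj_induction (f := TensorProduct.map (symProj δ) (symProj δ) ∘ₗ comul)
    (g := comul) δ (map_symProj_comul δ)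
  coder _ _ hX := symProj_coder δ hX
  cohom _ hF := symProj_cohom δ hF

end Symmetrization

/-! ### Word length and the arity components of operations. -/

section Length

variable {K I : Type*} [Field K] {δ : I → ℤ}

theorem map_mem_of_lenSub {n : ℕ} {N : Type*} [AddCommGroup N] [Module K N] {S : Submodule K N}
    {f : Tens K I →ₗ[K] N} (h : ∀ w : List I, w.length = n → f (wd w) ∈ S)
    {t : Tens K I} (ht : t ∈ lenSub K I n) : f t ∈ S := by
  have : lenSub K I n ≤ S.comap f := by
    rw [lenSub, Submodule.span_le]
    rintro _ ⟨w, hw, rfl⟩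
    exact h w hw
  exact this ht

theorem cons_mem_lenSub {n : ℕ} (v : I →₀ K) {t : Tens K I} (ht : t ∈ lenSub K I n) :
    cons v t ∈ lenSub K I (n + 1) := by
  refine map_mem_of_lenSub (fun w hw => ?_) ht
  induction v using Finsupp.induction_linear with
  | zero => simp
  | add f g hf hg => simpa using Submodule.add_mem _ hf hg
  | single i a =>
    have : (Finsupp.single i a : I →₀ K) = a • Finsupp.single i 1 := by simp
    rw [this, map_smul, LinearMap.smul_apply, cons_single_wd]
    exact Submodule.smul_mem _ _ (hw ▸ wd_mem_lenSub (i :: w))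

theorem sh_mem_lenSub (u v : List I) :
    sh δ (wd u : Tens K I) (wd v) ∈ lenSub K I (u.length + v.length) := by
  induction u generalizing v with
  | nil => simpa using wd_mem_lenSub v
  | cons i u ihu =>
    induction v with
    | nil => simpa using wd_mem_lenSub (i :: u)
    | cons j v ihv =>
      rw [← cons_single_wd j, sh_cons, cons_single_wd]
      refine Submodule.add_mem _ ?_ (cons_mem_lenSub _ ihv)
      have := cons_mem_lenSub (Finsupp.single i 1) (ihu (j :: v))
      rwa [add_right_comm] at this

theorem IsSym.mem_lenSub {e : Tens K I →ₗ[K] Tens K I} (he : IsSym δ e) {n : ℕ} {t : Tens K I}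
    (ht : t ∈ lenSub K I n) : e t ∈ lenSub K I n :=
  map_mem_of_lenSub (fun w hw => hw ▸ he.len w) ht

/-- The linear map vanishes on words whose length is not `j`. -/
def SuppLen {N : Type*} [AddCommGroup N] [Module K N] (j : ℕ) (β : Tens K I →ₗ[K] N) : Prop :=
  ∀ w : List I, w.length ≠ j → β (wd w) = 0

theorem SuppLen.eq_zero {N : Type*} [AddCommGroup N] [Module K N] {j : ℕ}
    {β : Tens K I →ₗ[K] N} (h : SuppLen j β) {n : ℕ} (hn : n ≠ j) {t : Tens K I}
    (ht : t ∈ lenSub K I n) : β t = 0 :=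
  lenSub_induction (f := β) (g := 0) (fun w hw => h w (hw ▸ hn)) ht

/-- The restriction of a linear map to words of length `j`. -/
def atLen {N : Type*} [AddCommGroup N] [Module K N] (j : ℕ) (β : Tens K I →ₗ[K] N) :
    Tens K I →ₗ[K] N :=
  ofWords fun w => if w.length = j then β (wd w) else 0

theorem suppLen_atLen {N : Type*} [AddCommGroup N] [Module K N] (j : ℕ) (β : Tens K I →ₗ[K] N) :
    SuppLen j (atLen j β) := fun w hw => by simp [atLen, hw]

theorem atLen_eq {N : Type*} [AddCommGroup N] [Module K N] {j : ℕ} (β : Tens K I →ₗ[K] N)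
    {t : Tens K I} (ht : t ∈ lenSub K I j) : atLen j β t = β t :=
  lenSub_induction (fun w hw => by simp [atLen, hw]) ht

theorem suppLen_letter : SuppLen 1 (letter : Tens K I →ₗ[K] _) := fun w hw => by
  match w, hw with
  | [], _ => simp
  | [i], h => simp at h
  | i :: j :: w, _ => simp [letter]

@[simp] theorem letter_wd_singleton (i : I) : letter (wd [i] : Tens K I) = Finsupp.single i 1 := by
  simp [letter]

theorem eq_cons_letter {t : Tens K I} (ht : t ∈ lenSub K I 1) : t = cons (letter t) (wd []) := by
  refine lenSub_induction (f := LinearMap.id) (g := cons.flip (wd []) ∘ₗ letter) (fun w hw => ?_) ht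
  obtain ⟨i, rfl⟩ := List.length_eq_one_iff.1 hw
  simp

theorem hat_zero (p : ℤ) : hat δ p (0 : Tens K I →ₗ[K] _) = 0 := tens_ext fun w => by
  induction w with
  | nil => simp [hat_nil]
  | cons i w ih =>
    rw [← cons_single_wd, hat_cons, ih]
    simp

theorem hat_add (p : ℤ) (β β' : Tens K I →ₗ[K] (I →₀ K)) :
    hat δ p (β + β') = hat δ p β + hat δ p β' := tens_ext fun w => by
  induction w with
  | nil => simp [hat_nil]
  | cons i w ih =>
    rw [LinearMap.add_apply, ← cons_single_wd, hat_cons, hat_cons, hat_cons, ih,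
      TensorProduct.map_add_left]
    simp only [LinearMap.add_apply, map_add]
    abel

theorem hat_smul (p : ℤ) (c : K) (β : Tens K I →ₗ[K] (I →₀ K)) :
    hat δ p (c • β) = c • hat δ p β := tens_ext fun w => by
  induction w with
  | nil => simp [hat_nil]
  | cons i w ih =>
    rw [LinearMap.smul_apply, ← cons_single_wd, hat_cons, hat_cons, ih,
      TensorProduct.map_smul_left]
    simp only [LinearMap.smul_apply, map_smul, smul_add]

theorem hat_sum (p : ℤ) {A : Type*} (s : Finset A) (β : A → Tens K I →ₗ[K] (I →₀ K)) :
    hat δ p (∑ a ∈ s, β a) = ∑ a ∈ s, hat δ p (β a) := by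
  classical
  induction s using Finset.induction_on with
  | empty => simp [hat_zero]
  | insert a s ha ih => rw [Finset.sum_insert ha, Finset.sum_insert ha, hat_add, ih]

/-- On a word of length `n` the coderivation evaluates `β` only on subwords, hence only in arities
up to `n`. -/
theorem hat_congr (p : ℤ) {β β' : Tens K I →ₗ[K] (I →₀ K)} {n : ℕ}
    (h : ∀ u : List I, u.length ≤ n → β (wd u) = β' (wd u)) {t : Tens K I}
    (ht : t ∈ lenSub K I n) : hat δ p β t = hat δ p β' t := by
  refine lenSub_induction (fun w hw => ?_) ht
  have h' : ∀ u : List I, u.length ≤ w.length → β (wd u) = β' (wd u) := fun u hu => h u (hw ▸ hu)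
  clear hw ht h
  induction w with
  | nil => rw [hat_nil, hat_nil, h' [] le_rfl]
  | cons i w ih =>
    rw [← cons_single_wd, hat_cons, hat_cons, cons_single_wd,
      ih fun u hu => h' u (hu.trans (by simp))]
    congr 2
    simp only [comul_wd, map_sum, map_tmul]
    exact Finset.sum_congr rfl fun l hl => by rw [h' _ (by simp)]

theorem SuppLen.hat_eq_zero {j : ℕ} {β : Tens K I →ₗ[K] (I →₀ K)} (h : SuppLen j β) (p : ℤ)
    {n : ℕ} (hn : n < j) {t : Tens K I} (ht : t ∈ lenSub K I n) : hat δ p β t = 0 := by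
  rw [hat_congr p (β' := 0) (fun u hu => h u (by omega)) ht, hat_zero, LinearMap.zero_apply]

/-- An operation of arity `j` replaces `j` letters by one. The bookkeeping of lengths in both halves
of the theorem rests on this. -/
theorem SuppLen.hat_mem {j : ℕ} {β : Tens K I →ₗ[K] (I →₀ K)} (h : SuppLen j β) (hj : 0 < j)
    (p : ℤ) {m n : ℕ} (hmn : m + 1 = n + j) {t : Tens K I} (ht : t ∈ lenSub K I m) :
    hat δ p β t ∈ lenSub K I n := by
  refine map_mem_of_lenSub (fun w hw => ?_) ht
  subst hw
  clear ht
  induction w generalizing n with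
  | nil =>
    rw [hat_nil, h [] (by simpa using hj.ne), map_zero, LinearMap.zero_apply]
    exact Submodule.zero_mem _
  | cons i w ih =>
    rcases Nat.eq_zero_or_pos n with rfl | hn
    · rw [h.hat_eq_zero p (by omega) (wd_mem_lenSub (i :: w))]
      exact Submodule.zero_mem _
    · obtain ⟨n, rfl⟩ : ∃ n', n = n' + 1 := ⟨n - 1, by omega⟩
      rw [← cons_single_wd, hat_cons, cons_single_wd]
      rw [List.length_cons] at hmn
      refine Submodule.add_mem _ ?_ (cons_mem_lenSub _ (ih (by omega)))
      simp only [comul_wd, map_sum, map_tmul, consT_tmul]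
      refine Submodule.sum_mem _ fun l hl => ?_
      have hl' := Finset.mem_range.1 hl
      rw [List.length_cons] at hl'
      by_cases hlj : l = j
      · refine cons_mem_lenSub _ ?_
        have := wd_mem_lenSub (K := K) ((i :: w).drop l)
        rwa [List.length_drop, List.length_cons, show w.length + 1 - l = n by omega] at this
      · rw [h ((i :: w).take l) (by simp; omega), map_zero, LinearMap.zero_apply]
        exact Submodule.zero_mem _

/-- The operator multiplying a word by its length. -/
theorem hat_letter_apply {n : ℕ} {t : Tens K I} (ht : t ∈ lenSub K I n) :
    hat δ 0 letter t = (n : K) • t := by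
  refine lenSub_induction (f := hat δ 0 letter) (g := (n : K) • LinearMap.id) (fun w hw => ?_) ht
  subst hw
  clear ht
  rw [LinearMap.smul_apply, LinearMap.id_apply]
  induction w with
  | nil => simp [hat_nil]
  | cons i w ih =>
    rw [← cons_single_wd, hat_cons, ih, twistV_zero, LinearMap.id_apply, map_smul]
    have : consT (TensorProduct.map letter LinearMap.id
        (comul (cons (Finsupp.single i (1 : K)) (wd w)))) = cons (Finsupp.single i 1) (wd w) :=
      congrArg consT (head_cons (Finsupp.single i (1 : K)) (wd w))
    rw [this, List.length_cons]
    push_cast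
    module

theorem letter_degree (c : Kˣ) (t : Tens K I) :
    scaleV δ c (letter t) = ((c ^ (0 : ℤ) : Kˣ) : K) • letter (scale δ c t) := by
  rw [letter_scale]; simp

/-- Converse of `IsCoder.apply_sh`: both terms of the Leibniz rule are shuffles of tensors without
constant term, so neither contains a letter. -/
theorem killsShuffles_of_derivation {X : Tens K I →ₗ[K] Tens K I} (c : List I → K)
    (hX : ∀ t, counit (X t) = 0)
    (h : ∀ u t, X (sh δ (wd u) t) = sh δ (X (wd u)) t + c u • sh δ (wd u) (X t)) :
    KillsShuffles δ (letter ∘ₗ X) := by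
  intro u v hu hv
  obtain ⟨i, u, rfl⟩ := List.exists_cons_of_ne_nil hu
  obtain ⟨j, v, rfl⟩ := List.exists_cons_of_ne_nil hv
  simp [h, letter_sh, hX]

end Length

/-! ### The Euler operator argument for a morphism to a quadratic structure. -/

section Formality

variable {K I : Type*} [Field K] {δ : I → ℤ} {e : Tens K I →ₗ[K] Tens K I}

variable (δ) in
/-- A family of operations of degree `p`. -/
def HasDeg (p : ℤ) (β : Tens K I →ₗ[K] (I →₀ K)) : Prop :=
  ∀ (c : Kˣ) t, scaleV δ c (β t) = ((c ^ p : Kˣ) : K) • β (scale δ c t)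

theorem HasDeg.atLen {p : ℤ} {β : Tens K I →ₗ[K] (I →₀ K)} (hβ : HasDeg δ p β) (n : ℕ) :
    HasDeg δ p (atLen n β) := fun c t => by
  have : scaleV δ c ∘ₗ MinimalPInfinity.atLen n β =
      ((c ^ p : Kˣ) : K) • MinimalPInfinity.atLen n β ∘ₗ scale δ c := tens_ext fun w => by
    have := hβ c (wd w)
    rw [scale_wd, map_smul] at this
    by_cases hw : w.length = n <;> simp [MinimalPInfinity.atLen, hw, this, -map_zpow₀]
  exact LinearMap.congr_fun this t

theorem HasDeg.smul {p : ℤ} {β : Tens K I →ₗ[K] (I →₀ K)} (hβ : HasDeg δ p β) (a : K) :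
    HasDeg δ p (a • β) := fun c t => by
  rw [LinearMap.smul_apply, map_smul, hβ, LinearMap.smul_apply, smul_comm]

theorem IsCoder.hasDeg {p : ℤ} {X : Tens K I →ₗ[K] Tens K I} (hX : IsCoder δ p X) :
    HasDeg δ p (letter ∘ₗ X) := fun c t => by
  rw [LinearMap.comp_apply, ← letter_scale, hX.scale_apply, map_smul]
  rfl

theorem HasDeg.comp_sym {p : ℤ} {β : Tens K I →ₗ[K] (I →₀ K)} (hβ : HasDeg δ p β)
    (he : IsSym δ e) : HasDeg δ p (β ∘ₗ e) := fun c t => by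
  rw [LinearMap.comp_apply, hβ, he.scale_apply]
  rfl

theorem hat_comp_sym (he : IsSym δ e) {p : ℤ} {β : Tens K I →ₗ[K] (I →₀ K)} (hβ : HasDeg δ p β)
    (t : Tens K I) : hat δ p (β ∘ₗ e) (e t) = hat δ p β (e t) :=
  IsCoder.ext_of_sym he (isCoder_hat (hβ.comp_sym he)) (isCoder_hat hβ)
    (fun t => by simp [he.idem]) t

/-- The morphism equation holds for the induced maps of coalgebras. -/
theorem lift_hat_of_letter (he : IsSym δ e) {β β' φ : Tens K I →ₗ[K] (I →₀ K)}
    (hβ : HasDeg δ (-1) β) (hβ' : HasDeg δ (-1) β') (hφ : HasDeg δ 0 φ) (hφ0 : φ (wd []) = 0)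
    (h : ∀ t, φ (hat δ (-1) β (e t)) = β' (lift φ (e t))) (t : Tens K I) :
    lift φ (hat δ (-1) β (e t)) = hat δ (-1) β' (lift φ (e t)) := by
  have hF : IsCohom δ (lift φ) := isCohom_lift hφ0 fun c t => by simpa using hφ c t
  have hX := isCoder_hat hβ
  have hX' := isCoder_hat hβ'
  have h1 : twist δ (-1) ∘ₗ lift φ = lift φ ∘ₗ twist δ (-1) :=
    LinearMap.ext fun t => hF.scale_apply _ t
  -- The difference of the two composites obeys a co-Leibniz rule relative to `lift φ`, so its
  -- vanishing is tested on letters, where it is the hypothesis.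
  have := he.eq_zero (E := lift φ ∘ₗ hat δ (-1) β - hat δ (-1) β' ∘ₗ lift φ) (F := lift φ)
    (G := lift φ ∘ₗ twist δ (-1)) (fun t => by
      simp only [LinearMap.sub_apply, LinearMap.comp_apply, map_sub, hF.comul_apply,
        hX.comul_apply, hX'.comul_apply, map_add, map_apply_comp, map_sub_left', map_sub_right',
        LinearMap.id_comp, LinearMap.comp_id, h1]
      abel)
    (fun t => by simp [hF.counit_apply, hX.counit_apply, hX'.counit_apply]) (by simp)
    (fun t => by simp [letter_lift hφ0, h]) t
  simpa [sub_eq_zero] using this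

/-- The Euler operator of the quadratic target, pulled back along the isomorphism, rescales the
source structure up to commutators. Its component of arity `k - 1`, divided by `-(k - 2)`, is the
cochain sought. No normalization of the morphism in low arities is needed. -/
theorem exists_cobounding_of_lift [CharZero K] (he : IsSym δ e) {k : ℕ} (hk : 3 ≤ k)
    {β β' φ : Tens K I →ₗ[K] (I →₀ K)}
    (hβ : HasDeg δ (-1) β) (hβ' : HasDeg δ (-1) β') (hφ : HasDeg δ 0 φ) (hφ0 : φ (wd []) = 0)
    (L : (I →₀ K) ≃ₗ[K] (I →₀ K)) (hL : ∀ i, φ (wd [i]) = L (Finsupp.single i 1))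
    (h2 : ∀ w : List I, w.length < k → w.length ≠ 2 → β (wd w) = 0) (h2' : SuppLen 2 β')
    (h : ∀ t, φ (hat δ (-1) β (e t)) = β' (lift φ (e t))) :
    ∃ ψ : Tens K I →ₗ[K] (I →₀ K), HasDeg δ 0 ψ ∧ SuppLen (k - 1) ψ ∧ ψ ∘ₗ e = ψ ∧
      (e = LinearMap.id → KillsShuffles δ φ → KillsShuffles δ ψ) ∧
      ∀ t ∈ lenSub K I k, β (e t) = β (hat δ 0 ψ (e t)) - ψ (hat δ (-1) (atLen 2 β) (e t)) := by
  have hF : IsCohom δ (lift φ) := isCohom_lift hφ0 fun c t => by simpa using hφ c t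
  let Φ : Tens K I ≃ₗ[K] Tens K I := LinearEquiv.ofBijective (lift φ) (bijective_lift L hL)
  have hΦ : IsCohom δ Φ.toLinearMap := hF
  have hΦa : ∀ t, Φ t = lift φ t := fun t => rfl
  have hN : IsCoder δ 0 (hat δ 0 (letter : Tens K I →ₗ[K] _)) := isCoder_hat letter_degree
  let D : Tens K I →ₗ[K] Tens K I := Φ.symm.toLinearMap ∘ₗ hat δ 0 letter ∘ₗ Φ.toLinearMap
  have hD : IsCoder δ 0 D := hN.conj (F := Φ.symm) hΦ.symm
  have hDa : ∀ t, Φ (D t) = hat δ 0 letter (Φ t) := fun t => by simp [D]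
  have hmor : ∀ t, Φ (hat δ (-1) β (e t)) = hat δ (-1) β' (Φ (e t)) :=
    lift_hat_of_letter he hβ hβ' hφ hφ0 h
  have hb := isCoder_hat hβ
  set b := hat δ (-1) β with hb_def
  set b' := hat δ (-1) β' with hb'_def
  -- the Euler operator shifts the quadratic differential by itself
  have hEuler : ∀ t, hat δ 0 letter (b' t) = b' (hat δ 0 letter t) - b' t := by
    have : hat δ 0 letter ∘ₗ b' + b' = b' ∘ₗ hat δ 0 letter := tens_ext fun w => by
      have h3 := hat_letter_apply (δ := δ) (wd_mem_lenSub (K := K) w)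
      rw [LinearMap.add_apply, LinearMap.comp_apply, LinearMap.comp_apply, h3, map_smul]
      by_cases hw : w.length < 2
      · rw [hb'_def, h2'.hat_eq_zero _ hw (wd_mem_lenSub w)]
        simp
      · have h4 : b' (wd w) ∈ lenSub K I (w.length - 1) :=
          h2'.hat_mem (by norm_num) _ (by omega) (wd_mem_lenSub w)
        rw [hat_letter_apply h4, Nat.cast_sub (by omega)]
        push_cast
        module
    intro t
    rw [eq_sub_iff_add_eq]
    exact LinearMap.congr_fun this t
  have hcomm : ∀ t, D (b (e t)) = b (D (e t)) - b (e t) := by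
    intro t
    -- The morphism equation is only known on symmetric tensors; being a coderivation, `D` stays
    -- within them.
    have e1 : D (e t) = e (D (e t)) := (he.coder _ _ hD t).symm
    apply Φ.injective
    rw [hDa, hmor, hEuler, map_sub, hmor, e1, hmor, ← e1, hDa]
  let γ : Tens K I →ₗ[K] (I →₀ K) := letter ∘ₗ D
  have hγ : HasDeg δ 0 γ := hD.hasDeg
  have hDγ : D = hat δ 0 γ := hD.eq_hat
  -- On words of length one the Euler operator is the identity, and so is its conjugate, whatever
  -- the linear part of the morphism.
  have hγ1 : ∀ t ∈ lenSub K I 1, γ t = letter t := by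
    intro t ht
    have h5 : Φ t ∈ lenSub K I 1 := by
      refine map_mem_of_lenSub (f := Φ.toLinearMap) (fun w hw => ?_) ht
      obtain ⟨i, rfl⟩ := List.length_eq_one_iff.1 hw
      rw [LinearEquiv.coe_coe, hΦa, lift_wd_cons]
      simpa using cons_mem_lenSub _ (wd_mem_lenSub (K := K) ([] : List I))
    have : D t = t := Φ.injective (by rw [hDa, hat_letter_apply h5]; simp)
    simp [γ, this]
  have hγ0 : γ (wd []) = 0 := by
    have : D (wd []) = 0 := Φ.injective (by rw [hDa, hΦa, lift_nil, hat_nil]; simp)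
    simp [γ, this]
  have hψe : atLen (k - 1) (γ ∘ₗ e) ∘ₗ e = atLen (k - 1) (γ ∘ₗ e) := tens_ext fun w => by
    rw [LinearMap.comp_apply]
    by_cases hw : w.length = k - 1
    · rw [atLen_eq _ (hw ▸ he.len w), atLen_eq _ (hw ▸ wd_mem_lenSub w)]
      simp [he.idem]
    · rw [(suppLen_atLen _ _).eq_zero hw (he.len w), suppLen_atLen _ _ w hw]
  have hkey : ∀ t ∈ lenSub K I k, ((k : K) - 2) • β (e t) =
      atLen (k - 1) (γ ∘ₗ e) (hat δ (-1) (atLen 2 β) (e t)) -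
        β (hat δ 0 (atLen (k - 1) (γ ∘ₗ e)) (e t)) := by
    intro t ht
    have hx := he.mem_lenSub ht
    have h6 : b (e t) = hat δ (-1) (atLen 2 β) (e t) + hat δ (-1) (atLen k β) (e t) := by
      rw [hb_def, ← LinearMap.add_apply, ← hat_add]
      refine hat_congr _ (fun u hu => ?_) hx
      rw [LinearMap.add_apply]
      by_cases hu2 : u.length = 2
      · rw [atLen_eq β (hu2 ▸ wd_mem_lenSub u), suppLen_atLen k β u (by omega), add_zero]
      · by_cases huk : u.length = k
        · rw [suppLen_atLen 2 β u hu2,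
            atLen_eq (j := k) β (by rw [← huk]; exact wd_mem_lenSub u), zero_add]
        · rw [suppLen_atLen k β u huk, suppLen_atLen 2 β u hu2, h2 u (by omega) hu2, add_zero]
    -- Starting from length `k`, the binary part of `b` leads to length `k - 1` and the part of
    -- arity `k` to a single letter, on which `γ` is the identity.
    have h7 : γ (b (e t)) = atLen (k - 1) (γ ∘ₗ e) (hat δ (-1) (atLen 2 β) (e t)) + β (e t) := by
      have h8 : hat δ (-1) (atLen 2 β) (e t) ∈ lenSub K I (k - 1) :=
        (suppLen_atLen 2 β).hat_mem (by norm_num) _ (by omega) hx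
      have h9 : hat δ (-1) (atLen k β) (e t) ∈ lenSub K I 1 :=
        (suppLen_atLen k β).hat_mem (by omega) _ (by omega) hx
      rw [h6, map_add, hγ1 _ h9, letter_hat, atLen_eq _ hx, atLen_eq _ h8]
      congr 1
      exact (congrArg γ (he.coder _ _ (isCoder_hat (hβ.atLen 2)) t)).symm
    have h10 : hat δ 0 γ (e t) = ∑ j ∈ Finset.range (k + 1), hat δ 0 (atLen j γ) (e t) := by
      rw [← LinearMap.sum_apply, ← hat_sum]
      refine hat_congr _ (fun u hu => ?_) hx
      rw [LinearMap.sum_apply, Finset.sum_eq_single u.length]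
      · rw [atLen_eq _ (wd_mem_lenSub u)]
      · intro j _ hj
        exact suppLen_atLen j γ u hj.symm
      · intro hu'
        simp only [Finset.mem_range] at hu'
        omega
    have h11 : hat δ 0 (atLen (k - 1) γ) (e t) = hat δ 0 (atLen (k - 1) (γ ∘ₗ e)) (e t) := by
      rw [← hat_comp_sym he (hγ.atLen (k - 1))]
      congr 2
      refine tens_ext fun w => ?_
      rw [LinearMap.comp_apply]
      by_cases hw : w.length = k - 1
      · rw [atLen_eq _ (hw ▸ he.len w), atLen_eq _ (hw ▸ wd_mem_lenSub w)]
        rfl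
      · rw [(suppLen_atLen _ _).eq_zero hw (he.len w), suppLen_atLen _ _ w hw]
    have h12 : β (hat δ 0 γ (e t)) = β (hat δ 0 (atLen (k - 1) (γ ∘ₗ e)) (e t)) +
        (k : K) • β (e t) := by
      have h14 : hat δ 0 (atLen 1 γ) (e t) = (k : K) • e t := by
        rw [← hat_letter_apply (δ := δ) hx]
        congr 2
        refine tens_ext fun w => ?_
        by_cases hw : w.length = 1
        · have := wd_mem_lenSub (K := K) w
          rw [hw] at this
          rw [atLen_eq _ this, hγ1 _ this]
        · rw [suppLen_atLen _ _ w hw, suppLen_letter w hw]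
      rw [h10, map_sum, ← h11, ← map_smul, ← h14]
      have hne : k - 1 ≠ 1 := by omega
      -- The component of arity `j` leads to length `k + 1 - j`, where `β` can be nonzero only for
      -- length `2` or `k`. Arity one acts as the Euler operator and gives the factor `k`.
      rw [Finset.sum_eq_add_of_mem (k - 1) 1 (by simp) (by simp; omega) hne]
      intro j hj hj'
      have hjk := Finset.mem_range.1 hj
      rcases Nat.eq_zero_or_pos j with rfl | hj0
      · have : (atLen 0 γ) = 0 := tens_ext fun w => by
          by_cases hw : w.length = 0
          · rw [List.length_eq_zero_iff.1 hw]
            simpa [atLen] using hγ0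
          · exact suppLen_atLen _ _ w hw
        rw [this, hat_zero, LinearMap.zero_apply, map_zero]
      · have h13 : hat δ 0 (atLen j γ) (e t) ∈ lenSub K I (k + 1 - j) :=
          (suppLen_atLen j γ).hat_mem hj0 _ (by omega) hx
        exact lenSub_induction (f := β) (g := 0)
          (fun w hw => h2 w (by omega) (by omega)) h13
    -- The corestriction of `[D, b] = -b`. Inserting both expansions makes the coefficients of the
    -- top component `1` on the left and `k - 1` on the right, hence the factor `k - 2`.
    have h15 : γ (b (e t)) = β (D (e t)) - β (e t) := by
      simp only [γ, LinearMap.comp_apply, hcomm, map_sub]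
      rw [hb_def, letter_hat, letter_hat]
    rw [h7, hDγ, h12] at h15
    rw [sub_smul, two_smul]
    have h16 := eq_sub_of_add_eq h15
    rw [h16]
    abel
  have hk2 : ((k : K) - 2) ≠ 0 := by
    have : ((k - 2 : ℕ) : K) ≠ 0 := Nat.cast_ne_zero.2 (by omega)
    rwa [Nat.cast_sub (by omega)] at this
  refine ⟨(-((k : K) - 2)⁻¹) • atLen (k - 1) (γ ∘ₗ e), ((hγ.comp_sym he).atLen _).smul _,
    fun w hw => ?_, ?_, ?_, fun t ht => ?_⟩
  · rw [LinearMap.smul_apply, suppLen_atLen _ _ w hw, smul_zero]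
  · rw [LinearMap.smul_comp, hψe]
  -- In the commutative case `Φ` is multiplicative for shuffles and the Euler operator is a
  -- derivation. The conjugate is then a derivation too, so its corestriction kills shuffles, and
  -- this passes to each arity because shuffling preserves length.
  · rintro rfl hs
    have hFsh := hF.apply_sh (by rwa [show letter ∘ₗ lift φ = φ from
      LinearMap.ext (letter_lift hφ0)])
    have hNsh := hN.apply_sh (by simp [hat_nil]) (by
      intro u v hu hv
      obtain ⟨i, u, rfl⟩ := List.exists_cons_of_ne_nil hu
      obtain ⟨j, v, rfl⟩ := List.exists_cons_of_ne_nil hv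
      simp [letter_sh])
    have hNsh' : ∀ s t : Tens K I, hat δ 0 letter (sh δ s t) =
        sh δ (hat δ 0 letter s) t + sh δ s (hat δ 0 letter t) := by
      intro s t
      have : (sh δ).compr₂ (hat δ 0 letter) = (sh δ).comp (hat δ 0 letter) +
          (sh δ).compl₂ (hat δ 0 (letter : Tens K I →ₗ[K] _)) := tens_ext fun u =>
        LinearMap.ext fun t => by simpa using hNsh u t
      exact LinearMap.congr_fun₂ this s t
    have hDsh : KillsShuffles δ γ := killsShuffles_of_derivation (fun _ => 1) hD.counit_apply
      fun u t => Φ.injective (by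
        rw [hDa, hΦa, hFsh, hNsh', map_add, map_smul, hΦa (sh δ _ _), hΦa (sh δ _ _), hFsh, hFsh,
          ← hΦa (D _), ← hΦa (D _), hDa, hDa, one_smul, hΦa (wd u), hΦa t])
    intro u v hu hv
    rw [LinearMap.smul_apply]
    by_cases huv : u.length + v.length = k - 1
    · rw [atLen_eq _ (huv ▸ sh_mem_lenSub u v), LinearMap.comp_id, hDsh u v hu hv, smul_zero]
    · rw [(suppLen_atLen _ _).eq_zero huv (sh_mem_lenSub u v), smul_zero]
  · rw [hat_smul, LinearMap.smul_apply, map_smul, LinearMap.smul_apply, ← smul_sub, neg_smul,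
      ← smul_neg, neg_sub, ← hkey t ht, smul_smul, inv_mul_cancel₀ hk2, one_smul]

end Formality

/-! ### Gauge transformation that removes the first higher operation. -/

section Truncation

variable {K I : Type*} [Field K] {δ : I → ℤ} {e : Tens K I →ₗ[K] Tens K I}

/-- For odd `b` the sign twist anticommutes with `b`, so the mixed terms in the coproduct of `b ∘ b`
cancel. The square then satisfies a co-Leibniz rule and is controlled by its corestriction. -/
theorem IsCoder.comp_self {p : ℤ} (hp : Odd p) {b : Tens K I →ₗ[K] Tens K I} (hb : IsCoder δ p b)
    (he : IsSym δ e) (h : ∀ t, letter (b (b (e t))) = 0) (t : Tens K I) : b (b (e t)) = 0 := by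
  have hs : ∀ t, twist δ p (b t) = - b (twist δ p t) := fun t => by
    have h1 : ((((-1 : Kˣ) ^ p) ^ p : Kˣ) : K) = -1 := by
      rw [hp.neg_one_zpow, hp.neg_one_zpow]; simp
    rw [twist, hb.scale_apply, h1, neg_one_smul]
  have hs' : twist δ p ∘ₗ b = - (b ∘ₗ twist δ p) := LinearMap.ext hs
  exact he.eq_zero (E := b ∘ₗ b) (F := LinearMap.id) (G := twist δ p ∘ₗ twist δ p) (fun t => by
    simp only [LinearMap.comp_apply, hb.comul_apply, map_add, map_apply_comp, hs',
      LinearMap.id_comp, LinearMap.comp_id]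
    have : TensorProduct.map (-(b ∘ₗ twist δ p)) b = -TensorProduct.map (b ∘ₗ twist δ p) b :=
      TensorProduct.ext' fun x y => by simp [neg_tmul]
    rw [this, LinearMap.neg_apply]
    abel) (fun t => by simp [hb.counit_apply]) (by simp) h t

/-- Two blocks of length `k - 1` need `2k - 2` letters, more than `k` since `k ≥ 3`. On words of
length at most `k` at most one nontrivial block fits. -/
theorem lift_letter_add {k : ℕ} (hk : 3 ≤ k) {ψ : Tens K I →ₗ[K] (I →₀ K)}
    (hψ : SuppLen (k - 1) ψ) {n : ℕ} (hn : n ≤ k) {t : Tens K I} (ht : t ∈ lenSub K I n) :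
    lift (letter + ψ) t = t + hat δ 0 ψ t := by
  refine lenSub_induction (f := lift (letter + ψ)) (g := LinearMap.id + hat δ 0 ψ)
    (fun w hw => ?_) ht
  replace hn : w.length ≤ k := hw ▸ hn
  clear ht hw
  rw [LinearMap.add_apply, LinearMap.id_apply]
  have hψ0 : ψ (wd []) = 0 := hψ [] (by simp; omega)
  have hφ0 : (letter + ψ : Tens K I →ₗ[K] _) (wd []) = 0 := by simp [hψ0]
  induction hm : w.length using Nat.strong_induction_on generalizing w with
  | _ m ih =>
    cases w with
    | nil => simp [hat_nil, hψ0]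
    | cons i w =>
      rw [List.length_cons] at hn hm
      have h1 := ih w.length (by omega) w (by omega) rfl
      rw [lift_eq hφ0]
      have h2 : TensorProduct.map (letter + ψ) (lift (letter + ψ)) (comul (wd (i :: w))) =
          Finsupp.single i 1 ⊗ₜ lift (letter + ψ) (wd w) +
          TensorProduct.map ψ LinearMap.id (comul (wd (i :: w))) := by
        have h3 : TensorProduct.map letter (lift (letter + ψ)) (comul (wd (i :: w))) =
            Finsupp.single i 1 ⊗ₜ lift (letter + ψ) (wd w) := by
          have := congrArg (TensorProduct.map LinearMap.id (lift (letter + ψ)))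
            (head_cons (Finsupp.single i (1 : K)) (wd w))
          rw [head, LinearMap.comp_apply, map_apply_comp, cons_single_wd] at this
          simpa using this
        rw [TensorProduct.map_add_left, LinearMap.add_apply, h3]
        congr 1
        simp only [comul_wd, map_sum, map_tmul, LinearMap.id_apply]
        refine Finset.sum_congr rfl fun l hl => ?_
        have hl' := Finset.mem_range.1 hl
        rw [List.length_cons] at hl'
        by_cases hlk : l = k - 1
        · have h4 : ((i :: w).drop l).length < k - 1 := by simp; omega
          rw [ih ((i :: w).drop l).length (by simp; omega) _ (by simp; omega) rfl,
            hψ.hat_eq_zero 0 h4 (wd_mem_lenSub _), add_zero]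
        · rw [hψ ((i :: w).take l) (by simp; omega)]
          simp
      rw [h2, map_add, consT_tmul, h1, ← cons_single_wd, hat_cons, counit_cons, map_add]
      simp
      abel

/-- The new structure is the conjugate of the old one by the automorphism with corestriction `letter
+ ψ`. The automorphism changes a word of length at most `k` only by `hat ψ`, so the change in the
operations up to arity `k` is the commutator with `ψ`. -/
theorem exists_truncation [CharZero K] (he : IsSym δ e) {k : ℕ} (hk : 3 ≤ k)
    {β ψ : Tens K I →ₗ[K] (I →₀ K)}
    (hβ : HasDeg δ (-1) β) (hβe : β ∘ₗ e = β) (hββ : ∀ t, β (hat δ (-1) β (e t)) = 0)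
    (hβk : ∀ w : List I, w.length < k → w.length ≠ 2 → β (wd w) = 0)
    (hψ : HasDeg δ 0 ψ) (hψk : SuppLen (k - 1) ψ)
    (hβψ : ∀ t ∈ lenSub K I k,
      β (e t) = β (hat δ 0 ψ (e t)) - ψ (hat δ (-1) (atLen 2 β) (e t))) :
    ∃ β' : Tens K I →ₗ[K] (I →₀ K), HasDeg δ (-1) β' ∧ β' ∘ₗ e = β' ∧
      (∀ t, β' (hat δ (-1) β' (e t)) = 0) ∧
      (∀ w : List I, w.length < k → β' (wd w) = β (wd w)) ∧
      (∀ w : List I, w.length = k → β' (wd w) = 0) ∧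
      (∀ t, (letter + ψ : Tens K I →ₗ[K] _) (hat δ (-1) β (e t)) = β' (lift (letter + ψ) (e t))) ∧
      (e = LinearMap.id → KillsShuffles δ β → KillsShuffles δ ψ → KillsShuffles δ β') := by
  set φ : Tens K I →ₗ[K] (I →₀ K) := letter + ψ with hφ_def
  have hψ0 : ψ (wd []) = 0 := hψk [] (by simp; omega)
  have hφ0 : φ (wd []) = 0 := by simp [hφ_def, hψ0]
  have hF : IsCohom δ (lift φ) := isCohom_lift hφ0 fun c t => by
    have h1 := letter_degree (δ := δ) c t
    have h2 := hψ c t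
    simp only [hφ_def, LinearMap.add_apply, map_add, h1, h2]
    simp
  -- As `k - 1` is at least two, `ψ` vanishes on letters; the linear part is the identity and the
  -- coalgebra map is invertible.
  have hL : ∀ i, φ (wd [i]) = LinearEquiv.refl K (I →₀ K) (Finsupp.single i 1) := fun i => by
    simp [hφ_def, hψk [i] (by simp; omega)]
  let Φ : Tens K I ≃ₗ[K] Tens K I := LinearEquiv.ofBijective (lift φ) (bijective_lift _ hL)
  have hΦ : IsCohom δ Φ.toLinearMap := hF
  have hΦa : ∀ t, Φ t = lift φ t := fun t => rfl
  have hb := isCoder_hat hβ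
  set b := hat δ (-1) β with hb_def
  have hbl : ∀ t, letter (b t) = β t := letter_hat _ _
  let b' : Tens K I →ₗ[K] Tens K I := Φ.toLinearMap ∘ₗ b ∘ₗ Φ.symm.toLinearMap
  have hb' : IsCoder δ (-1) b' := hb.conj hΦ
  have hb'a : ∀ t, b' (Φ t) = Φ (b t) := fun t => by simp [b']
  have hlb' : ∀ t, letter (b' (Φ t)) = β t + ψ (b t) := fun t => by
    rw [hb'a, hΦa, letter_lift hφ0, hφ_def, LinearMap.add_apply, hbl]
  have hsplit : ∀ n ≤ k, ∀ t ∈ lenSub K I n,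
      b t = hat δ (-1) (atLen 2 β) t + hat δ (-1) (atLen k β) t := by
    intro n hn t ht
    rw [hb_def, ← LinearMap.add_apply, ← hat_add]
    refine hat_congr _ (fun u hu => ?_) ht
    rw [LinearMap.add_apply]
    by_cases hu2 : u.length = 2
    · rw [atLen_eq β (hu2 ▸ wd_mem_lenSub u), suppLen_atLen k β u (by omega), add_zero]
    · by_cases huk : u.length = k
      · rw [suppLen_atLen 2 β u hu2,
          atLen_eq (j := k) β (by rw [← huk]; exact wd_mem_lenSub u), zero_add]
      · rw [suppLen_atLen k β u huk, suppLen_atLen 2 β u hu2, hβk u (by omega) hu2, add_zero]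
  have h2mem : ∀ n, ∀ t ∈ lenSub K I n, hat δ (-1) (atLen 2 β) t ∈ lenSub K I (n - 1) := by
    intro n t ht
    rcases Nat.eq_zero_or_pos n with rfl | hn
    · rw [(suppLen_atLen 2 β).hat_eq_zero _ (by norm_num) ht]
      exact Submodule.zero_mem _
    · exact (suppLen_atLen 2 β).hat_mem (by norm_num) _ (by omega) ht
  have hkmem : ∀ t ∈ lenSub K I k, hat δ (-1) (atLen k β) t ∈ lenSub K I 1 := fun t ht =>
    (suppLen_atLen k β).hat_mem (by omega) _ (by omega) ht
  have hψb : ∀ n < k, ∀ t ∈ lenSub K I n, ψ (b t) = 0 := by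
    intro n hn t ht
    rw [hsplit n hn.le t ht, (suppLen_atLen k β).hat_eq_zero _ hn ht, add_zero]
    exact hψk.eq_zero (by omega) (h2mem n t ht)
  have hlow' : ∀ n < k - 1, ∀ t ∈ lenSub K I n, letter (b' t) = β t := by
    intro n hn t ht
    have h1 : Φ t = t := by
      rw [hΦa, lift_letter_add (δ := δ) hk hψk (by omega) ht, hψk.hat_eq_zero _ hn ht, add_zero]
    rw [← h1, hlb', hψb n (by omega) t ht, add_zero, h1]
  have hlow : ∀ n < k, ∀ t ∈ lenSub K I n, letter (b' t) = β t := by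
    intro n hn t ht
    rcases Nat.lt_or_ge n (k - 1) with h | h
    · exact hlow' n h t ht
    · have h1 : hat δ 0 ψ t ∈ lenSub K I 1 := hψk.hat_mem (by omega) _ (by omega) ht
      have h2 : Φ t = t + hat δ 0 ψ t := by rw [hΦa, lift_letter_add (δ := δ) hk hψk hn.le ht]
      have h3 := hlb' t
      rw [h2, map_add, map_add, hlow' 1 (by omega) _ h1, hψb n hn t ht, add_zero] at h3
      have h4 : β (hat δ 0 ψ t) = 0 := lenSub_induction (f := β) (g := 0)
        (fun w hw => hβk w (by omega) (by omega)) h1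
      rwa [h4, add_zero] at h3
  have hlen : ∀ w : List I, w.length < k → letter (b' (e (wd w))) = β (wd w) := fun w hw => by
    rw [hlow _ hw _ (he.len w)]
    exact LinearMap.congr_fun hβe (wd w)
  -- The conjugate itself need not be the coderivation built from the restricted corestriction, but
  -- the two agree on symmetric tensors.
  have hbe : ∀ t, b' (e t) = hat δ (-1) (letter ∘ₗ b' ∘ₗ e) (e t) :=
    IsCoder.ext_of_sym he hb' (isCoder_hat (hb'.hasDeg.comp_sym he)) fun t => by
      simp [letter_hat, he.idem]
  have hbb : ∀ t, b (b (e t)) = 0 := hb.comp_self (by decide) he fun t => by rw [hbl, hββ]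
  refine ⟨letter ∘ₗ b' ∘ₗ e, hb'.hasDeg.comp_sym he, ?_, fun t => ?_, hlen, fun w hw => ?_,
    fun t => ?_, ?_⟩
  · exact LinearMap.ext fun t => by simp [he.idem]
  · rw [← hbe]
    simp only [LinearMap.comp_apply]
    rw [he.coder _ _ hb']
    have h1 : Φ.symm (e t) = e (Φ.symm (e t)) := (he.cohom Φ.symm hΦ.symm t).symm
    simp only [b', LinearMap.comp_apply, LinearEquiv.coe_coe, LinearEquiv.symm_apply_apply]
    rw [h1, hbb, map_zero, map_zero]
  · have ht : e (wd w) ∈ lenSub K I k := hw ▸ he.len w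
    -- In arity `k` the correction has length two and is evaluated by the binary product. It cancels
    -- against the coboundary expression for `β`.
    have h1 : hat δ 0 ψ (e (wd w)) ∈ lenSub K I 2 := hψk.hat_mem (by omega) _ (by omega) ht
    have h2 : Φ (e (wd w)) = e (wd w) + hat δ 0 ψ (e (wd w)) := by
      rw [hΦa, lift_letter_add (δ := δ) hk hψk le_rfl ht]
    have h3 := hlb' (e (wd w))
    rw [h2, map_add, map_add, hlow 2 (by omega) _ h1, hsplit k le_rfl _ ht, map_add,
      hψk.eq_zero (by omega) (hkmem _ ht), add_zero,
      hβψ (wd w) (by rw [← hw]; exact wd_mem_lenSub w), sub_add_cancel] at h3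
    simpa using h3
  · simp only [LinearMap.comp_apply]
    rw [← hΦa, he.cohom Φ hΦ, hb'a, hΦa, letter_lift hφ0]
  -- `Φ` is multiplicative for shuffles and `b` is a derivation, so the conjugate is a derivation
  -- and its corestriction kills shuffles.
  · rintro rfl hsβ hsψ
    have hsφ : KillsShuffles δ φ := fun u v hu hv => by
      obtain ⟨i, u, rfl⟩ := List.exists_cons_of_ne_nil hu
      obtain ⟨j, v, rfl⟩ := List.exists_cons_of_ne_nil hv
      rw [hφ_def, LinearMap.add_apply, hsψ _ _ hu hv]
      simp [letter_sh]
    have hFsh := hF.apply_sh (by rwa [show letter ∘ₗ lift φ = φ from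
      LinearMap.ext (letter_lift hφ0)])
    have hb0 : b (wd []) = 0 := by rw [hb_def, hat_nil, hβk [] (by simp; omega) (by simp)]; simp
    have hbsh := hb.apply_sh hb0 (by rwa [show letter ∘ₗ b = β from LinearMap.ext hbl])
    have hbsh' : ∀ s t : Tens K I, b (sh δ s t) =
        sh δ (b s) t + sh δ (twist δ (-1) s) (b t) := by
      intro s t
      have : (sh δ).compr₂ b = (sh δ).comp b + (sh δ).compl₁₂ (twist δ (-1)) b :=
        tens_ext fun u => LinearMap.ext fun t => by
          have h1 : twist δ (-1) (wd u : Tens K I) =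
              (((-1) ^ (-1 * wdeg δ u) : Kˣ) : K) • wd u := by
            rw [twist, scale_wd, ← zpow_mul]
          simp only [LinearMap.compr₂_apply, LinearMap.add_apply, LinearMap.comp_apply,
            LinearMap.compl₁₂_apply, h1, map_smul, LinearMap.smul_apply, hbsh]
      exact LinearMap.congr_fun₂ this s t
    rw [LinearMap.comp_id]
    refine killsShuffles_of_derivation (fun u => (((-1) ^ (-1 * wdeg δ u) : Kˣ) : K))
      hb'.counit_apply fun u t => ?_
    obtain ⟨s, hs⟩ := Φ.surjective (wd u)
    obtain ⟨t, rfl⟩ := Φ.surjective t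
    have h1 : Φ (twist δ (-1) s) = (((-1) ^ (-1 * wdeg δ u) : Kˣ) : K) • Φ s := by
      have := hF.scale_apply ((-1) ^ (-1 : ℤ)) s
      rw [← hΦa, ← hΦa, hs, scale_wd, ← zpow_mul, ← hs] at this
      exact this.symm
    rw [← hs, hΦa s, hΦa t, ← hFsh, ← hΦa, hb'a, hbsh', map_add, hΦa, hFsh, hΦa (sh δ _ _), hFsh,
      ← hΦa (twist δ (-1) s), h1, ← hΦa (b s), ← hΦa (b t), ← hb'a, ← hb'a, map_smul,
      LinearMap.smul_apply]
    simp only [hΦa]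

end Truncation

/-! ### Homogeneous bases, suspension signs and the passage between operations and words. -/

section HomogeneousBasis

variable {K H : Type*} [Field K] [AddCommGroup H] [Module K H]

theorem exists_homogeneous_basis (𝒢 : ℤ → Submodule K H) [DirectSum.Decomposition 𝒢] :
    ∃ (B : Module.Basis (Σ j : ℤ, Module.Basis.ofVectorSpaceIndex K (𝒢 j)) K H),
      ∀ i, B i ∈ 𝒢 i.1 :=
  ⟨(DirectSum.Decomposition.isInternal 𝒢).collectedBasis fun j => Module.Basis.ofVectorSpace K (𝒢 j),
    fun i => DirectSum.IsInternal.collectedBasis_mem _ _ i⟩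

variable {I : Type*} {𝒢 : ℤ → Submodule K H} {B : Module.Basis I K H} {deg : I → ℤ}

/-- Multilinear maps which agree on tuples of basis vectors of degrees `d` agree on all tuples
of vectors of degrees `d`. -/
theorem multilinear_ext_of_basis [DirectSum.Decomposition 𝒢] (hB : ∀ i, B i ∈ 𝒢 (deg i))
    {N : Type*} [AddCommGroup N] [Module K N]
    {n : ℕ} {f g : MultilinearMap K (fun _ : Fin n => H) N} {d : Fin n → ℤ}
    (h : ∀ w : Fin n → I, (∀ i, deg (w i) = d i) → f (fun i => B (w i)) = g fun i => B (w i))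
    {x : Fin n → H} (hx : ∀ i, x i ∈ 𝒢 (d i)) : f x = g x := by
  classical
  -- Precomposing with the projections to the prescribed degrees kills basis vectors of other
  -- degrees, so agreement need only be tested on basis vectors of the right degrees.
  let p : ℤ → H →ₗ[K] H := fun a => (𝒢 a).subtype ∘ₗ DirectSum.component K ℤ _ a ∘ₗ
    (DirectSum.decomposeLinearEquiv 𝒢).toLinearMap
  have hp : ∀ a x, p a x = (DirectSum.decompose 𝒢 x a : H) := fun a x => rfl
  have hpx : ∀ i, p (d i) (x i) = x i := fun i => by
    rw [hp, DirectSum.decompose_of_mem_same _ (hx i)]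
  have key : f.compLinearMap (fun i => p (d i)) = g.compLinearMap fun i => p (d i) := by
    refine Module.Basis.ext_multilinear (fun _ => B) fun w => ?_
    simp only [MultilinearMap.compLinearMap_apply]
    by_cases hw : ∀ i, deg (w i) = d i
    · have : (fun i => p (d i) (B (w i))) = fun i => B (w i) := funext fun i => by
        rw [hp, DirectSum.decompose_of_mem_same _ (hw i ▸ hB (w i))]
      rw [this, h w hw]
    · push Not at hw
      obtain ⟨i, hi⟩ := hw
      have : p (d i) (B (w i)) = 0 := by
        rw [hp, DirectSum.decompose_of_mem_ne _ (hB (w i)) hi]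
      rw [f.map_coord_zero i this, g.map_coord_zero i this]
  have := MultilinearMap.congr_fun key x
  simpa only [MultilinearMap.compLinearMap_apply, hpx] using this

variable (B) in
/-- `t ↦ y_a ⊗ ⋯ ⊗ y_{a+n-1} ⊗ t`. -/
def seg (y : ℕ → H) : ℕ → ℕ → Tens K I →ₗ[K] Tens K I
  | _, 0 => LinearMap.id
  | a, n + 1 => cons (B.repr (y a)) ∘ₗ seg y (a + 1) n

theorem seg_zero (y : ℕ → H) (a : ℕ) (t : Tens K I) : seg B y a 0 t = t := rfl

theorem seg_succ (y : ℕ → H) (a n : ℕ) (t : Tens K I) :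
    seg B y a (n + 1) t = cons (B.repr (y a)) (seg B y (a + 1) n t) := rfl

theorem seg_add (y : ℕ → H) (a m n : ℕ) (t : Tens K I) :
    seg B y a (m + n) t = seg B y a m (seg B y (a + m) n t) := by
  induction m generalizing a with
  | zero => simp [seg_zero]
  | succ m ih => rw [Nat.add_right_comm, seg_succ, seg_succ, ih, Nat.add_right_comm a 1, add_assoc]

theorem seg_congr {y y' : ℕ → H} {a b n : ℕ} (h : ∀ i < n, y (a + i) = y' (b + i)) (t : Tens K I) :
    seg B y a n t = seg B y' b n t := by
  induction n generalizing a b with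
  | zero => rfl
  | succ n ih =>
    have h0 := h 0 (Nat.succ_pos n)
    rw [add_zero, add_zero] at h0
    rw [seg_succ, seg_succ, h0, ih fun i hi => by
      have := h (i + 1) (by omega)
      rwa [← add_assoc, ← add_assoc, add_right_comm, add_right_comm b] at this]

theorem seg_mem_lenSub (y : ℕ → H) (a n : ℕ) {m : ℕ} {t : Tens K I} (ht : t ∈ lenSub K I m) :
    seg B y a n t ∈ lenSub K I (m + n) := by
  induction n generalizing a with
  | zero => exact ht
  | succ n ih => exact cons_mem_lenSub _ (ih (a + 1))

variable (B) in
/-- The tensor `x₀ ⊗ ⋯ ⊗ xₙ₋₁`. -/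
def tensMap : (n : ℕ) → MultilinearMap K (fun _ : Fin n => H) (Tens K I)
  | 0 => MultilinearMap.constOfIsEmpty K _ (wd [])
  | n + 1 => LinearMap.uncurryLeft
      { toFun := fun h => (cons (B.repr h)).compMultilinearMap (tensMap n)
        map_add' := fun u v => by ext x; simp
        map_smul' := fun c v => by ext x; simp }

theorem tensMap_succ {n : ℕ} (x : Fin (n + 1) → H) :
    tensMap B (n + 1) x = cons (B.repr (x 0)) (tensMap B n fun i => x i.succ) := rfl

theorem tensMap_eq_seg (y : ℕ → H) (a n : ℕ) :
    tensMap B n (fun i => y (a + i)) = seg B y a n (wd []) := by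
  induction n generalizing a with
  | zero => rfl
  | succ n ih =>
    rw [tensMap_succ, seg_succ, ← ih]
    simp only [Fin.val_zero, add_zero, Fin.val_succ]
    congr 3
    funext i
    rw [add_assoc, add_comm 1]

theorem tensMap_eq_seg_toSeq {n : ℕ} (x : Fin n → H) :
    tensMap B n x = seg B (toSeq x) 0 n (wd []) := by
  rw [← tensMap_eq_seg]
  congr 1
  funext i
  simp [toSeq]

theorem tensMap_basis {n : ℕ} (w : Fin n → I) :
    tensMap B n (fun i => B (w i)) = wd (List.ofFn w) := by
  induction n with
  | zero => rfl
  | succ n ih => rw [tensMap_succ, ih fun i => w i.succ, List.ofFn_succ]; simp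

/-- The exponent `∑ i < n, (n - 1 - i) d_{a+i}` of the sign of the iterated suspension. -/
def decSum (d : ℕ → ℤ) : ℕ → ℕ → ℤ
  | _, 0 => 0
  | a, n + 1 => n * d a + decSum d (a + 1) n

/-- `d_a + ⋯ + d_{a+n-1}`. -/
def degSum (d : ℕ → ℤ) (a n : ℕ) : ℤ := ∑ i ∈ Finset.range n, d (a + i)

theorem degSum_add (d : ℕ → ℤ) (a m n : ℕ) :
    degSum d a (m + n) = degSum d a m + degSum d (a + m) n := by
  simp [degSum, Finset.sum_range_add, add_assoc]

theorem degSum_zero (d : ℕ → ℤ) (a : ℕ) : degSum d a 0 = 0 := rfl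

theorem degSum_succ (d : ℕ → ℤ) (a n : ℕ) :
    degSum d a (n + 1) = d a + degSum d (a + 1) n := by
  rw [add_comm n, degSum_add]
  simp [degSum]

theorem degSum_congr {d d' : ℕ → ℤ} {a b n : ℕ} (h : ∀ i < n, d (a + i) = d' (b + i)) :
    degSum d a n = degSum d' b n :=
  Finset.sum_congr rfl fun i hi => h i (Finset.mem_range.1 hi)

theorem decSum_zero (d : ℕ → ℤ) (a : ℕ) : decSum d a 0 = 0 := rfl

theorem decSum_succ (d : ℕ → ℤ) (a n : ℕ) :
    decSum d a (n + 1) = n * d a + decSum d (a + 1) n := rfl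

theorem decSum_add (d : ℕ → ℤ) (a m n : ℕ) :
    decSum d a (m + n) = decSum d a m + n * degSum d a m + decSum d (a + m) n := by
  induction m generalizing a with
  | zero => simp [decSum_zero, degSum_zero]
  | succ m ih =>
    rw [Nat.add_right_comm, decSum_succ, ih, decSum_succ, degSum_succ, Nat.add_right_comm a 1,
      add_assoc a]
    push_cast
    ring

theorem decSum_congr {d d' : ℕ → ℤ} {a b n : ℕ} (h : ∀ i < n, d (a + i) = d' (b + i)) :
    decSum d a n = decSum d' b n := by
  induction n generalizing a b with
  | zero => rfl
  | succ n ih =>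
    have h0 := h 0 (Nat.succ_pos n)
    rw [add_zero, add_zero] at h0
    rw [decSum_succ, decSum_succ, h0, ih fun i hi => by
      have := h (i + 1) (by omega)
      rwa [← add_assoc, ← add_assoc, add_right_comm, add_right_comm b] at this]

variable (deg) in
/-- The exponent of the sign of the iterated suspension of a word. -/
def wordSum : List I → ℤ
  | [] => 0
  | i :: w => w.length * deg i + wordSum w

theorem wordSum_ofFn {n : ℕ} (w : Fin n → I) (d : ℕ → ℤ) (a : ℕ)
    (h : ∀ i, deg (w i) = d (a + i)) : wordSum deg (List.ofFn w) = decSum d a n := by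
  induction n generalizing a with
  | zero => rfl
  | succ n ih =>
    rw [List.ofFn_succ, wordSum, decSum_succ, ih (fun i => w i.succ) (a + 1) fun i => by
      rw [h, Fin.val_succ, add_assoc, add_comm 1], h]
    simp

theorem apply_congr_length {M N : Type*} {f : (n : ℕ) → (Fin n → M) → N} {m n : ℕ} (h : m = n)
    {x : Fin m → M} {y : Fin n → M}
    (hxy : ∀ i (hi : i < m) (hi' : i < n), x ⟨i, hi⟩ = y ⟨i, hi'⟩) : f m x = f n y := by
  subst h
  congr 1
  funext i
  exact hxy i i.2 i.2

variable (B deg) in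
/-- The map on the tensor coalgebra given by a family of operations, with the signs of the
suspension and weights `1 / fac n`. -/
def bar (fac : ℕ → K) (f : (n : ℕ) → MultilinearMap K (fun _ : Fin n => H) H) :
    Tens K I →ₗ[K] (I →₀ K) :=
  ofWords fun w => (fac w.length)⁻¹ • sg K (wordSum deg w) •
    B.repr (f w.length fun i => B (w.get i))

theorem bar_ofFn (fac : ℕ → K) (f : (n : ℕ) → MultilinearMap K (fun _ : Fin n => H) H)
    {n : ℕ} (w : Fin n → I) (d : ℕ → ℤ) (a : ℕ) (h : ∀ i, deg (w i) = d (a + i)) :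
    bar B deg fac f (wd (List.ofFn w)) =
      (fac n)⁻¹ • sg K (decSum d a n) • B.repr (f n fun i => B (w i)) := by
  have h1 : f (List.ofFn w).length (fun i => B ((List.ofFn w).get i)) = f n fun i => B (w i) :=
    apply_congr_length (f := fun n => f n) List.length_ofFn fun i hi hi' => by simp
  have h2 : fac (List.ofFn w).length = fac n := by rw [List.length_ofFn]
  rw [bar, ofWords_wd, wordSum_ofFn w d a h, h1, h2]

/-- Both sides are multilinear in the arguments, so the formula extends from basis words to
homogeneous vectors. -/
theorem bar_seg [DirectSum.Decomposition 𝒢] (hB : ∀ i, B i ∈ 𝒢 (deg i)) (fac : ℕ → K)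
    (f : (n : ℕ) → MultilinearMap K (fun _ : Fin n => H) H) {y : ℕ → H} {d : ℕ → ℤ} {a n : ℕ}
    (hy : ∀ i < n, y (a + i) ∈ 𝒢 (d (a + i))) :
    bar B deg fac f (seg B y a n (wd [])) =
      (fac n)⁻¹ • sg K (decSum d a n) • B.repr (f n fun i => y (a + i)) := by
  rw [← tensMap_eq_seg]
  exact multilinear_ext_of_basis hB (f := (bar B deg fac f).compMultilinearMap (tensMap B n))
    (g := (fac n)⁻¹ • sg K (decSum d a n) • B.repr.toLinearMap.compMultilinearMap (f n))
    (d := fun i => d (a + i)) (fun w hw => by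
      simp only [LinearMap.compMultilinearMap_apply, tensMap_basis, bar_ofFn fac f w d a hw]
      rfl) fun i => hy i i.2

variable (deg) in
/-- The signs of the iterated suspension. -/
def decMap : Tens K I →ₗ[K] Tens K I := ofWords fun w => sg K (wordSum deg w) • wd w

variable (B deg) in
/-- The family of operations given by a map on the tensor coalgebra. -/
def unbar (fac : ℕ → K) (β : Tens K I →ₗ[K] (I →₀ K)) (n : ℕ) :
    MultilinearMap K (fun _ : Fin n => H) H :=
  (B.repr.symm.toLinearMap ∘ₗ (fac n • β) ∘ₗ decMap deg).compMultilinearMap (tensMap B n)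

theorem unbar_basis (fac : ℕ → K) (β : Tens K I →ₗ[K] (I →₀ K)) {n : ℕ} (w : Fin n → I) :
    unbar B deg fac β n (fun i => B (w i)) =
      B.repr.symm (fac n • sg K (wordSum deg (List.ofFn w)) • β (wd (List.ofFn w))) := by
  simp [unbar, tensMap_basis, decMap]

theorem bar_unbar {fac : ℕ → K} (hfac : ∀ n, fac n ≠ 0) (β : Tens K I →ₗ[K] (I →₀ K)) :
    bar B deg fac (unbar B deg fac β) = β := tens_ext fun w => by
  have h := unbar_basis (B := B) (deg := deg) fac β w.get
  rw [List.ofFn_get] at h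
  have h1 : (fac w.length)⁻¹ * (sg K (wordSum deg w) * (fac w.length * sg K (wordSum deg w))) =
      ((fac w.length)⁻¹ * fac w.length) * (sg K (wordSum deg w) * sg K (wordSum deg w)) := by ring
  rw [bar, ofWords_wd, h, LinearEquiv.apply_symm_apply, smul_smul, smul_smul, smul_smul, mul_assoc,
    mul_assoc, h1, inv_mul_cancel₀ (hfac _), sg_mul_self, one_mul, one_smul]

theorem unbar_eq_zero (fac : ℕ → K) {β : Tens K I →ₗ[K] (I →₀ K)} {n : ℕ}
    (h : ∀ w : List I, w.length = n → β (wd w) = 0) : unbar B deg fac β n = 0 :=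
  Module.Basis.ext_multilinear (fun _ => B) fun w => by
    rw [unbar_basis, h _ List.length_ofFn]; simp

theorem unbar_congr (fac : ℕ → K) {β β' : Tens K I →ₗ[K] (I →₀ K)} {n : ℕ}
    (h : ∀ w : List I, w.length = n → β (wd w) = β' (wd w)) :
    unbar B deg fac β n = unbar B deg fac β' n :=
  Module.Basis.ext_multilinear (fun _ => B) fun w => by
    rw [unbar_basis, unbar_basis, h _ List.length_ofFn]

theorem unbar_bar {fac : ℕ → K} (hfac : ∀ n, fac n ≠ 0)
    (f : (n : ℕ) → MultilinearMap K (fun _ : Fin n => H) H) (n : ℕ) :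
    unbar B deg fac (bar B deg fac f) n = f n :=
  Module.Basis.ext_multilinear (fun _ => B) fun w => by
    have h := wordSum_ofFn (deg := deg) w (toSeq fun i => deg (w i)) 0 fun i => by simp [toSeq]
    rw [unbar_basis, bar_ofFn fac f w (toSeq fun i => deg (w i)) 0 fun i => by simp [toSeq], h]
    rw [smul_comm (sg K _), smul_smul, mul_inv_cancel₀ (hfac _), one_smul, smul_smul, sg_mul_self,
      one_smul, LinearEquiv.symm_apply_apply]

end HomogeneousBasis

/-! ### Insertion of one operation into another and its signs. -/

section Inner

variable {K H : Type*} [Field K] [AddCommGroup H] [Module K H]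
  {I : Type*} {𝒢 : ℤ → Submodule K H} {B : Module.Basis I K H} {deg : I → ℤ}

theorem sg_eq_zpow (e : ℤ) : sg K e = (((-1) ^ e : Kˣ) : K) := by
  rcases Int.even_or_odd e with h | h
  · rw [sg, Int.negOnePow_even e h, h.neg_one_zpow]; simp
  · rw [sg, Int.negOnePow_odd e h, h.neg_one_zpow]; simp

theorem sg_add_two_mul (a b : ℤ) : sg K (a + 2 * b) = sg K a := by
  rw [sg_add, two_mul, sg_add, sg_mul_self, mul_one]

theorem sg_zero : sg K 0 = 1 := by simp [sg]

theorem comul_seg (y : ℕ → H) (a n : ℕ) : comul (seg B y a n (wd [])) =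
    ∑ j ∈ Finset.range (n + 1), seg B y a j (wd []) ⊗ₜ[K] seg B y (a + j) (n - j) (wd []) := by
  induction n generalizing a with
  | zero => simp [seg_zero]
  | succ n ih =>
    rw [seg_succ, comul_cons, ih, Finset.sum_range_succ' _ (n + 1), map_sum, add_comm]
    congr 1
    refine Finset.sum_congr rfl fun j _ => ?_
    rw [map_tmul, seg_succ, Nat.add_sub_add_right, LinearMap.id_apply, add_assoc, add_comm 1]

variable [DirectSum.Decomposition 𝒢]

theorem scaleV_repr (hB : ∀ i, B i ∈ 𝒢 (deg i)) (c : Kˣ) {a : ℤ} {h : H} (hh : h ∈ 𝒢 a) :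
    scaleV (fun i => deg i + 1) c (B.repr h) = ((c ^ (a + 1) : Kˣ) : K) • B.repr h := by
  have := multilinear_ext_of_basis hB
    (f := MultilinearMap.ofSubsingleton K H (I →₀ K) (0 : Fin 1)
      (scaleV (fun i => deg i + 1) c ∘ₗ B.repr.toLinearMap))
    (g := MultilinearMap.ofSubsingleton K H (I →₀ K) (0 : Fin 1)
      (((c ^ (a + 1) : Kˣ) : K) • B.repr.toLinearMap))
    (d := fun _ => a) (fun w hw => by simp [hw 0, -Finsupp.smul_single]) (x := fun _ => h)
    (fun _ => hh)
  simpa using this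

theorem twistV_repr (hB : ∀ i, B i ∈ 𝒢 (deg i)) (p : ℤ) {a : ℤ} {h : H} (hh : h ∈ 𝒢 a) :
    twistV (fun i => deg i + 1) p (B.repr h) = sg K (p * (a + 1)) • B.repr h := by
  rw [twistV, scaleV_repr hB _ hh, ← zpow_mul, sg_eq_zpow]

/-- The coderivation inserts `β` at every position `r` and in every arity `s`, including zero. The
sign is the suspended degree of the `r` arguments in front. -/
theorem hat_seg (hB : ∀ i, B i ∈ 𝒢 (deg i)) (p : ℤ) (β : Tens K I →ₗ[K] (I →₀ K)) {y : ℕ → H}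
    {d : ℕ → ℤ} (hy : ∀ i, y i ∈ 𝒢 (d i)) (a n : ℕ) :
    hat (fun i => deg i + 1) p β (seg B y a n (wd [])) = ∑ r ∈ Finset.range (n + 1),
      ∑ s ∈ Finset.range (n - r + 1), sg K (p * (degSum d a r + r)) •
        seg B y a r (cons (β (seg B y (a + r) s (wd []))) (seg B y (a + r + s) (n - r - s) (wd []))) := by
  induction n generalizing a with
  | zero => simp [seg_zero, hat_nil, degSum_zero, sg_zero]
  | succ n ih =>
    rw [Finset.sum_range_succ' _ (n + 1), seg_succ, hat_cons, ← seg_succ, ih, add_comm, comul_seg]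
    congr 1
    · rw [twistV_repr hB p (hy a), map_sum]
      refine Finset.sum_congr rfl fun r _ => ?_
      rw [Nat.add_sub_add_right, map_sum (cons _)]
      refine Finset.sum_congr rfl fun s _ => ?_
      rw [map_smul, map_smul, LinearMap.smul_apply, smul_smul, ← sg_add, seg_succ, degSum_succ,
        Nat.add_right_comm a 1 r, add_assoc a r 1]
      congr 2
      push_cast
      ring
    · simp [degSum_zero, sg_zero, seg_zero]

/-- Suspending the operations separately and suspending the composite give signs whose quotient is
the sign of the unsuspended formula: the Koszul sign for passing the first `r` arguments, and one
depending only on the position and the arities. -/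
theorem bar_insertArg (hB : ∀ i, B i ∈ 𝒢 (deg i)) (fac : ℕ → K) {p : ℤ}
    {m : (n : ℕ) → MultilinearMap K (fun _ : Fin n => H) H}
    (f : (n : ℕ) → MultilinearMap K (fun _ : Fin n => H) H)
    (hm : ∀ (s : ℕ) (d : Fin s → ℤ) (x : Fin s → H), (∀ i, x i ∈ 𝒢 (d i)) →
      m s x ∈ 𝒢 (∑ i, d i + (s - 1 + p)))
    {x : ℕ → H} {d : ℕ → ℤ} (hx : ∀ i, x i ∈ 𝒢 (d i)) (r s t a : ℕ) (ha : a = r + t + 1) :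
    sg K (decSum d 0 (r + s + t)) • sg K (p * (degSum d 0 r + r)) •
      bar B deg fac f (seg B x 0 r
        (cons (bar B deg fac m (seg B x r s (wd []))) (seg B x (r + s) t (wd [])))) =
    ((fac a)⁻¹ * (fac s)⁻¹) • sg K ((s - 1 + p) * degSum d 0 r + t * (s - 1 + p) + p * r) •
      B.repr (f a fun i => insertArg r (m s) x i) := by
  subst ha
  set z : ℕ → H := insertArg r (m s) x with hz
  set d' : ℕ → ℤ := fun i => if i < r then d i else if i = r then degSum d r s + (s - 1 + p)
    else d (i + s - 1) with hd'
  have hzr : z r = m s fun j => x (r + j) := by simp [hz, insertArg]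
  have hzd : ∀ i, z i ∈ 𝒢 (d' i) := by
    intro i
    by_cases h1 : i < r
    · simp only [hz, hd', insertArg, h1, if_true]
      exact hx i
    · by_cases h2 : i = r
      · subst h2
        simp only [hzr, hd', lt_irrefl, if_true, if_false, degSum]
        rw [← Fin.sum_univ_eq_sum_range fun j => d (i + j)]
        exact hm s (fun j => d (i + j)) _ fun j => hx _
      · simp only [hz, hd', insertArg, h1, h2, if_false]
        exact hx _
  have hseg : seg B z 0 (r + t + 1) (wd []) = seg B x 0 r (cons (B.repr (m s fun j => x (r + j)))
      (seg B x (r + s) t (wd []))) := by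
    rw [add_assoc, seg_add, zero_add, seg_succ, hzr]
    rw [seg_congr (y' := x) (b := 0) fun i hi => by simp [hz, insertArg, hi]]
    rw [seg_congr (y := z) (y' := x) (b := r + s) fun i hi => by
      have h1 : ¬ (r + 1 + i < r) := by omega
      have h2 : ¬ (r + 1 + i = r) := by omega
      simp only [hz, insertArg, h1, h2, if_false]
      congr 1
      omega]
  have hA : degSum d' 0 r = degSum d 0 r := degSum_congr fun i hi => by simp [hd', hi]
  have hD1 : decSum d' 0 r = decSum d 0 r := decSum_congr fun i hi => by simp [hd', hi]
  have hD2 : decSum d' (r + 1) t = decSum d (r + s) t := decSum_congr fun i hi => by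
    have h1 : ¬ (r + 1 + i < r) := by omega
    have h2 : ¬ (r + 1 + i = r) := by omega
    simp only [hd', h1, h2, if_false]
    congr 1
    omega
  have hdr : d' r = degSum d r s + (s - 1 + p) := by simp [hd']
  have hdec' : decSum d' 0 (r + t + 1) = decSum d 0 r + (t + 1) * degSum d 0 r +
      (t * (degSum d r s + (s - 1 + p)) + decSum d (r + s) t) := by
    rw [add_assoc, decSum_add, zero_add, decSum_succ, hA, hD1, hD2, hdr]
    push_cast
    ring
  have hdec : decSum d 0 (r + s + t) = decSum d 0 r + (s + t) * degSum d 0 r +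
      (decSum d r s + t * degSum d r s + decSum d (r + s) t) := by
    rw [add_assoc, decSum_add, zero_add, decSum_add]
    push_cast
    ring
  rw [bar_seg hB fac m (a := r) (d := d) fun i _ => hx _]
  simp only [map_smul, LinearMap.smul_apply]
  rw [← hseg, bar_seg hB fac f (a := 0) (d := d') fun i _ => hzd _]
  simp only [zero_add]
  simp only [smul_smul]
  congr 1
  have hsg : sg K (decSum d 0 (r + s + t)) * sg K (p * (degSum d 0 r + r)) *
      (sg K (decSum d r s) * sg K (decSum d' 0 (r + t + 1))) =
      sg K ((s - 1 + p) * degSum d 0 r + t * (s - 1 + p) + p * r) := by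
    rw [← sg_add, ← sg_add, ← sg_add, hdec, hdec']
    -- The listed exponents occur twice, once from the original word and once from the word after
    -- insertion, and drop out modulo two.
    refine Eq.trans ?_ (sg_add_two_mul _ (decSum d 0 r + decSum d r s + t * degSum d r s +
      decSum d (r + s) t + (t + 1) * degSum d 0 r))
    congr 1
    ring
  rw [← hsg]
  ring

end Inner

/-! ### Coalgebra maps as sums over compositions and their signs. -/

section Outer

variable {K H : Type*} [Field K] [AddCommGroup H] [Module K H]
  {I : Type*} {𝒢 : ℤ → Submodule K H} {B : Module.Basis I K H} {deg : I → ℤ}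

theorem toSeq_mem {n : ℕ} {d : Fin n → ℤ} {x : Fin n → H} (hx : ∀ i, x i ∈ 𝒢 (d i)) (i : ℕ) :
    toSeq x i ∈ 𝒢 (toSeq d i) := by
  unfold toSeq
  split_ifs
  · exact hx _
  · exact Submodule.zero_mem _

theorem toSeq_val {M : Type*} [Zero M] {n : ℕ} (x : Fin n → M) (i : Fin n) : toSeq x i = x i := by
  simp [toSeq]

/-- `φ(y_a, …) ⊗ ⋯ ⊗ φ(…, y_{a+n-1})` for consecutive blocks of given lengths. -/
def blockT (B : Module.Basis I K H) (φ : Tens K I →ₗ[K] (I →₀ K)) (y : ℕ → H) :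
    ℕ → List ℕ → Tens K I
  | _, [] => wd []
  | a, s :: b => cons (φ (seg B y a s (wd []))) (blockT B φ y (a + s) b)

theorem sum_composition_succ {M : Type*} [AddCommMonoid M] (n : ℕ) (F : List ℕ → M) :
    ∑ c : Composition (n + 1), F c.blocks =
      ∑ j ∈ Finset.range (n + 1), ∑ c : Composition (n - j), F ((j + 1) :: c.blocks) := by
  rw [Finset.sum_sigma']
  symm
  refine Finset.sum_bij (fun jc hjc => ⟨(jc.1 + 1) :: jc.2.blocks, ?_, ?_⟩) (fun _ _ => by simp)
    ?_ ?_ (fun _ _ => rfl)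
  · intro i hi
    rcases List.mem_cons.1 hi with rfl | hi
    · omega
    · exact jc.2.blocks_pos hi
  · have := Finset.mem_range.1 (Finset.mem_sigma.1 hjc).1
    rw [List.sum_cons, jc.2.blocks_sum]
    omega
  · rintro ⟨j, c⟩ _ ⟨j', c'⟩ _ h
    have h1 := congrArg Composition.blocks h
    simp only [List.cons.injEq, Nat.add_right_cancel_iff] at h1
    obtain ⟨rfl, h2⟩ := h1
    rw [Composition.ext h2]
  · rintro ⟨b, hb, hs⟩ _
    cases b with
    | nil => simp at hs
    | cons s b =>
      have hs0 : 0 < s := hb (by simp)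
      rw [List.sum_cons] at hs
      refine ⟨⟨s - 1, ⟨b, fun h => hb (List.mem_cons_of_mem _ h), by omega⟩⟩, ?_, ?_⟩
      · simp
        omega
      · simp only [Composition.mk.injEq, List.cons.injEq, and_true]
        omega

/-- Unrolling the recursion on the first block enumerates the compositions of `n`. -/
theorem lift_seg {φ : Tens K I →ₗ[K] (I →₀ K)} (hφ : φ (wd []) = 0) (y : ℕ → H) (a n : ℕ) :
    lift φ (seg B y a n (wd [])) = ∑ c : Composition n, blockT B φ y a c.blocks := by
  induction n using Nat.strong_induction_on generalizing a with
  | _ n ih =>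
    cases n with
    | zero =>
      have h : ∀ c : Composition 0, c.blocks = [] := fun c => c.blocks_eq_nil.2 rfl
      rw [seg_zero, lift_nil, Fintype.sum_eq_single default fun c hc =>
        absurd (Composition.ext (by rw [h, h])) hc, h]
      rfl
    | succ n =>
      rw [lift_eq hφ, comul_seg, Finset.sum_range_succ' _ (n + 1), seg_succ, counit_cons, zero_smul,
        zero_add, sum_composition_succ, map_add, map_add, map_tmul, seg_zero, hφ, zero_tmul,
        map_zero, add_zero, map_sum, map_sum]
      refine Finset.sum_congr rfl fun j hj => ?_
      rw [map_tmul, consT_tmul, Nat.add_sub_add_right, ih (n - j) (by omega), map_sum]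
      rfl

/-- The sequence of the values of `f` on consecutive blocks. -/
def blockVal (f : (n : ℕ) → MultilinearMap K (fun _ : Fin n => H) H) (y : ℕ → H) (a : ℕ)
    (b : List ℕ) (j : ℕ) : H :=
  f (b.getD j 0) fun i => y (a + (b.take j).sum + i)

/-- The degrees of the values of operations `f_n` of degree `n - 1` on consecutive blocks. -/
def blockDeg (d : ℕ → ℤ) (a : ℕ) (b : List ℕ) (j : ℕ) : ℤ :=
  degSum d (a + (b.take j).sum) (b.getD j 0) + (b.getD j 0 - 1)

/-- The exponent of the sign from the suspensions of the blocks. -/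
def blockSum (d : ℕ → ℤ) : ℕ → List ℕ → ℤ
  | _, [] => 0
  | a, s :: b => decSum d a s + blockSum d (a + s) b

theorem blockDeg_succ (d : ℕ → ℤ) (a s : ℕ) (b : List ℕ) (j : ℕ) :
    blockDeg d a (s :: b) (j + 1) = blockDeg d (a + s) b j := by
  simp [blockDeg, add_assoc]

theorem blockVal_succ (f : (n : ℕ) → MultilinearMap K (fun _ : Fin n => H) H) (y : ℕ → H)
    (a s : ℕ) (b : List ℕ) (j : ℕ) :
    blockVal f y a (s :: b) (j + 1) = blockVal f y (a + s) b j := by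
  simp only [blockVal, List.take_succ_cons, List.sum_cons, ← add_assoc]
  rfl

theorem blockT_bar [DirectSum.Decomposition 𝒢] (hB : ∀ i, B i ∈ 𝒢 (deg i)) (fac : ℕ → K)
    (f : (n : ℕ) → MultilinearMap K (fun _ : Fin n => H) H) {y : ℕ → H} {d : ℕ → ℤ}
    (hy : ∀ i, y i ∈ 𝒢 (d i)) (a : ℕ) (b : List ℕ) :
    blockT B (bar B deg fac f) y a b = ((b.map fac).prod)⁻¹ • sg K (blockSum d a b) •
      seg B (blockVal f y a b) 0 b.length (wd []) := by
  induction b generalizing a with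
  | nil => simp [blockT, blockSum, seg_zero, sg_zero]
  | cons s b ih =>
    rw [blockT, ih, bar_seg hB fac f (d := d) fun i _ => hy _, List.length_cons, seg_succ,
      seg_congr (y := blockVal f y a (s :: b)) (a := 0 + 1) (y' := blockVal f y (a + s) b) (b := 0) (fun i _ => by
        rw [add_comm (0 + 1), zero_add, zero_add, blockVal_succ]),
      blockSum, sg_add, List.map_cons, List.prod_cons, mul_inv]
    have : blockVal f y a (s :: b) 0 = f s fun i => y (a + i) := by
      simp only [blockVal, List.take_zero, List.sum_nil, add_zero]
      rfl
    rw [this]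
    simp only [map_smul, LinearMap.smul_apply, smul_smul]
    congr 1
    ring

/-- The left side collects the suspension signs of the whole word, of each block and of the sequence
of block values; the sum on the right is the exponent in `outerTerm`. In the induction over the
blocks everything else occurs twice. -/
theorem blockSum_parity (d : ℕ → ℤ) (a : ℕ) (b : List ℕ) : ∃ c : ℤ,
    decSum d a b.sum + (blockSum d a b + decSum (blockDeg d a b) 0 b.length) =
      (∑ j ∈ Finset.range b.length, ((b.getD j 0 : ℤ) - 1) *
        ((b.length : ℤ) - 1 - j + degSum d a (b.take j).sum)) + 2 * c := by
  induction b generalizing a with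
  | nil => exact ⟨0, by simp [decSum_zero, blockSum]⟩
  | cons s b ih =>
    obtain ⟨c, hc⟩ := ih (a + s)
    have h1 : ∑ j ∈ Finset.range b.length, ((b.getD j 0 : ℤ) - 1) = b.sum - b.length := by
      clear ih hc
      induction b with
      | nil => simp
      | cons s b ih =>
        rw [List.length_cons, Finset.sum_range_succ', List.sum_cons]
        simp only [List.getD_cons_succ, List.getD_cons_zero, ih]
        push_cast
        ring
    have h2 : ∑ j ∈ Finset.range (b.length + 1), (((s :: b).getD j 0 : ℤ) - 1) *
        (((b.length + 1 : ℕ) : ℤ) - 1 - j + degSum d a ((s :: b).take j).sum) =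
        (∑ j ∈ Finset.range b.length, ((b.getD j 0 : ℤ) - 1) *
          ((b.length : ℤ) - 1 - j + degSum d (a + s) (b.take j).sum)) +
        degSum d a s * (b.sum - b.length) + (s - 1) * b.length := by
      rw [Finset.sum_range_succ', ← h1, Finset.mul_sum, ← Finset.sum_add_distrib]
      congr 1
      · refine Finset.sum_congr rfl fun j _ => ?_
        rw [List.take_succ_cons, List.sum_cons, degSum_add, List.getD_cons_succ]
        push_cast
        ring
      · simp [degSum_zero]
    refine ⟨c + decSum d a s + b.length * degSum d a s, ?_⟩
    rw [List.length_cons, h2, List.sum_cons, decSum_add, blockSum, decSum_succ,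
      decSum_congr (d := blockDeg d a (s :: b)) (a := 0 + 1) (d' := blockDeg d (a + s) b) (b := 0) fun i _ => by
        rw [add_comm (0 + 1), zero_add, zero_add, blockDeg_succ]]
    have h3 : blockDeg d a (s :: b) 0 = degSum d a s + (s - 1) := by simp [blockDeg]
    rw [h3]
    linear_combination hc

theorem bar_blockT [DirectSum.Decomposition 𝒢] (hB : ∀ i, B i ∈ 𝒢 (deg i)) (fac : ℕ → K)
    (m : (n : ℕ) → MultilinearMap K (fun _ : Fin n => H) H)
    {f : (n : ℕ) → MultilinearMap K (fun _ : Fin n => H) H}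
    (hf : ∀ (s : ℕ) (d : Fin s → ℤ) (x : Fin s → H), (∀ i, x i ∈ 𝒢 (d i)) →
      f s x ∈ 𝒢 (∑ i, d i + (s - 1)))
    {n : ℕ} (c : Composition n) {d : Fin n → ℤ} {x : Fin n → H} (hx : ∀ i, x i ∈ 𝒢 (d i)) :
    sg K (decSum (toSeq d) 0 n) • bar B deg fac m (blockT B (bar B deg fac f) (toSeq x) 0 c.blocks) =
      (fac c.length * ∏ j, fac (c.blocksFun j))⁻¹ • B.repr (outerTerm m f c d x) := by
  have hx' := toSeq_mem hx
  have hdeg : ∀ i, blockVal f (toSeq x) 0 c.blocks i ∈ 𝒢 (blockDeg (toSeq d) 0 c.blocks i) := by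
    intro i
    rw [blockVal, blockDeg, degSum, ← Fin.sum_univ_eq_sum_range fun j => toSeq d (_ + j)]
    exact hf _ _ _ fun j => hx' _
  have hprod : ∏ j, fac (c.blocksFun j) = (c.blocks.map fac).prod := by
    rw [← List.prod_ofFn, ← c.ofFn_blocksFun, List.map_ofFn]
    rfl
  obtain ⟨e, he⟩ := blockSum_parity (toSeq d) 0 c.blocks
  rw [c.blocks_sum] at he
  have hval : (fun j : Fin c.length => f (c.blocksFun j) (fun i => x (c.embedding j i))) =
      fun j : Fin c.blocks.length => blockVal f (toSeq x) 0 c.blocks (0 + j) := by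
    funext j
    rw [blockVal]
    refine apply_congr_length (f := fun n => f n) ?_ fun i hi hi' => ?_
    · simp [Composition.blocksFun]
    · rw [← toSeq_val x, Composition.coe_embedding]
      simp [Composition.sizeUpTo]
  have hsum : ∑ j : Fin c.length, ((c.blocksFun j : ℤ) - 1) *
      ((c.length : ℤ) - 1 - j + ∑ i ∈ Finset.range (c.sizeUpTo j), toSeq d i) =
      ∑ j ∈ Finset.range c.blocks.length, ((c.blocks.getD j 0 : ℤ) - 1) *
        ((c.blocks.length : ℤ) - 1 - j + degSum (toSeq d) 0 (c.blocks.take j).sum) := by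
    rw [Finset.sum_range]
    refine Finset.sum_congr rfl fun j _ => ?_
    simp [Composition.blocksFun, Composition.sizeUpTo, degSum]
  rw [blockT_bar hB fac f hx', map_smul, map_smul,
    bar_seg hB fac m (d := blockDeg (toSeq d) 0 c.blocks) (fun i _ => hdeg _), outerTerm, hval,
    hprod, map_smul, hsum, mul_inv]
  simp only [smul_smul]
  congr 1
  have hsg := sg_add_two_mul (K := K) (∑ j ∈ Finset.range c.blocks.length,
    ((c.blocks.getD j 0 : ℤ) - 1) *
      ((c.blocks.length : ℤ) - 1 - j + degSum (toSeq d) 0 (c.blocks.take j).sum)) e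
  rw [← he, sg_add, sg_add] at hsg
  rw [← hsg]
  change _ = (fac c.blocks.length)⁻¹ * _ * _
  ring

end Outer

/-! ### Permutation signs before and after suspension. -/

section Permutations

variable {K : Type*} [Field K]

/-- The permutation sending `p` to `0`, and the other elements in the way given by `ρ`. -/
def permCons {n : ℕ} (p : Fin (n + 1)) (ρ : Equiv.Perm (Fin n)) : Equiv.Perm (Fin (n + 1)) :=
  Equiv.Perm.decomposeFin.symm (0, ρ) * p.cycleRange

@[simp] theorem permCons_self {n : ℕ} (p : Fin (n + 1)) (ρ : Equiv.Perm (Fin n)) :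
    permCons p ρ p = 0 := by
  simp [permCons]

@[simp] theorem permCons_succAbove {n : ℕ} (p : Fin (n + 1)) (ρ : Equiv.Perm (Fin n)) (j : Fin n) :
    permCons p ρ (p.succAbove j) = (ρ j).succ := by
  simp [permCons]

@[simp] theorem permCons_inv_zero {n : ℕ} (p : Fin (n + 1)) (ρ : Equiv.Perm (Fin n)) :
    (permCons p ρ)⁻¹ 0 = p := by
  rw [Equiv.Perm.inv_eq_iff_eq, permCons_self]

@[simp] theorem permCons_inv_succ {n : ℕ} (p : Fin (n + 1)) (ρ : Equiv.Perm (Fin n)) (j : Fin n) :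
    (permCons p ρ)⁻¹ j.succ = p.succAbove (ρ⁻¹ j) := by
  rw [Equiv.Perm.inv_eq_iff_eq, permCons_succAbove]; simp

theorem sign_permCons {n : ℕ} (p : Fin (n + 1)) (ρ : Equiv.Perm (Fin n)) :
    Equiv.Perm.sign (permCons p ρ) = (-1) ^ (p : ℕ) * Equiv.Perm.sign ρ := by
  simp [permCons, Fin.sign_cycleRange, mul_comm]

theorem permCons_bijective (n : ℕ) : Function.Bijective
    fun x : Fin (n + 1) × Equiv.Perm (Fin n) => permCons x.1 x.2 := by
  rw [Fintype.bijective_iff_injective_and_card]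
  constructor
  · rintro ⟨p, ρ⟩ ⟨p', ρ'⟩ h
    have h : permCons p ρ = permCons p' ρ' := h
    have hp : p = p' := (permCons p' ρ').injective (by rw [← h, permCons_self, h, permCons_self])
    subst hp
    congr 1
    ext j
    have := congrArg (fun σ => σ (p.succAbove j)) h
    simpa using congrArg Fin.val this
  · simp [Fintype.card_perm, Nat.factorial_succ]

theorem sum_perm_succ {M : Type*} [AddCommMonoid M] {n : ℕ} (F : Equiv.Perm (Fin (n + 1)) → M) :
    ∑ σ, F σ = ∑ p : Fin (n + 1), ∑ ρ : Equiv.Perm (Fin n), F (permCons p ρ) := by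
  rw [← Fintype.sum_prod_type']
  exact (Fintype.sum_bijective _ (permCons_bijective n) _ _ fun _ => rfl).symm

theorem succAbove_lt_self_iff {n : ℕ} (p : Fin (n + 1)) (j : Fin n) :
    p.succAbove j < p ↔ (j : ℕ) < p := by
  rw [Fin.succAbove_lt_iff_castSucc_lt, Fin.lt_def, Fin.val_castSucc]

theorem sg_sum {A : Type*} (s : Finset A) (f : A → ℤ) :
    sg K (∑ a ∈ s, f a) = ∏ a ∈ s, sg K (f a) := by
  classical
  induction s using Finset.induction_on with
  | empty => simp [sg_zero]
  | insert a s ha ih => rw [Finset.sum_insert ha, Finset.prod_insert ha, sg_add, ih]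

theorem sg_natCast (n : ℕ) : sg K n = (-1) ^ n := by
  simp [sg_eq_zpow]

/-- The inversions are those of `ρ` together with the pairs formed by position `p`, which takes the
least value, and each of the `p` positions before it. -/
theorem gammaSign_permCons {n : ℕ} (p : Fin (n + 1)) (ρ : Equiv.Perm (Fin n))
    (d : Fin (n + 1) → ℤ) : gammaSign K (permCons p ρ) d =
      sg K (p + d 0 * ∑ j ∈ Finset.univ.filter (fun j : Fin n => (j : ℕ) < p), d (ρ j).succ) *
        gammaSign K ρ fun j => d j.succ := by
  have h1 : ∏ x : Fin n, (if (x : ℕ) < p then sg K (d (ρ x).succ * d 0) else 1) =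
      sg K (d 0 * ∑ j ∈ Finset.univ.filter (fun j : Fin n => (j : ℕ) < p), d (ρ j).succ) := by
    rw [Finset.mul_sum, sg_sum, Finset.prod_filter]
    simp only [mul_comm]
  rw [gammaSign, gammaSign, sign_permCons, Fintype.prod_prod_type, Fintype.prod_prod_type,
    Fin.prod_univ_succAbove _ p]
  simp only [Fin.prod_univ_succAbove _ p, permCons_self, permCons_succAbove, if_false,
    Fin.not_lt_zero, and_false, Finset.prod_const_one, one_mul, Fin.succ_pos, and_true,
    Fin.succ_lt_succ_iff, Fin.succAbove_lt_succAbove_iff, succAbove_lt_self_iff]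
  rw [Finset.prod_mul_distrib, h1, sg_add, sg_natCast]
  push_cast
  ring

theorem gammaSign_inv {n : ℕ} (σ : Equiv.Perm (Fin n)) (d : Fin n → ℤ) :
    gammaSign K σ⁻¹ d = ((Equiv.Perm.sign σ : ℤ) : K) * ∏ ij : Fin n × Fin n,
      if ij.1 < ij.2 ∧ σ ij.2 < σ ij.1 then sg K (d ij.1 * d ij.2) else 1 := by
  rw [gammaSign, Equiv.Perm.sign_inv]
  congr 1
  refine Fintype.prod_equiv ((Equiv.prodComm _ _).trans (Equiv.prodCongr σ⁻¹ σ⁻¹)) _ _ fun x => ?_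
  simp [mul_comm, and_comm]

theorem gammaSign_inv_permCons {n : ℕ} (p : Fin (n + 1)) (ρ : Equiv.Perm (Fin n))
    (d : Fin (n + 1) → ℤ) : gammaSign K (permCons p ρ)⁻¹ d =
      sg K (p + d p * ∑ j ∈ Finset.univ.filter (fun j : Fin n => (j : ℕ) < p), d (p.succAbove j)) *
        gammaSign K ρ⁻¹ fun j => d (p.succAbove j) := by
  have h1 : ∏ x : Fin n, (if (x : ℕ) < p then sg K (d (p.succAbove x) * d p) else 1) =
      sg K (d p * ∑ j ∈ Finset.univ.filter (fun j : Fin n => (j : ℕ) < p), d (p.succAbove j)) := by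
    rw [Finset.mul_sum, sg_sum, Finset.prod_filter]
    simp only [mul_comm]
  rw [gammaSign_inv, gammaSign_inv, sign_permCons, Fintype.prod_prod_type, Fintype.prod_prod_type,
    Fin.prod_univ_succAbove _ p]
  simp only [Fin.prod_univ_succAbove _ p, permCons_self, permCons_succAbove, if_false,
    Fin.not_lt_zero, and_false, Finset.prod_const_one, one_mul, Fin.succ_pos, and_true,
    Fin.succ_lt_succ_iff, Fin.succAbove_lt_succAbove_iff, succAbove_lt_self_iff]
  rw [Finset.prod_mul_distrib, h1, sg_add, sg_natCast]
  push_cast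
  ring

theorem decSum_toSeq {n : ℕ} (d : Fin n → ℤ) :
    decSum (toSeq d) 0 n = ∑ i : Fin n, ((n : ℤ) - 1 - i) * d i := by
  have : ∀ (e : ℕ → ℤ) (a n : ℕ), decSum e a n = ∑ i : Fin n, ((n : ℤ) - 1 - i) * e (a + i) := by
    intro e a n
    induction n generalizing a with
    | zero => rfl
    | succ n ih =>
      rw [decSum_succ, ih, Fin.sum_univ_succ]
      congr 1
      · simp
      · refine Finset.sum_congr rfl fun i _ => ?_
        rw [Fin.val_succ, add_assoc, add_comm 1]
        push_cast
        ring
  rw [this]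
  simp [toSeq_val]

/-- Taking out the argument at position `p` lowers by one the coefficient of every argument in front
of it and leaves the later ones unchanged. -/
theorem decSum_succAbove {n : ℕ} (p : Fin (n + 1)) (d : Fin (n + 1) → ℤ) :
    decSum (toSeq d) 0 (n + 1) = (n - p) * d p + decSum (toSeq fun j => d (p.succAbove j)) 0 n +
      ∑ j ∈ Finset.univ.filter (fun j : Fin n => (j : ℕ) < p), d (p.succAbove j) := by
  rw [decSum_toSeq, decSum_toSeq, Fin.sum_univ_succAbove _ p, Finset.sum_filter, add_assoc,
    ← Finset.sum_add_distrib]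
  congr 1
  · push_cast
    ring
  · refine Finset.sum_congr rfl fun j _ => ?_
    by_cases h : (j : ℕ) < p
    · rw [if_pos h, Fin.succAbove_of_castSucc_lt _ _ (by rwa [Fin.lt_def, Fin.val_castSucc])]
      simp
      ring
    · rw [if_neg h, Fin.succAbove_of_le_castSucc _ _ (by
        rw [Fin.le_def, Fin.val_castSucc]; omega), Fin.val_succ]
      push_cast
      ring

variable (K) in
/-- The Koszul sign of a permutation of suspended arguments. -/
def suspSign {n : ℕ} (σ : Equiv.Perm (Fin n)) (d : Fin n → ℤ) : K :=
  gammaSign K σ d * sg K (decSum (toSeq d) 0 n) * sg K (decSum (toSeq fun i => d (σ i)) 0 n)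

theorem gammaSign_mul_sg {n : ℕ} (σ : Equiv.Perm (Fin n)) (d : Fin n → ℤ) :
    gammaSign K σ d * sg K (decSum (toSeq fun i => d (σ i)) 0 n) =
      sg K (decSum (toSeq d) 0 n) * suspSign K σ d := by
  rw [suspSign]
  have := sg_mul_self (K := K) (decSum (toSeq d) 0 n)
  linear_combination (- gammaSign K σ d * sg K (decSum (toSeq fun i => d (σ i)) 0 n)) * this

theorem sum_add_one_eq {n : ℕ} (s : Finset (Fin n)) (f : Fin n → ℤ) :
    ∑ j ∈ s, (f j + 1) = ∑ j ∈ s, f j + s.card := by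
  rw [Finset.sum_add_distrib]; simp

theorem card_filter_lt {n : ℕ} (p : Fin (n + 1)) :
    ((Finset.univ.filter fun j : Fin n => (j : ℕ) < p).card : ℤ) = p := by
  rw [Fin.card_filter_val_lt, min_eq_right (by omega)]

/-- Suspension absorbs the sign of the permutation: each of the `p` crossings contributes the
product of the two degrees raised by one. -/
theorem suspSign_permCons {n : ℕ} (p : Fin (n + 1)) (ρ : Equiv.Perm (Fin n))
    (d : Fin (n + 1) → ℤ) : suspSign K (permCons p ρ) d =
      sg K ((d 0 + 1) * ∑ j ∈ Finset.univ.filter (fun j : Fin n => (j : ℕ) < p), (d (ρ j).succ + 1)) *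
        suspSign K ρ fun j => d j.succ := by
  have h0 := decSum_succAbove 0 d
  have hp := decSum_succAbove p fun i => d (permCons p ρ i)
  simp only [permCons_self, permCons_succAbove] at hp
  simp only [Fin.succAbove_zero, Fin.val_zero, not_lt_zero, Finset.filter_false,
    Finset.sum_empty, add_zero] at h0
  rw [suspSign, suspSign, gammaSign_permCons, hp, h0, sum_add_one_eq, card_filter_lt]
  set S := ∑ j ∈ Finset.univ.filter (fun j : Fin n => (j : ℕ) < p), d (ρ j).succ
  have e : sg K ((p : ℤ) + d 0 * S) * sg K (((n : ℤ) - (0 : ℕ)) * d 0) * sg K ((n - p) * d 0) * sg K S =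
      sg K ((d 0 + 1) * (S + p)) := by
    rw [← sg_add, ← sg_add, ← sg_add]
    refine Eq.trans ?_ (sg_add_two_mul _ ((n - p) * d 0))
    congr 1
    push_cast
    ring
  rw [← e]
  simp only [sg_add]
  push_cast
  ring

theorem suspSign_inv_permCons {n : ℕ} (p : Fin (n + 1)) (ρ : Equiv.Perm (Fin n))
    (d : Fin (n + 1) → ℤ) : suspSign K (permCons p ρ)⁻¹ d =
      sg K ((d p + 1) * ∑ j ∈ Finset.univ.filter (fun j : Fin n => (j : ℕ) < p), (d (p.succAbove j) + 1)) *
        suspSign K ρ⁻¹ fun j => d (p.succAbove j) := by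
  have hp := decSum_succAbove p d
  have h0 := decSum_succAbove 0 fun i => d ((permCons p ρ)⁻¹ i)
  simp only [Fin.succAbove_zero, Fin.val_zero, not_lt_zero, Finset.filter_false,
    Finset.sum_empty, add_zero, permCons_inv_zero, permCons_inv_succ] at h0
  rw [suspSign, suspSign, gammaSign_inv_permCons, hp, h0, sum_add_one_eq, card_filter_lt]
  set S := ∑ j ∈ Finset.univ.filter (fun j : Fin n => (j : ℕ) < p), d (p.succAbove j)
  have e : sg K ((p : ℤ) + d p * S) * sg K (((n : ℤ) - (0 : ℕ)) * d p) * sg K ((n - p) * d p) * sg K S =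
      sg K ((d p + 1) * (S + p)) := by
    rw [← sg_add, ← sg_add, ← sg_add]
    refine Eq.trans ?_ (sg_add_two_mul _ ((n - p) * d p))
    congr 1
    push_cast
    ring
  rw [← e]
  simp only [sg_add]
  push_cast
  ring

end Permutations

/-! ### Symmetrization and shuffles as sums over permutations. -/

section PermutedWords

variable {K I : Type*} [Field K] {δ : I → ℤ}

theorem insertNth_succ_eq_cons {α : Type*} {n : ℕ} (p : Fin (n + 1)) (i : α)
    (u : Fin (n + 1) → α) : (p.succ.insertNth i u : Fin (n + 2) → α) =
      Fin.cons (u 0) (p.insertNth i fun j => u j.succ : Fin (n + 1) → α) := by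
  symm
  rw [Fin.eq_insertNth_iff]
  refine ⟨by simp, ?_⟩
  funext j
  refine Fin.cases ?_ (fun j => ?_) j
  · simp [Fin.removeNth]
  · simp [Fin.removeNth]

theorem sum_filter_val_lt_succ {n : ℕ} (p : Fin (n + 1)) (f : Fin (n + 1) → ℤ) :
    ∑ j ∈ Finset.univ.filter (fun j : Fin (n + 1) => (j : ℕ) < p.succ), f j =
      f 0 + ∑ j ∈ Finset.univ.filter (fun j : Fin n => (j : ℕ) < p), f j.succ := by
  rw [Finset.sum_filter, Finset.sum_filter, Fin.sum_univ_succ]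
  simp

theorem sh_letter_ofFn (i : I) {n : ℕ} (u : Fin n → I) :
    sh δ (wd [i] : Tens K I) (wd (List.ofFn u)) = ∑ p : Fin (n + 1),
      sg K (δ i * ∑ j ∈ Finset.univ.filter (fun j : Fin n => (j : ℕ) < p), δ (u j)) •
        wd (List.ofFn (p.insertNth i u : Fin (n + 1) → I)) := by
  induction n with
  | zero => simp [sg_zero]
  | succ n ih =>
    rw [Fin.sum_univ_succ, List.ofFn_succ, sh_letter_cons, ih fun j => u j.succ]
    congr 1
    · simp [sg_zero, List.ofFn_succ]
    · rw [map_sum, Finset.smul_sum]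
      refine Finset.sum_congr rfl fun p _ => ?_
      rw [map_smul, cons_single_wd, smul_smul, insertNth_succ_eq_cons, List.ofFn_cons,
        sum_filter_val_lt_succ, mul_add, sg_add, sg_eq_zpow (δ i * δ (u 0))]

theorem comp_permCons {α : Type*} {n : ℕ} (p : Fin (n + 1)) (ρ : Equiv.Perm (Fin n))
    (w : Fin (n + 1) → α) : (fun j => w (permCons p ρ j)) =
      p.insertNth (w 0) fun j => w (ρ j).succ := by
  rw [Fin.eq_insertNth_iff]
  refine ⟨by simp, ?_⟩
  funext j
  simp [Fin.removeNth]

/-- The formula for the graded symmetrization of a word. -/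
theorem symm_ofFn {n : ℕ} (w : Fin n → I) (d : I → ℤ) (hd : ∀ i, δ i = d i + 1) :
    symm δ (wd (List.ofFn w) : Tens K I) =
      ∑ σ : Equiv.Perm (Fin n), suspSign K σ (fun i => d (w i)) •
        wd (List.ofFn fun i => w (σ i)) := by
  induction n with
  | zero => simp [suspSign, gammaSign, decSum_zero, sg_zero]
  | succ n ih =>
    rw [List.ofFn_succ, symm_wd_cons, ih fun j => w j.succ, map_sum, sum_perm_succ,
      Finset.sum_comm]
    refine Finset.sum_congr rfl fun ρ _ => ?_
    rw [map_smul, sh_letter_ofFn, Finset.smul_sum]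
    refine Finset.sum_congr rfl fun p _ => ?_
    rw [comp_permCons p ρ w, suspSign_permCons, smul_smul, mul_comm]
    simp only [hd]

theorem symm_insertNth {n : ℕ} (p : Fin (n + 1)) (i : I) (u : Fin n → I) :
    symm δ (wd (List.ofFn (p.insertNth i u : Fin (n + 1) → I)) : Tens K I) =
      sg K (δ i * ∑ j ∈ Finset.univ.filter (fun j : Fin n => (j : ℕ) < p), δ (u j)) •
        sh δ (wd [i]) (symm δ (wd (List.ofFn u))) := by
  induction n with
  | zero =>
    rw [Subsingleton.elim (α := Fin 1) p 0]
    simp [sg_zero, symm_wd_cons]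
  | succ n ih =>
    refine Fin.cases ?_ (fun p => ?_) p
    · simp [sg_zero, List.ofFn_succ, symm_wd_cons]
    · rw [insertNth_succ_eq_cons, List.ofFn_cons, symm_wd_cons, ih, List.ofFn_succ, symm_wd_cons,
        sh_letter_comm, sum_filter_val_lt_succ, mul_add, sg_add, map_smul, smul_smul,
        ← sg_eq_zpow, mul_comm (sg K (δ i * δ (u 0))), mul_assoc, sg_mul_self, mul_one]

/-- Symmetric tensors are invariant under signed permutations. By induction on the length, the sign
for moving the first letter to position `p` occurs in both `symm_insertNth` and `suspSign_permCons`
and cancels. -/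
theorem symm_comp_perm {n : ℕ} (σ : Equiv.Perm (Fin n)) (w : Fin n → I) (d : I → ℤ)
    (hd : ∀ i, δ i = d i + 1) :
    suspSign K σ (fun i => d (w i)) • symm δ (wd (List.ofFn fun i => w (σ i))) =
      symm δ (wd (List.ofFn w) : Tens K I) := by
  induction n with
  | zero =>
    rw [Subsingleton.elim σ 1]
    simp [suspSign, gammaSign, decSum_zero, sg_zero]
  | succ n ih =>
    obtain ⟨⟨p, ρ⟩, rfl⟩ := (permCons_bijective n).2 σ
    simp only
    rw [comp_permCons p ρ w, symm_insertNth, suspSign_permCons, List.ofFn_succ, symm_wd_cons,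
      ← ih ρ fun j => w j.succ, map_smul, smul_smul]
    simp only [hd]
    rw [mul_right_comm, sg_mul_self, one_mul]

/-- The permutations that are increasing on the first `q` and on the last `n - q` elements. -/
def IsShuffle (n q : ℕ) (σ : Equiv.Perm (Fin n)) : Prop :=
  ∀ i j : Fin n, i < j → ((j : ℕ) < q ∨ q ≤ (i : ℕ)) → σ i < σ j

instance (n q : ℕ) : DecidablePred (IsShuffle n q) := fun σ => by
  unfold IsShuffle; infer_instance

/-- The least value must be taken at the start of one of the two increasing runs, position `0` or
position `q`. This matches the two terms in the recursion for the shuffle product. -/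
theorem isShuffle_permCons {n q : ℕ} (p : Fin (n + 1)) (ρ : Equiv.Perm (Fin n)) :
    IsShuffle (n + 1) q (permCons p ρ) ↔
      ((p : ℕ) = 0 ∧ 0 < q ∧ IsShuffle n (q - 1) ρ) ∨ ((p : ℕ) = q ∧ IsShuffle n q ρ) := by
  constructor
  · intro h
    have hnot : ∀ i, i < p → ((p : ℕ) < q ∨ q ≤ (i : ℕ)) → False := fun i hi hiq => by
      have := h i p hi hiq
      rw [permCons_self] at this
      exact absurd this (Fin.not_lt_zero _)
    have hρ : ∀ q' : ℕ, (∀ i j : Fin n, i < j → ((j : ℕ) < q' ∨ q' ≤ (i : ℕ)) →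
        ((p.succAbove j : ℕ) < q ∨ q ≤ (p.succAbove i : ℕ))) → IsShuffle n q' ρ := by
      intro q' hq' i j hij hq
      have := h (p.succAbove i) (p.succAbove j) (by simpa using hij) (hq' i j hij hq)
      simpa using this
    by_cases hpq : (p : ℕ) = q
    · refine Or.inr ⟨hpq, hρ q fun i j _ hq => ?_⟩
      rcases hq with hq | hq
      · left
        rw [Fin.succAbove_of_castSucc_lt _ _ (by rw [Fin.lt_def, Fin.val_castSucc]; omega)]
        simpa using hq
      · right
        rw [Fin.succAbove_of_le_castSucc _ _ (by rw [Fin.le_def, Fin.val_castSucc]; omega),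
          Fin.val_succ]
        omega
    · have hp0 : p = 0 := by
        by_contra hp
        have hp' : 0 < (p : ℕ) := Nat.pos_of_ne_zero fun h => hp (Fin.ext h)
        rcases Nat.lt_or_ge p q with h1 | h1
        · exact hnot 0 (by rw [Fin.lt_def]; exact hp') (Or.inl h1)
        · exact hnot ⟨p - 1, by omega⟩ (Fin.lt_def.2 (by change (p : ℕ) - 1 < p; omega))
            (Or.inr (by change q ≤ (p : ℕ) - 1; omega))
      subst hp0
      rw [Fin.val_zero] at hpq
      refine Or.inl ⟨rfl, by omega, hρ (q - 1) fun i j _ hq => ?_⟩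
      simp only [Fin.succAbove_zero, Fin.val_succ]
      omega
  · rintro (⟨hp, hq, h⟩ | ⟨hp, h⟩) i j hij hijq
    · obtain rfl : p = 0 := Fin.ext hp
      have hj : j ≠ 0 := (Fin.zero_le i |>.trans_lt hij).ne'
      obtain ⟨j, rfl⟩ := Fin.exists_succ_eq.2 hj
      have ej := permCons_succAbove 0 ρ j
      rw [Fin.succAbove_zero] at ej
      rw [ej]
      by_cases hi : i = 0
      · rw [hi, permCons_self]
        exact Fin.succ_pos _
      · obtain ⟨i, rfl⟩ := Fin.exists_succ_eq.2 hi
        have ei := permCons_succAbove 0 ρ i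
        rw [Fin.succAbove_zero] at ei
        rw [ei, Fin.succ_lt_succ_iff]
        refine h i j (by simpa using hij) ?_
        simp only [Fin.val_succ] at hijq
        omega
    · have hj : j ≠ p := by
        rintro rfl
        rw [Fin.lt_def] at hij
        omega
      obtain ⟨j, rfl⟩ := Fin.exists_succAbove_eq hj
      rw [permCons_succAbove]
      by_cases hi : i = p
      · rw [hi, permCons_self]
        exact Fin.succ_pos _
      · obtain ⟨i, rfl⟩ := Fin.exists_succAbove_eq hi
        rw [permCons_succAbove, Fin.succ_lt_succ_iff]
        refine h i j (by simpa using hij) ?_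
        rcases hijq with hq | hq
        · left
          by_cases hjp : (j : ℕ) < p
          · omega
          · rw [Fin.succAbove_of_le_castSucc _ _ (by rw [Fin.le_def, Fin.val_castSucc]; omega),
              Fin.val_succ] at hq
            omega
        · right
          by_cases hip : (i : ℕ) < p
          · rw [Fin.succAbove_of_castSucc_lt _ _ (by rw [Fin.lt_def, Fin.val_castSucc]; omega)] at hq
            simp at hq
            omega
          · omega

theorem comp_permCons_inv {α : Type*} {n : ℕ} (p : Fin (n + 1)) (ρ : Equiv.Perm (Fin n))
    (w : Fin (n + 1) → α) : (fun j => w ((permCons p ρ)⁻¹ j)) =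
      Fin.cons (w p) fun j => w (p.succAbove (ρ⁻¹ j)) := by
  funext j
  refine Fin.cases ?_ (fun j => ?_) j
  · simp only [permCons_inv_zero, Fin.cons_zero]
  · simp only [permCons_inv_succ, Fin.cons_succ]

/-- The formula for the shuffle product of two words. -/
theorem sh_take_drop {n q : ℕ} (hq : q ≤ n) (w : Fin n → I) (d : I → ℤ)
    (hd : ∀ i, δ i = d i + 1) :
    sh δ (wd ((List.ofFn w).take q) : Tens K I) (wd ((List.ofFn w).drop q)) =
      ∑ σ ∈ Finset.univ.filter (IsShuffle n q), suspSign K σ⁻¹ (fun i => d (w i)) •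
        wd (List.ofFn fun i => w (σ⁻¹ i)) := by
  induction n generalizing q with
  | zero =>
    obtain rfl : q = 0 := by omega
    rw [Finset.sum_eq_single 1]
    · simp [suspSign, gammaSign, decSum_zero, sg_zero]
    · intro σ _ hσ
      exact absurd (Subsingleton.elim _ _) hσ
    · intro h
      exact absurd (Finset.mem_filter.2 ⟨Finset.mem_univ _, fun i => i.elim0⟩) h
  | succ n ih =>
    have hS : ∀ (p : Fin (n + 1)) (q' : ℕ), q' ≤ n →
        (∑ ρ : Equiv.Perm (Fin n), if IsShuffle n q' ρ then
          suspSign K (permCons p ρ)⁻¹ (fun i => d (w i)) •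
            wd (List.ofFn fun i => w ((permCons p ρ)⁻¹ i)) else (0 : Tens K I)) =
        sg K (δ (w p) * ∑ j ∈ Finset.univ.filter (fun j : Fin n => (j : ℕ) < p),
            δ (w (p.succAbove j))) •
          cons (Finsupp.single (w p) 1)
            (sh δ (wd ((List.ofFn fun j => w (p.succAbove j)).take q'))
              (wd ((List.ofFn fun j => w (p.succAbove j)).drop q'))) := by
      intro p q' hq'
      rw [ih hq' fun j => w (p.succAbove j), map_sum, Finset.smul_sum, ← Finset.sum_filter]
      refine Finset.sum_congr rfl fun ρ _ => ?_
      rw [map_smul, cons_single_wd, smul_smul, suspSign_inv_permCons, comp_permCons_inv,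
        List.ofFn_cons]
      simp only [hd]
    have hsplit : ∀ (p : Fin (n + 1)) (ρ : Equiv.Perm (Fin n)) (t : Tens K I),
        (if IsShuffle (n + 1) q (permCons p ρ) then t else 0) =
        (if (p : ℕ) = 0 then if 0 < q then if IsShuffle n (q - 1) ρ then t else 0 else 0 else 0) +
        (if (p : ℕ) = q then if IsShuffle n q ρ then t else 0 else 0) := by
      intro p ρ t
      simp only [isShuffle_permCons]
      by_cases h0 : (p : ℕ) = 0
      · by_cases hq0 : 0 < q
        · have : (p : ℕ) ≠ q := by omega
          simp [h0, hq0, hq0.ne]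
        · simp [h0, show q = 0 by omega]
      · simp [h0]
        split_ifs <;> simp_all
    rw [Finset.sum_filter, sum_perm_succ]
    simp only [hsplit, Finset.sum_add_distrib]
    rw [Finset.sum_eq_single (0 : Fin (n + 1)) (fun p _ hp => by
      have : (p : ℕ) ≠ 0 := fun h => hp (Fin.ext h)
      simp [this]) (fun h => absurd (Finset.mem_univ _) h)]
    simp only [Fin.val_zero, if_true]
    rcases Nat.eq_zero_or_pos q with rfl | hq0
    · simp only [lt_irrefl, if_false, Finset.sum_const_zero, zero_add]
      rw [Finset.sum_eq_single (0 : Fin (n + 1)) (fun p _ hp => by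
        have : (p : ℕ) ≠ 0 := fun h => hp (Fin.ext h)
        simp [this]) (fun h => absurd (Finset.mem_univ _) h)]
      simp only [Fin.val_zero, if_true]
      rw [hS 0 0 (Nat.zero_le _)]
      simp [sg_zero]
    · obtain ⟨q, rfl⟩ : ∃ q', q = q' + 1 := ⟨q - 1, by omega⟩
      simp only [hq0, if_true, Nat.add_sub_cancel]
      rw [hS 0 q (by omega)]
      simp only [Fin.succAbove_zero, Fin.val_zero, not_lt_zero, Finset.filter_false,
        Finset.sum_empty, mul_zero, sg_zero, one_smul]
      rw [List.ofFn_succ, List.take_succ_cons, List.drop_succ_cons]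
      -- With letters left in the second word, its first letter can come first and crosses the whole
      -- first word. If the second word is empty, only the first term of the recursion exists.
      rcases Nat.lt_or_ge q n with hqn | hqn
      · rw [Finset.sum_eq_single (⟨q + 1, by omega⟩ : Fin (n + 1)) (fun p _ hp => by
          have : (p : ℕ) ≠ q + 1 := fun h => hp (Fin.ext h)
          simp [this]) (fun h => absurd (Finset.mem_univ _) h)]
        simp only [if_true]
        rw [hS _ (q + 1) hqn]
        set p : Fin (n + 1) := ⟨q + 1, by omega⟩
        have hlow : ∀ j : Fin n, (j : ℕ) < q + 1 → p.succAbove j = j.castSucc := fun j hj =>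
          Fin.succAbove_of_castSucc_lt _ _ (by rw [Fin.lt_def, Fin.val_castSucc]; exact hj)
        have hhigh : ∀ j : Fin n, q + 1 ≤ (j : ℕ) → p.succAbove j = j.succ := fun j hj =>
          Fin.succAbove_of_le_castSucc _ _ (by rw [Fin.le_def, Fin.val_castSucc]; exact hj)
        have h1 : (List.ofFn fun i : Fin n => w i.succ).drop q = w p ::
            (List.ofFn fun j => w (p.succAbove j)).drop (q + 1) := by
          refine List.ext_getElem (by simp; omega) fun i hi hi' => ?_
          cases i with
          | zero => simp [p, Fin.succ]
          | succ i =>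
            simp only [List.length_drop, List.length_ofFn] at hi
            simp only [List.getElem_drop, List.getElem_ofFn, List.getElem_cons_succ]
            rw [hhigh _ (by simp)]
            congr 2
            ext
            simp
            omega
        have h2 : w 0 :: (List.ofFn fun i : Fin n => w i.succ).take q =
            (List.ofFn fun j => w (p.succAbove j)).take (q + 1) := by
          rw [← List.take_succ_cons, ← List.ofFn_succ (f := w)]
          refine List.ext_getElem (by simp; omega) fun i hi hi' => ?_
          simp only [List.length_take, List.length_ofFn] at hi'
          simp only [List.getElem_take, List.getElem_ofFn]
          rw [hlow _ (by simp; omega)]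
          rfl
        have h3 : wdeg δ ((List.ofFn fun j => w (p.succAbove j)).take (q + 1)) =
            ∑ j ∈ Finset.univ.filter (fun j : Fin n => (j : ℕ) < p), δ (w (p.succAbove j)) := by
          rw [wdeg, List.map_take, List.map_ofFn, List.sum_take_ofFn]
          rfl
        rw [h1, ← cons_single_wd (w p), sh_cons, h2]
        congr 1
        rw [twistV, scaleV_single, map_smul, LinearMap.smul_apply, h3, sg_eq_zpow, ← zpow_mul,
          mul_comm]
      · have h1 : (List.ofFn fun i : Fin n => w i.succ).drop q = [] := by simp [hqn]
        rw [Finset.sum_eq_zero fun p _ => by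
          have : (p : ℕ) ≠ q + 1 := by omega
          simp [this]]
        rw [h1]
        simp

end PermutedWords

/-! ### Degree and symmetry conditions translated to words. -/

section CochainsOnWords

variable {K H : Type*} [Field K] [AddCommGroup H] [Module K H]
  {I : Type*} {𝒢 : ℤ → Submodule K H} {B : Module.Basis I K H} {deg : I → ℤ}

variable (K) in
/-- The weights: `n!` for Lie algebras, where operations correspond to sums over unshuffles. -/
def weight (P : OperadKind) (n : ℕ) : K :=
  match P with
  | .lie => n.factorial
  | _ => 1

theorem weight_ne_zero [CharZero K] (P : OperadKind) (n : ℕ) : weight K P n ≠ 0 := by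
  cases P
  · exact one_ne_zero
  · exact one_ne_zero
  · exact Nat.cast_ne_zero.2 n.factorial_ne_zero

variable (K) in
/-- The projection onto the subcoalgebra of the tensor coalgebra on which operations live. -/
def symOf (P : OperadKind) (δ : I → ℤ) : Tens K I →ₗ[K] Tens K I :=
  match P with
  | .lie => symProj δ
  | _ => LinearMap.id

theorem isSym_symOf [CharZero K] (P : OperadKind) (δ : I → ℤ) : IsSym δ (symOf K P δ) := by
  cases P
  · exact isSym_id
  · exact isSym_id
  · exact isSym_symProj δ

theorem scaleV_apply (δ : I → ℤ) (c : Kˣ) (v : I →₀ K) (i : I) :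
    scaleV δ c v i = ((c ^ δ i : Kˣ) : K) * v i := by
  have : Finsupp.lapply i ∘ₗ scaleV δ c = ((c ^ δ i : Kˣ) : K) • Finsupp.lapply i :=
    Finsupp.lhom_ext' fun j => LinearMap.ext_ring (by
      by_cases h : j = i
      · subst h; simp
      · simp [h])
  exact LinearMap.congr_fun this v

/-- In characteristic zero the powers of `2` with distinct exponents differ, so scaling by `c = 2`
already detects the degree of every coordinate. -/
theorem repr_symm_mem_of_scaleV [CharZero K] (hB : ∀ i, B i ∈ 𝒢 (deg i)) {a : ℤ} {v : I →₀ K}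
    (hv : ∀ c : Kˣ, scaleV (fun i => deg i + 1) c v = ((c ^ (a + 1) : Kˣ) : K) • v) :
    B.repr.symm v ∈ 𝒢 a := by
  rw [Module.Basis.repr_symm_apply, Finsupp.linearCombination_apply]
  refine Submodule.sum_mem _ fun i hi => Submodule.smul_mem _ _ ?_
  have h1 := DFunLike.congr_fun (hv (Units.mk0 2 two_ne_zero)) i
  rw [scaleV_apply, Finsupp.smul_apply, smul_eq_mul] at h1
  have h2 := mul_right_cancel₀ (Finsupp.mem_support_iff.1 hi) h1
  simp only [Units.val_zpow_eq_zpow_val, Units.val_mk0] at h2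
  have h3 : (2 : ℚ) ^ (deg i + 1) = 2 ^ (a + 1) := by
    have : (((2 : ℚ) ^ (deg i + 1) : ℚ) : K) = ((2 ^ (a + 1) : ℚ) : K) := by
      push_cast
      exact h2
    exact_mod_cast this
  have h4 := zpow_right_injective₀ (by norm_num) (by norm_num) h3
  have h5 : deg i = a := by omega
  exact h5 ▸ hB i

theorem bar_word (fac : ℕ → K) (f : (n : ℕ) → MultilinearMap K (fun _ : Fin n => H) H)
    {n : ℕ} (w : Fin n → I) : bar B deg fac f (wd (List.ofFn w)) =
      (fac n)⁻¹ • sg K (decSum (toSeq fun i => deg (w i)) 0 n) • B.repr (f n fun i => B (w i)) :=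
  bar_ofFn fac f w _ 0 fun i => by rw [zero_add, toSeq_val]

theorem unbar_word (fac : ℕ → K) (β : Tens K I →ₗ[K] (I →₀ K)) {n : ℕ} (w : Fin n → I) :
    unbar B deg fac β n (fun i => B (w i)) = B.repr.symm (fac n •
      sg K (decSum (toSeq fun i => deg (w i)) 0 n) • β (wd (List.ofFn w))) := by
  rw [unbar_basis, wordSum_ofFn w (toSeq fun i => deg (w i)) 0 fun i => by
    rw [zero_add, toSeq_val]]

theorem wdeg_ofFn (δ : I → ℤ) {n : ℕ} (w : Fin n → I) :
    wdeg δ (List.ofFn w) = ∑ i, δ (w i) := by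
  rw [wdeg, List.map_ofFn, List.sum_ofFn]
  rfl

theorem hasDeg_bar [DirectSum.Decomposition 𝒢] (hB : ∀ i, B i ∈ 𝒢 (deg i)) (fac : ℕ → K) {p : ℤ}
    {f : (n : ℕ) → MultilinearMap K (fun _ : Fin n => H) H}
    (hf : ∀ (n : ℕ) (d : Fin n → ℤ) (x : Fin n → H), (∀ i, x i ∈ 𝒢 (d i)) →
      f n x ∈ 𝒢 (∑ i, d i + (n - 1 + p))) :
    HasDeg (fun i => deg i + 1) p (bar B deg fac f) := by
  intro c t
  have : scaleV (fun i => deg i + 1) c ∘ₗ bar B deg fac f =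
      ((c ^ p : Kˣ) : K) • bar B deg fac f ∘ₗ scale (fun i => deg i + 1) c := tens_ext fun w => by
    obtain ⟨n, w, rfl⟩ : ∃ (n : ℕ) (w' : Fin n → I), w = List.ofFn w' := ⟨_, w.get, by simp⟩
    simp only [LinearMap.comp_apply, LinearMap.smul_apply, scale_wd, map_smul, bar_word]
    have h1 : c ^ (∑ i, deg (w i) + ((n : ℤ) - 1 + p) + 1) =
        c ^ p * c ^ wdeg (fun i => deg i + 1) (List.ofFn w) := by
      rw [← zpow_add, wdeg_ofFn, Finset.sum_add_distrib, Finset.sum_const, Finset.card_univ,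
        Fintype.card_fin, nsmul_one]
      congr 1
      ring
    rw [scaleV_repr hB c (hf n _ _ fun i => hB (w i)), h1, Units.val_mul]
    simp only [smul_smul]
    congr 1
    ring
  exact LinearMap.congr_fun this t

theorem unbar_mem [CharZero K] [DirectSum.Decomposition 𝒢] (hB : ∀ i, B i ∈ 𝒢 (deg i))
    (fac : ℕ → K) {p : ℤ} {β : Tens K I →ₗ[K] (I →₀ K)} (hβ : HasDeg (fun i => deg i + 1) p β)
    {n : ℕ} {d : Fin n → ℤ} {x : Fin n → H} (hx : ∀ i, x i ∈ 𝒢 (d i)) :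
    unbar B deg fac β n x ∈ 𝒢 (∑ i, d i + (n - 1 + p)) := by
  rw [← Submodule.Quotient.mk_eq_zero]
  exact multilinear_ext_of_basis hB
    (f := (Submodule.mkQ (𝒢 (∑ i, d i + (n - 1 + p)))).compMultilinearMap (unbar B deg fac β n))
    (g := 0) (fun w hw => by
      rw [LinearMap.compMultilinearMap_apply, zero_apply, Submodule.mkQ_apply,
        Submodule.Quotient.mk_eq_zero, unbar_word]
      refine repr_symm_mem_of_scaleV hB fun c => ?_
      rw [map_smul, map_smul, hβ, scale_wd, map_smul, smul_smul ((c ^ p : Kˣ) : K),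
        ← Units.val_mul, ← zpow_add, smul_comm (sg K _), smul_comm (fac n)]
      congr 3
      rw [wdeg_ofFn, Finset.sum_add_distrib]
      simp [hw]
      ring) hx

theorem symm_tensMap [DirectSum.Decomposition 𝒢] (hB : ∀ i, B i ∈ 𝒢 (deg i))
    {n : ℕ} {d : Fin n → ℤ} {x : Fin n → H} (hx : ∀ i, x i ∈ 𝒢 (d i)) :
    symm (fun i => deg i + 1) (tensMap B n x) =
      ∑ σ : Equiv.Perm (Fin n), suspSign K σ d • tensMap B n fun i => x (σ i) := by
  have := multilinear_ext_of_basis hB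
    (f := (symm (fun i => deg i + 1)).compMultilinearMap (tensMap B n))
    (g := ∑ σ : Equiv.Perm (Fin n), suspSign K σ d • (tensMap B n).domDomCongr σ)
    (fun w hw => by
      obtain rfl : (fun i => deg (w i)) = d := funext hw
      simp only [LinearMap.compMultilinearMap_apply, sum_apply,
        smul_apply, MultilinearMap.domDomCongr_apply, tensMap_basis]
      exact symm_ofFn w deg fun _ => rfl) hx
  simpa only [LinearMap.compMultilinearMap_apply, sum_apply,
    smul_apply, MultilinearMap.domDomCongr_apply] using this

theorem tensMap_mem_lenSub {n : ℕ} (x : Fin n → H) : tensMap B n x ∈ lenSub K I n := by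
  rw [tensMap_eq_seg_toSeq]
  simpa using seg_mem_lenSub (B := B) (toSeq x) 0 n (wd_mem_lenSub (K := K) ([] : List I))

theorem symProj_eq_smul (δ : I → ℤ) {n : ℕ} {t : Tens K I} (ht : t ∈ lenSub K I n) :
    symProj δ t = (n.factorial : K)⁻¹ • symm δ t :=
  lenSub_induction (f := (symProj δ : Tens K I →ₗ[K] _)) (g := (n.factorial : K)⁻¹ • symm δ)
    (fun w hw => by rw [symProj_wd, hw]; rfl) ht

theorem bar_comp_symProj [CharZero K] [DirectSum.Decomposition 𝒢] (hB : ∀ i, B i ∈ 𝒢 (deg i))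
    (fac : ℕ → K)
    {f : (n : ℕ) → MultilinearMap K (fun _ : Fin n => H) H}
    (hf : ∀ (n : ℕ) (σ : Equiv.Perm (Fin n)) (d : Fin n → ℤ) (x : Fin n → H),
      (∀ i, x i ∈ 𝒢 (d i)) → gammaSign K σ d • f n (fun i => x (σ i)) = f n x) :
    bar B deg fac f ∘ₗ symProj (fun i => deg i + 1) = bar B deg fac f := tens_ext fun w => by
  obtain ⟨n, w, rfl⟩ : ∃ (n : ℕ) (w' : Fin n → I), w = List.ofFn w' := ⟨_, w.get, by simp⟩
  have h1 : ∀ σ : Equiv.Perm (Fin n), suspSign K σ (fun i => deg (w i)) •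
      bar B deg fac f (wd (List.ofFn fun i => w (σ i))) = bar B deg fac f (wd (List.ofFn w)) := by
    intro σ
    rw [bar_word, bar_word, ← hf n σ _ _ fun i => hB (w i), map_smul, suspSign]
    simp only [smul_smul]
    congr 1
    have := sg_mul_self (K := K) (decSum (toSeq fun i => deg (w (σ i))) 0 n)
    linear_combination ((fac n)⁻¹ * gammaSign K σ (fun i => deg (w i)) *
      sg K (decSum (toSeq fun i => deg (w i)) 0 n)) * this
  rw [LinearMap.comp_apply, symProj_wd, symm_ofFn w deg fun _ => rfl, map_smul, map_sum]
  simp only [map_smul, h1]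
  rw [Finset.sum_const, Finset.card_univ, Fintype.card_perm, Fintype.card_fin, List.length_ofFn,
    ← Nat.cast_smul_eq_nsmul K, smul_smul,
    inv_mul_cancel₀ (Nat.cast_ne_zero.2 n.factorial_ne_zero), one_smul]

theorem unbar_antisymm [CharZero K] [DirectSum.Decomposition 𝒢] (hB : ∀ i, B i ∈ 𝒢 (deg i))
    (fac : ℕ → K) {β : Tens K I →ₗ[K] (I →₀ K)} (hβ : β ∘ₗ symProj (fun i => deg i + 1) = β)
    {n : ℕ} (σ : Equiv.Perm (Fin n)) {d : Fin n → ℤ} {x : Fin n → H} (hx : ∀ i, x i ∈ 𝒢 (d i)) :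
    gammaSign K σ d • unbar B deg fac β n (fun i => x (σ i)) = unbar B deg fac β n x := by
  refine multilinear_ext_of_basis hB
    (f := gammaSign K σ d • (unbar B deg fac β n).domDomCongr σ) (fun w hw => ?_) hx
  obtain rfl : (fun i => deg (w i)) = d := funext hw
  have h1 : ∀ w : Fin n → I, β (wd (List.ofFn w)) =
      (n.factorial : K)⁻¹ • β (symm (fun i => deg i + 1) (wd (List.ofFn w))) := fun w => by
    rw [← map_smul, ← symProj_eq_smul (fun i => deg i + 1)
      (by simpa using wd_mem_lenSub (K := K) (List.ofFn w))]
    exact (LinearMap.congr_fun hβ _).symm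
  rw [smul_apply, MultilinearMap.domDomCongr_apply, unbar_word,
    unbar_word (deg := deg) fac β w, h1, h1 w, ← symm_comp_perm σ w deg fun _ => rfl]
  simp only [map_smul, smul_smul]
  congr 1
  have := gammaSign_mul_sg (K := K) σ fun i => deg (w i)
  linear_combination (fac n * (n.factorial : K)⁻¹) * this

theorem killsShuffles_bar [DirectSum.Decomposition 𝒢] (hB : ∀ i, B i ∈ 𝒢 (deg i)) (fac : ℕ → K)
    {f : (n : ℕ) → MultilinearMap K (fun _ : Fin n => H) H}
    (hf : ∀ (n q : ℕ), 0 < q → q < n → ∀ (d : Fin n → ℤ) (x : Fin n → H), (∀ i, x i ∈ 𝒢 (d i)) →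
      ∑ σ ∈ Finset.univ.filter (IsShuffle n q),
        gammaSign K σ⁻¹ d • f n (fun i => x (σ⁻¹ i)) = 0) :
    KillsShuffles (fun i => deg i + 1) (bar B deg fac f) := by
  intro u v hu hv
  obtain ⟨n, w, q, hq0, hqn, rfl, rfl⟩ : ∃ (n : ℕ) (w : Fin n → I) (q : ℕ), 0 < q ∧ q < n ∧
      u = (List.ofFn w).take q ∧ v = (List.ofFn w).drop q :=
    ⟨_, (u ++ v).get, u.length, List.length_pos_iff.2 hu, by
      have := List.length_pos_iff.2 hv
      simp
      omega, by simp only [List.ofFn_get, List.take_left'], by simp only [List.ofFn_get, List.drop_left']⟩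
  rw [sh_take_drop hqn.le w deg fun _ => rfl, map_sum]
  have h1 : ∀ σ : Equiv.Perm (Fin n), bar B deg fac f (suspSign K σ⁻¹ (fun i => deg (w i)) •
      wd (List.ofFn fun i => w (σ⁻¹ i))) =
      ((fac n)⁻¹ * sg K (decSum (toSeq fun i => deg (w i)) 0 n)) • B.repr
        (gammaSign K σ⁻¹ (fun i => deg (w i)) • f n fun i => B (w (σ⁻¹ i))) := by
    intro σ
    rw [map_smul, bar_word, map_smul, suspSign]
    simp only [smul_smul]
    congr 1
    have := sg_mul_self (K := K) (decSum (toSeq fun i => deg (w (σ⁻¹ i))) 0 n)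
    linear_combination ((fac n)⁻¹ * gammaSign K σ⁻¹ (fun i => deg (w i)) *
      sg K (decSum (toSeq fun i => deg (w i)) 0 n)) * this
  simp only [h1]
  rw [← Finset.smul_sum, ← map_sum, hf n q hq0 hqn _ _ fun i => hB (w i), map_zero, smul_zero]

theorem unbar_shuffle [DirectSum.Decomposition 𝒢] (hB : ∀ i, B i ∈ 𝒢 (deg i)) (fac : ℕ → K)
    {β : Tens K I →ₗ[K] (I →₀ K)} (hβ : KillsShuffles (fun i => deg i + 1) β)
    {n q : ℕ} (hq0 : 0 < q) (hqn : q < n) {d : Fin n → ℤ} {x : Fin n → H}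
    (hx : ∀ i, x i ∈ 𝒢 (d i)) : ∑ σ ∈ Finset.univ.filter (IsShuffle n q),
      gammaSign K σ⁻¹ d • unbar B deg fac β n (fun i => x (σ⁻¹ i)) = 0 := by
  have := multilinear_ext_of_basis hB
    (f := ∑ σ ∈ Finset.univ.filter (IsShuffle n q),
      gammaSign K σ⁻¹ d • (unbar B deg fac β n).domDomCongr σ⁻¹) (g := 0) (fun w hw => ?_) hx
  · simpa only [sum_apply, smul_apply, zero_apply,
      MultilinearMap.domDomCongr_apply] using this
  · obtain rfl : (fun i => deg (w i)) = d := funext hw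
    have h1 : ∀ σ : Equiv.Perm (Fin n), gammaSign K σ⁻¹ (fun i => deg (w i)) •
        unbar B deg fac β n (fun i => B (w (σ⁻¹ i))) =
        (fac n * sg K (decSum (toSeq fun i => deg (w i)) 0 n)) • B.repr.symm
          (β (suspSign K σ⁻¹ (fun i => deg (w i)) • wd (List.ofFn fun i => w (σ⁻¹ i)))) := by
      intro σ
      rw [unbar_word (deg := deg) fac β fun i => w (σ⁻¹ i)]
      simp only [map_smul, smul_smul]
      congr 1
      have := gammaSign_mul_sg (K := K) σ⁻¹ fun i => deg (w i)
      linear_combination fac n * this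
    simp only [sum_apply, smul_apply, zero_apply,
      MultilinearMap.domDomCongr_apply, h1]
    rw [← Finset.smul_sum, ← map_sum, ← map_sum, ← sh_take_drop hqn.le w deg fun _ => rfl,
      hβ _ _ (List.ne_nil_of_length_pos (by simp; omega))
        (List.ne_nil_of_length_pos (by simp; omega)), map_zero, smul_zero]

/-- The parameter `p` is the degree after suspension: `-1` for structures, whose operations have
degree `n - 2`, and `0` for morphisms and gauge cochains, of degree `n - 1`. -/
theorem bar_isCochain [CharZero K] [DirectSum.Decomposition 𝒢] (hB : ∀ i, B i ∈ 𝒢 (deg i))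
    {P : OperadKind} {p : ℤ} {f : (n : ℕ) → MultilinearMap K (fun _ : Fin n => H) H}
    (hf : ∀ n : ℕ, IsCochain P 𝒢 𝒢 ((n : ℤ) - 1 + p) (f n)) :
    HasDeg (fun i => deg i + 1) p (bar B deg (weight K P) f) ∧
      bar B deg (weight K P) f (wd []) = 0 ∧
      bar B deg (weight K P) f ∘ₗ symOf K P (fun i => deg i + 1) = bar B deg (weight K P) f ∧
      (P = .com → KillsShuffles (fun i => deg i + 1) (bar B deg (weight K P) f)) := by
  refine ⟨hasDeg_bar hB _ fun n => (hf n).degree, ?_, ?_, ?_⟩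
  · have := (hf 0).eq_zero rfl
    rw [bar, ofWords_wd]
    simp [this]
  · cases P with
    | ass => rfl
    | com => rfl
    | lie => exact bar_comp_symProj hB _ fun n => (hf n).antisymm rfl
  · rintro rfl
    refine killsShuffles_bar hB _ fun n q hq hqn d x hx => ?_
    convert (hf n).shuffle rfl q hq hqn d x hx using 3
    exact Iff.rfl

theorem isCochain_unbar [CharZero K] [DirectSum.Decomposition 𝒢] (hB : ∀ i, B i ∈ 𝒢 (deg i))
    {P : OperadKind} {p : ℤ} {β : Tens K I →ₗ[K] (I →₀ K)}
    (hβ : HasDeg (fun i => deg i + 1) p β) (hβ0 : β (wd []) = 0)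
    (hβe : β ∘ₗ symOf K P (fun i => deg i + 1) = β)
    (hs : P = .com → KillsShuffles (fun i => deg i + 1) β) (n : ℕ) :
    IsCochain P 𝒢 𝒢 ((n : ℤ) - 1 + p) (unbar B deg (weight K P) β n) where
  eq_zero h := by
    subst h
    exact unbar_eq_zero _ fun w hw => by rw [List.length_eq_zero_iff.1 hw, hβ0]
  degree d x hx := unbar_mem hB _ hβ hx
  shuffle hP q hq hqn d x hx := by
    convert unbar_shuffle hB (weight K P) (hs hP) hq hqn hx using 3
    exact Iff.rfl
  antisymm hP σ d x hx := by
    subst hP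
    exact unbar_antisymm hB _ hβe σ hx

end CochainsOnWords

/-! ### Structure and morphism equations as identities of corestrictions. -/

section Equations

variable {K H : Type*} [Field K] [AddCommGroup H] [Module K H]
  {I : Type*} {𝒢 : ℤ → Submodule K H} {B : Module.Basis I K H} {deg : I → ℤ}
  [DirectSum.Decomposition 𝒢]

theorem bar_hat_seg (hB : ∀ i, B i ∈ 𝒢 (deg i)) (fac : ℕ → K) {p : ℤ}
    {m : (n : ℕ) → MultilinearMap K (fun _ : Fin n => H) H}
    (f : (n : ℕ) → MultilinearMap K (fun _ : Fin n => H) H)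
    (hm : ∀ (s : ℕ) (d : Fin s → ℤ) (x : Fin s → H), (∀ i, x i ∈ 𝒢 (d i)) →
      m s x ∈ 𝒢 (∑ i, d i + (s - 1 + p)))
    {x : ℕ → H} {d : ℕ → ℤ} (hx : ∀ i, x i ∈ 𝒢 (d i)) (n : ℕ) :
    sg K (decSum d 0 n) • bar B deg fac f
      (hat (fun i => deg i + 1) p (bar B deg fac m) (seg B x 0 n (wd []))) =
    ∑ s ∈ Finset.range (n + 1), ∑ r ∈ Finset.range (n - s + 1),
      ((fac (n - s + 1))⁻¹ * (fac s)⁻¹) •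
        sg K ((s - 1 + p) * degSum d 0 r + (n - s - r : ℕ) * (s - 1 + p) + p * r) •
          B.repr (f (n - s + 1) fun i => insertArg r (m s) x i) := by
  rw [hat_seg hB p _ hx, map_sum, Finset.smul_sum]
  simp only [map_sum, Finset.smul_sum]
  rw [Finset.sum_comm' (t' := Finset.range (n + 1)) (s' := fun s => Finset.range (n - s + 1))
    (fun r s => by simp only [Finset.mem_range]; omega)]
  refine Finset.sum_congr rfl fun s hs => Finset.sum_congr rfl fun r hr => ?_
  have hs := Finset.mem_range.1 hs
  have hr := Finset.mem_range.1 hr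
  have h1 : decSum d 0 n = decSum d 0 (r + s + (n - s - r)) := by congr 1; omega
  have h2 : n - r - s = n - s - r := by omega
  rw [h1, h2, zero_add, map_smul]
  exact bar_insertArg hB fac f hm hx r s (n - s - r) (n - s + 1) (by omega)

/-- A map factoring through symmetrization cannot tell where a letter was inserted, so the `n + 1`
places contribute equally. -/
theorem apply_sh_letter [CharZero K] (δ : I → ℤ) {β : Tens K I →ₗ[K] (I →₀ K)}
    (hβ : β ∘ₗ symProj δ = β) (v : I →₀ K) {n : ℕ} {t : Tens K I} (ht : t ∈ lenSub K I n) :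
    β (sh δ (cons v (wd [])) t) = ((n + 1 : ℕ) : K) • β (cons v t) := by
  have hβ' : ∀ t, β (symProj δ t) = β t := LinearMap.congr_fun hβ
  refine lenSub_induction (f := β ∘ₗ sh δ (cons v (wd [])))
    (g := ((n + 1 : ℕ) : K) • β ∘ₗ cons v) (fun w hw => ?_) ht
  subst hw
  have : β ∘ₗ (sh δ).flip (wd w) ∘ₗ cons.flip (wd []) =
      ((w.length + 1 : ℕ) : K) • β ∘ₗ cons.flip (wd w) :=
    Finsupp.lhom_ext' fun i => LinearMap.ext_ring (by
      simp only [LinearMap.comp_apply, LinearMap.flip_apply, LinearMap.smul_apply,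
        Finsupp.lsingle_apply, cons_single_wd]
      rw [← hβ', symProj_eq_smul δ (sh_letter_mem_lenSub δ i (wd_mem_lenSub w)), symm_sh_letter,
        ← hβ' (wd (i :: w)), symProj_wd, smul_comm, map_smul]
      rfl)
  exact LinearMap.congr_fun this v

/-- By `hat_symm` the output letter is shuffled into the remaining `n - s` ones, which costs a
factor `n - s + 1`. With the weights `1 / s!` and `1 / (n - s + 1)!` this leaves the coefficient `1
/ (s! (n - s)!)` of the unshuffle sum. -/
theorem bar_hat_symm [CharZero K] (hB : ∀ i, B i ∈ 𝒢 (deg i)) {p : ℤ}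
    {m f : (n : ℕ) → MultilinearMap K (fun _ : Fin n => H) H}
    (hm : ∀ (s : ℕ) (d : Fin s → ℤ) (x : Fin s → H), (∀ i, x i ∈ 𝒢 (d i)) →
      m s x ∈ 𝒢 (∑ i, d i + (s - 1 + p)))
    (hf : bar B deg (weight K .lie) f ∘ₗ symProj (fun i => deg i + 1) =
      bar B deg (weight K .lie) f)
    {n : ℕ} {d : Fin n → ℤ} {x : Fin n → H} (hx : ∀ i, x i ∈ 𝒢 (d i)) :
    sg K (decSum (toSeq d) 0 n) • bar B deg (weight K .lie) f
      (hat (fun i => deg i + 1) p (bar B deg (weight K .lie) m)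
        (symm (fun i => deg i + 1) (tensMap B n x))) =
    ∑ s ∈ Finset.range (n + 1), ((s.factorial * (n - s).factorial : ℕ) : K)⁻¹ •
      ∑ σ : Equiv.Perm (Fin n), (gammaSign K σ d * sg K ((n - s : ℕ) * (s - 1 + p))) •
        B.repr (f (n - s + 1) fun i => insertArg 0 (m s) (toSeq fun j => x (σ j)) i) := by
  rw [hat_symm _ (hasDeg_bar hB _ hm), symm_tensMap hB hx]
  simp only [map_sum, map_smul, Finset.smul_sum, tensMap_eq_seg_toSeq, comul_seg, smul_smul]
  rw [Finset.sum_comm]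
  refine Finset.sum_congr rfl fun s hs => Finset.sum_congr rfl fun σ _ => ?_
  have hs := Finset.mem_range.1 hs
  have h1 := bar_insertArg hB (weight K .lie) f hm (toSeq_mem fun i => hx (σ i)) 0 s (n - s)
    (n - s + 1) (by omega)
  have h2 : s + (n - s) = n := by omega
  have h3 : (n - s + 1).factorial = (n - s + 1) * (n - s).factorial := Nat.factorial_succ _
  have h4 : ((n - s + 1 : ℕ) : K) ≠ 0 := Nat.cast_ne_zero.2 (Nat.succ_ne_zero _)
  simp only [degSum_zero, Nat.cast_zero, mul_zero, add_zero, zero_add, sg_zero, one_smul,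
    seg_zero, h2] at h1
  rw [TensorProduct.map_tmul, TensorProduct.lift.tmul, LinearMap.comp_apply, LinearMap.flip_apply,
    LinearMap.id_apply, apply_sh_letter _ hf _ (by
      simpa using seg_mem_lenSub (B := B) _ (0 + s) (n - s) (wd_mem_lenSub (K := K) ([] : List I))),
    ← gammaSign_mul_sg, mul_smul, smul_comm (sg K _), zero_add, h1]
  simp only [smul_smul, weight]
  congr 1
  rw [h3]
  push_cast at h4 ⊢
  have h5 : ((n - s).factorial : K) ≠ 0 := Nat.cast_ne_zero.2 (Nat.factorial_ne_zero _)
  have h6 : (s.factorial : K) ≠ 0 := Nat.cast_ne_zero.2 (Nat.factorial_ne_zero _)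
  field_simp

theorem weight_smul_symOf [CharZero K] (P : OperadKind) (δ : I → ℤ) {n : ℕ} {t : Tens K I}
    (ht : t ∈ lenSub K I n) : weight K P n • symOf K P δ t = match P with
      | .lie => symm δ t
      | _ => t := by
  cases P with
  | ass => exact one_smul _ _
  | com => exact one_smul _ _
  | lie =>
    change (n.factorial : K) • symProj δ t = symm δ t
    rw [symProj_eq_smul δ ht, smul_smul,
      mul_inv_cancel₀ (Nat.cast_ne_zero.2 n.factorial_ne_zero), one_smul]

theorem sum_range_succ_eq_sum_Icc {M : Type*} [AddCommMonoid M] {F : ℕ → M} (h : F 0 = 0) (n : ℕ) :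
    ∑ s ∈ Finset.range (n + 1), F s = ∑ s ∈ Finset.Icc 1 n, F s := by
  refine (Finset.sum_subset (fun s hs => ?_) fun s hs hs' => ?_).symm
  · simp only [Finset.mem_Icc, Finset.mem_range] at *
    omega
  · simp only [Finset.mem_Icc, Finset.mem_range] at *
    obtain rfl : s = 0 := by omega
    exact h

theorem apply_insertArg_zero (f : (n : ℕ) → MultilinearMap K (fun _ : Fin n => H) H)
    (g : MultilinearMap K (fun _ : Fin 0 => H) H) (hg : g = 0) {r a : ℕ} (hr : r < a) (y : ℕ → H) :
    f a (fun i => insertArg r g y i) = 0 := by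
  apply MultilinearMap.map_coord_zero (i := ⟨r, hr⟩)
  simp [insertArg, hg]

theorem repr_innerSum [CharZero K] (hB : ∀ i, B i ∈ 𝒢 (deg i)) {P : OperadKind}
    {m f : (n : ℕ) → MultilinearMap K (fun _ : Fin n => H) H}
    (hm : ∀ n : ℕ, IsCochain P 𝒢 𝒢 ((n : ℤ) - 1 + -1) (m n))
    (hf : bar B deg (weight K P) f ∘ₗ symOf K P (fun i => deg i + 1) = bar B deg (weight K P) f)
    {n : ℕ} {d : Fin n → ℤ} {x : Fin n → H} (hx : ∀ i, x i ∈ 𝒢 (d i)) :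
    B.repr (innerSum P m f d x) = (sg K (decSum (toSeq d) 0 n) * weight K P n) •
      bar B deg (weight K P) f (hat (fun i => deg i + 1) (-1) (bar B deg (weight K P) m)
        (symOf K P (fun i => deg i + 1) (tensMap B n x))) := by
  rw [mul_smul, ← map_smul _ (weight K P n), ← map_smul _ (weight K P n),
    weight_smul_symOf P _ (tensMap_mem_lenSub x)]
  have hass : ∀ m f : (n : ℕ) → MultilinearMap K (fun _ : Fin n => H) H,
      (∀ (s : ℕ) (d : Fin s → ℤ) (x : Fin s → H), (∀ i, x i ∈ 𝒢 (d i)) →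
        m s x ∈ 𝒢 (∑ i, d i + (s - 1 + -1))) → m 0 = 0 →
      B.repr (innerSumAss m f d x) = sg K (decSum (toSeq d) 0 n) • bar B deg (fun _ => 1) f
        (hat (fun i => deg i + 1) (-1) (bar B deg (fun _ => 1) m) (tensMap B n x)) := by
    intro m f hm hm0
    rw [tensMap_eq_seg_toSeq, bar_hat_seg hB _ f hm (toSeq_mem hx), innerSumAss,
      sum_range_succ_eq_sum_Icc]
    · simp only [map_sum, map_smul]
      refine Finset.sum_congr rfl fun s hs => Finset.sum_congr rfl fun r hr => ?_
      rw [inv_one, one_mul, one_smul]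
      congr 1
      simp only [degSum, zero_add]
      -- The exponents `r + st` and `t(s - 2) - r` differ by the even number `2(t + r)`, where `t =
      -- n - s - r`.
      refine Eq.trans (sg_add_two_mul _ (-((n - s - r : ℕ) : ℤ) - r)).symm ?_
      congr 1
      ring
    · exact Finset.sum_eq_zero fun r hr => by
        rw [apply_insertArg_zero f _ hm0 (Finset.mem_range.1 hr), map_zero, smul_zero, smul_zero]
  cases P with
  | ass => exact hass m f (fun n => (hm n).degree) ((hm 0).eq_zero rfl)
  | com => exact hass m f (fun n => (hm n).degree) ((hm 0).eq_zero rfl)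
  | lie =>
    refine Eq.trans ?_ (bar_hat_symm hB (fun n => (hm n).degree) hf hx).symm
    rw [sum_range_succ_eq_sum_Icc, innerSum, innerSumLie]
    · simp only [map_sum, map_smul]
      refine Finset.sum_congr rfl fun s hs => ?_
      congr 1
      refine Finset.sum_congr rfl fun σ _ => ?_
      congr 2
      refine Eq.trans (sg_add_two_mul _ (-((n - s : ℕ) : ℤ))).symm ?_
      congr 1
      ring
    · rw [Finset.sum_eq_zero fun σ _ => ?_, smul_zero]
      rw [apply_insertArg_zero f _ ((hm 0).eq_zero rfl) (Nat.succ_pos _), map_zero, smul_zero]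

/-- `lift` expands into compositions and each block tensor gives one `outerTerm`. For `Lie` the
weights supply the factor for unordered blocks, and symmetrization supplies the sum over
permutations. -/
theorem repr_outerSum [CharZero K] (hB : ∀ i, B i ∈ 𝒢 (deg i)) {P : OperadKind}
    (m : (n : ℕ) → MultilinearMap K (fun _ : Fin n => H) H)
    {f : (n : ℕ) → MultilinearMap K (fun _ : Fin n => H) H}
    (hf : ∀ n : ℕ, IsCochain P 𝒢 𝒢 ((n : ℤ) - 1) (f n))
    {n : ℕ} {d : Fin n → ℤ} {x : Fin n → H} (hx : ∀ i, x i ∈ 𝒢 (d i)) :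
    B.repr (outerSum P m f d x) = (sg K (decSum (toSeq d) 0 n) * weight K P n) •
      bar B deg (weight K P) m (lift (bar B deg (weight K P) f)
        (symOf K P (fun i => deg i + 1) (tensMap B n x))) := by
  have h0 : ∀ fac, bar B deg fac f (wd []) = 0 := fun fac => by
    rw [bar, ofWords_wd]
    simp [(hf 0).eq_zero rfl]
  have key : ∀ fac (d : Fin n → ℤ) (x : Fin n → H), (∀ i, x i ∈ 𝒢 (d i)) →
      sg K (decSum (toSeq d) 0 n) • bar B deg fac m (lift (bar B deg fac f) (tensMap B n x)) =
      ∑ c : Composition n, (fac c.length * ∏ j, fac (c.blocksFun j))⁻¹ •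
        B.repr (outerTerm m f c d x) := by
    intro fac d x hx
    rw [tensMap_eq_seg_toSeq, lift_seg (h0 fac), map_sum, Finset.smul_sum]
    exact Finset.sum_congr rfl fun c _ => bar_blockT hB fac m (fun n => (hf n).degree) c hx
  rw [mul_smul, ← map_smul _ (weight K P n), ← map_smul _ (weight K P n),
    weight_smul_symOf P _ (tensMap_mem_lenSub x)]
  cases P with
  | ass =>
    refine Eq.trans ?_ (key (fun _ => 1) d x hx).symm
    simp [outerSum]
  | com =>
    refine Eq.trans ?_ (key (fun _ => 1) d x hx).symm
    simp [outerSum]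
  | lie =>
    change _ = _ • bar B deg _ m (lift _ (symm _ _))
    rw [symm_tensMap hB hx]
    simp only [map_sum, map_smul, Finset.smul_sum, smul_smul, ← gammaSign_mul_sg]
    simp only [mul_smul]
    rw [Finset.sum_congr rfl fun σ _ => congrArg (gammaSign K σ d • ·)
      (key (weight K .lie) _ _ fun i => hx (σ i))]
    simp only [Finset.smul_sum]
    rw [Finset.sum_comm, outerSum, map_sum]
    refine Finset.sum_congr rfl fun c _ => ?_
    rw [map_smul, map_sum, Finset.smul_sum]
    refine Finset.sum_congr rfl fun σ _ => ?_
    rw [map_smul, smul_comm (gammaSign K σ d)]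
    simp [weight]

end Equations

/-! ### The operadic differential as a commutator on words. -/

section DifferentialOnWords

variable {K H : Type*} [Field K] [AddCommGroup H] [Module K H]
  {I : Type*} {𝒢 : ℤ → Submodule K H} {B : Module.Basis I K H} {deg : I → ℤ}
  [DirectSum.Decomposition 𝒢]

/-- With an inner operation of arity `n + 1` on `n + 2` arguments the outer one must be binary, so
there are just two positions. They are the outer terms of the Hochschild formula. -/
theorem bar_hat_tensMap (hB : ∀ i, B i ∈ 𝒢 (deg i)) (fac : ℕ → K)
    (m : (n : ℕ) → MultilinearMap K (fun _ : Fin n => H) H)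
    {f : (n : ℕ) → MultilinearMap K (fun _ : Fin n => H) H} {n : ℕ}
    (hf : ∀ (s : ℕ) (d : Fin s → ℤ) (x : Fin s → H), (∀ i, x i ∈ 𝒢 (d i)) →
      f s x ∈ 𝒢 (∑ i, d i + (s - 1 + 0)))
    (hf0 : ∀ j, j ≠ n + 1 → f j = 0)
    {d : Fin (n + 2) → ℤ} {x : Fin (n + 2) → H} (hx : ∀ i, x i ∈ 𝒢 (d i)) :
    sg K (decSum (toSeq d) 0 (n + 2)) • bar B deg fac m
      (hat (fun i => deg i + 1) 0 (bar B deg fac f) (tensMap B (n + 2) x)) =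
    ((fac 2)⁻¹ * (fac (n + 1))⁻¹) •
      (sg K n • B.repr (partialComp (m 2) (f (n + 1)) 0 (n + 2) (by omega) (by omega) x) +
      sg K (n * d 0) •
        B.repr (partialComp (m 2) (f (n + 1)) 1 (n + 2) (by omega) (by omega) x)) := by
  rw [tensMap_eq_seg_toSeq, bar_hat_seg hB fac m hf (toSeq_mem hx), Finset.sum_eq_single (n + 1)]
  · have h : n + 2 - (n + 1) = 1 := by omega
    rw [h, Finset.sum_range_succ, Finset.sum_range_one, ← smul_add]
    congr 2
    · congr 2
      simp [degSum_zero]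
    · congr 2
      simp [degSum, toSeq]
  · intro s _ hs
    refine Finset.sum_eq_zero fun r hr => ?_
    have : m (n + 2 - s + 1) (fun i => insertArg r (f s) (toSeq x) i) = 0 := by
      apply MultilinearMap.map_coord_zero (i := ⟨r, Finset.mem_range.1 hr⟩)
      simp [insertArg, hf0 s hs]
    rw [this, map_zero, smul_zero, smul_zero]
  · intro h
    simp at h

/-- The unshuffle formula puts the inner operation into the first slot of the product, whereas the
Chevalley-Eilenberg formula has it in the second. Computing the same quantity in two ways compares
them without using antisymmetry of the product directly. -/
theorem bar_hat_symm_tensMap [CharZero K] (hB : ∀ i, B i ∈ 𝒢 (deg i))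
    {m f : (n : ℕ) → MultilinearMap K (fun _ : Fin n => H) H} {n : ℕ}
    (hf : ∀ (s : ℕ) (d : Fin s → ℤ) (x : Fin s → H), (∀ i, x i ∈ 𝒢 (d i)) →
      f s x ∈ 𝒢 (∑ i, d i + (s - 1 + 0)))
    (hm : bar B deg (weight K .lie) m ∘ₗ symProj (fun i => deg i + 1) =
      bar B deg (weight K .lie) m)
    (hf0 : ∀ j, j ≠ n + 1 → f j = 0)
    {d : Fin (n + 2) → ℤ} {x : Fin (n + 2) → H} (hx : ∀ i, x i ∈ 𝒢 (d i)) :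
    sg K (decSum (toSeq d) 0 (n + 2)) • bar B deg (weight K .lie) m
      (hat (fun i => deg i + 1) 0 (bar B deg (weight K .lie) f)
        (symm (fun i => deg i + 1) (tensMap B (n + 2) x))) =
    (((n + 1).factorial : ℕ) : K)⁻¹ • ∑ σ : Equiv.Perm (Fin (n + 2)),
      (gammaSign K σ d * sg K (n * d (σ 0))) • B.repr (partialComp (m 2) (f (n + 1)) 1 (n + 2)
        (by omega) (by omega) fun i => x (σ i)) := by
  set T := sg K (decSum (toSeq d) 0 (n + 2)) • bar B deg (weight K .lie) m
      (hat (fun i => deg i + 1) 0 (bar B deg (weight K .lie) f)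
        (symm (fun i => deg i + 1) (tensMap B (n + 2) x))) with hT
  have h0 : T = (((n + 1).factorial : ℕ) : K)⁻¹ • ∑ σ : Equiv.Perm (Fin (n + 2)),
      (gammaSign K σ d * sg K n) • B.repr (partialComp (m 2) (f (n + 1)) 0 (n + 2)
        (by omega) (by omega) fun i => x (σ i)) := by
    rw [hT, bar_hat_symm hB hf hm hx, Finset.sum_eq_single (n + 1)]
    · have h : n + 2 - (n + 1) = 1 := by omega
      rw [h]
      simp only [Nat.factorial_one, mul_one]
      congr 1
      refine Finset.sum_congr rfl fun σ _ => ?_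
      congr 2
      simp
    · intro s _ hs
      rw [Finset.sum_eq_zero, smul_zero]
      intro σ _
      have : m (n + 2 - s + 1)
          (fun i => insertArg 0 (f s) (toSeq fun j => x (σ j)) i) = 0 := by
        apply MultilinearMap.map_coord_zero (i := ⟨0, Nat.succ_pos _⟩)
        simp [insertArg, hf0 s hs]
      rw [this, map_zero, smul_zero]
    · intro h
      simp at h
  have h1 : T = ((2 : K)⁻¹ * (((n + 1).factorial : ℕ) : K)⁻¹) •
      ∑ σ : Equiv.Perm (Fin (n + 2)), gammaSign K σ d •
        (sg K n • B.repr (partialComp (m 2) (f (n + 1)) 0 (n + 2) (by omega) (by omega)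
          fun i => x (σ i)) +
        sg K (n * d (σ 0)) • B.repr (partialComp (m 2) (f (n + 1)) 1 (n + 2) (by omega) (by omega)
          fun i => x (σ i))) := by
    rw [hT, symm_tensMap hB hx]
    simp only [map_sum, map_smul, Finset.smul_sum, smul_smul, ← gammaSign_mul_sg]
    refine Finset.sum_congr rfl fun σ _ => ?_
    rw [mul_smul, bar_hat_tensMap hB _ m hf hf0 fun i => hx (σ i), smul_smul]
    congr 1
    simp [weight]
    ring
  simp only [smul_add, Finset.sum_add_distrib, smul_smul] at h1
  rw [mul_smul, mul_smul, ← h0] at h1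
  clear_value T
  -- Here `h1` says that `T` is the average of the first-slot sum, which is `T` by `h0`, and the
  -- second-slot sum. The two sums are therefore equal.
  have h2 := congrArg ((2 : K) • ·) h1
  simp only [smul_add, smul_inv_smul₀ (two_ne_zero (α := K))] at h2
  rw [two_smul] at h2
  exact add_left_cancel h2

/-- The terms in which the product is applied to a value of the cochain come from `β ∘ hat ψ`. Those
with a product inserted into the cochain form the inner sum of the morphism equation for the binary
structure, so `repr_innerSum` handles them. -/
theorem repr_differential [CharZero K] (hB : ∀ i, B i ∈ 𝒢 (deg i)) {P : OperadKind}
    (A : GradedAlgebra P 𝒢) {m f : (n : ℕ) → MultilinearMap K (fun _ : Fin n => H) H} {n : ℕ}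
    (hm : bar B deg (weight K P) m ∘ₗ symOf K P (fun i => deg i + 1) = bar B deg (weight K P) m)
    (hm2 : m 2 = A.mul) (hf : ∀ j : ℕ, IsCochain P 𝒢 𝒢 ((j : ℤ) - 1 + 0) (f j))
    (hf0 : ∀ j, j ≠ n + 1 → f j = 0)
    {d : Fin (n + 2) → ℤ} {x : Fin (n + 2) → H} (hx : ∀ i, x i ∈ 𝒢 (d i)) :
    B.repr (A.differential n (f (n + 1)) x) =
      (sg K (decSum (toSeq d) 0 (n + 2)) * weight K P (n + 2)) •
        (bar B deg (weight K P) m (hat (fun i => deg i + 1) 0 (bar B deg (weight K P) f)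
          (symOf K P (fun i => deg i + 1) (tensMap B (n + 2) x))) -
        bar B deg (weight K P) f (hat (fun i => deg i + 1) (-1)
          (bar B deg (weight K P) (binaryOps A.mul))
          (symOf K P (fun i => deg i + 1) (tensMap B (n + 2) x)))) := by
  rw [smul_sub, ← repr_innerSum hB (fun j => by
    have := isCochain_binaryOps A j
    rwa [show (j : ℤ) - 1 + -1 = j - 2 by ring]) (bar_isCochain hB hf).2.2.1 hx, mul_smul,
    ← map_smul _ (weight K P (n + 2)), ← map_smul _ (weight K P (n + 2)),
    weight_smul_symOf P _ (tensMap_mem_lenSub x)]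
  have hass : (∀ j : ℕ, IsCochain P 𝒢 𝒢 ((j : ℤ) - 1 + 0) (f j)) →
      B.repr (glue 𝒢 (differentialAss A.mul n (f (n + 1))) x) =
      sg K (decSum (toSeq d) 0 (n + 2)) • bar B deg (fun _ => 1) m
        (hat (fun i => deg i + 1) 0 (bar B deg (fun _ => 1) f) (tensMap B (n + 2) x)) -
      B.repr (innerSumAss (binaryOps A.mul) f d x) := by
    intro hf
    have h1 : innerSumAss (binaryOps A.mul) f d x = - ∑ i : Fin (n + 1), sg K ((i : ℤ) + 1) •
        partialComp (f (n + 1)) A.mul i (n + 2) (by omega) i.isLt x := by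
      rw [innerSumAss, Finset.sum_eq_single 2]
      · rw [← Finset.sum_neg_distrib]
        refine (Fin.sum_univ_eq_sum_range (fun r => sg K ((r : ℤ) + (2 : ℕ) *
          ((n + 2 - 2 - r : ℕ) : ℤ) + (((2 : ℕ) : ℤ) - 2) * ∑ i ∈ Finset.range r, toSeq d i) •
          f (n + 1) (fun i => insertArg r A.mul (toSeq x) i)) (n + 1)).symm.trans
          (Finset.sum_congr rfl fun r _ => ?_)
        rw [← neg_smul]
        congr 1
        have h : sg K ((r : ℤ) + 1) = - sg K r := by
          rw [sg_add]
          simp [sg]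
        rw [h, neg_neg]
        refine Eq.trans ?_ (sg_add_two_mul _ ((n + 2 - 2 - r : ℕ) : ℤ))
        simp
      · intro s hs hs2
        refine Finset.sum_eq_zero fun r hr => ?_
        have : f (n + 2 - s + 1) (fun i => insertArg r (binaryOps A.mul s) (toSeq x) i) = 0 := by
          apply MultilinearMap.map_coord_zero (i := ⟨r, Finset.mem_range.1 hr⟩)
          simp [insertArg, binaryOps_of_ne A.mul hs2]
        rw [this, smul_zero]
      · intro h
        simp at h
    rw [bar_hat_tensMap hB _ m (fun j => (hf j).degree) hf0 hx, h1, hm2, glue_apply 𝒢 _ d x hx,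
      differentialAss]
    simp only [add_apply, smul_apply, sum_apply, map_add, map_neg, map_smul, sub_neg_eq_add,
      inv_one, one_mul, one_smul]
    rw [show (n : ℤ) + 2 = n + 2 * 1 by ring, sg_add_two_mul]
    abel
  cases P with
  | ass => exact hass hf
  | com => exact hass hf
  | lie =>
    change B.repr (glue 𝒢 (differentialLie A.mul n (f (n + 1))) x) =
      _ • bar B deg _ m (hat _ _ _ (symm _ _)) - B.repr (innerSumLie (binaryOps A.mul) f d x)
    rw [bar_hat_symm_tensMap hB (fun j => (hf j).degree) hm hf0 hx, hm2, glue_apply 𝒢 _ d x hx,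
      differentialLie, sub_apply, map_sub]
    congr 1
    · simp only [smul_apply, sum_apply, map_sum, map_smul]
      rfl
    · congr 1
      symm
      rw [innerSumLie, Finset.sum_eq_single 2]
      · have h : sg K (((2 : ℕ) : ℤ) * ((n + 2 - 2 : ℕ) : ℤ)) = 1 := by
          rw [← sg_zero, ← sg_add_two_mul 0 ((n + 2 - 2 : ℕ) : ℤ)]
          simp
        simp only [h, mul_one, smul_apply, sum_apply]
        rfl
      · intro s hs hs2
        rw [Finset.sum_eq_zero, smul_zero]
        intro σ _
        have : f (n + 2 - s + 1)
            (fun i => insertArg 0 (binaryOps A.mul s) (toSeq fun j => x (σ j)) i) = 0 := by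
          apply MultilinearMap.map_coord_zero (i := ⟨0, Nat.succ_pos _⟩)
          simp [insertArg, binaryOps_of_ne A.mul hs2]
        rw [this, smul_zero]
      · intro h
        simp at h

end DifferentialOnWords

/-! ### Equivalences between statements about operations and about words. -/

section Translation

variable {K H : Type*} [Field K] [AddCommGroup H] [Module K H]
  {I : Type*} {𝒢 : ℤ → Submodule K H} {B : Module.Basis I K H} {deg : I → ℤ}

theorem exists_eq_ofFn {n : ℕ} {w : List I} (hw : w.length = n) :
    ∃ w' : Fin n → I, w = List.ofFn w' := by
  subst hw
  exact ⟨w.get, by simp⟩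

theorem letter_comp_of_isSym {δ : I → ℤ} {e : Tens K I →ₗ[K] Tens K I} (he : IsSym δ e) :
    letter ∘ₗ e = letter := tens_ext fun w => by
  by_cases h : w.length = 1
  · obtain ⟨i, rfl⟩ := List.length_eq_one_iff.1 h
    rw [LinearMap.comp_apply, he.single]
  · rw [LinearMap.comp_apply, suppLen_letter.eq_zero h (he.len w), suppLen_letter w h]

theorem killsShuffles_letter (δ : I → ℤ) :
    KillsShuffles δ (letter : Tens K I →ₗ[K] (I →₀ K)) := fun u v hu hv => by
  obtain ⟨i, u, rfl⟩ := List.exists_cons_of_ne_nil hu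
  obtain ⟨j, v, rfl⟩ := List.exists_cons_of_ne_nil hv
  rw [letter_sh]
  simp [counit]

theorem sg_ne_zero (a : ℤ) : sg K a ≠ 0 := left_ne_zero_of_mul_eq_one (sg_mul_self a)

theorem tens_ext_tensMap {N : Type*} [AddCommGroup N] [Module K N] {f g : Tens K I →ₗ[K] N}
    (h : ∀ (n : ℕ) (w : Fin n → I),
      f (tensMap B n fun i => B (w i)) = g (tensMap B n fun i => B (w i))) : f = g :=
  tens_ext fun w => by
    have := h _ w.get
    rwa [tensMap_basis, List.ofFn_get] at this

theorem suppLen_bar (fac : ℕ → K) {f : (n : ℕ) → MultilinearMap K (fun _ : Fin n => H) H} {n : ℕ}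
    (hf : ∀ j, j ≠ n → f j = 0) : SuppLen n (bar B deg fac f) := fun w hw => by
  rw [bar, ofWords_wd, hf _ hw]
  simp

theorem atLen_two_bar (fac : ℕ → K) {m : (n : ℕ) → MultilinearMap K (fun _ : Fin n => H) H}
    {μ : MultilinearMap K (fun _ : Fin 2 => H) H} (hm : m 2 = μ) :
    atLen 2 (bar B deg fac m) = bar B deg fac (binaryOps μ) := tens_ext fun w => by
  by_cases hw : w.length = 2
  · rw [atLen_eq _ (hw ▸ wd_mem_lenSub w)]
    obtain ⟨i, j, rfl⟩ := List.length_eq_two.1 hw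
    have := bar_word (B := B) (deg := deg) fac m ![i, j]
    have h2 := bar_word (B := B) (deg := deg) fac (binaryOps μ) ![i, j]
    rw [hm] at this
    exact this.trans h2.symm
  · rw [suppLen_atLen 2 _ w hw, suppLen_bar (B := B) (deg := deg) fac
      (fun j hj => binaryOps_of_ne μ hj) w hw]

theorem PInfAlgebra.isCochain' {P : OperadKind} (M : PInfAlgebra P 𝒢) (n : ℕ) :
    IsCochain P 𝒢 𝒢 ((n : ℤ) - 1 + -1) (M.op n) := by
  have := M.isCochain n
  rwa [show (n : ℤ) - 1 + -1 = n - 2 by ring]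

theorem PInfAlgebra.HasForm.bar_wd {P : OperadKind} {M : PInfAlgebra P 𝒢} {A : GradedAlgebra P 𝒢}
    {k : ℕ} (hM : M.HasForm A k) (fac : ℕ → K) (w : List I) (hw : w.length < k)
    (hw2 : w.length ≠ 2) : bar B deg fac M.op (wd w) = 0 := by
  have : M.op w.length = 0 := by
    rcases Nat.lt_or_ge w.length 3 with h | h
    · have h' : w.length = 0 ∨ w.length = 1 := by omega
      rcases h' with h' | h'
      · exact (M.isCochain _).eq_zero h'
      · rw [h']; exact hM.op_one
    · exact hM.op_eq_zero _ h hw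
  rw [bar, ofWords_wd, this]
  simp

/-- With zero differentials the homology is the space itself, so a quasi-isomorphism has bijective
linear part. -/
theorem PInfMorphism.IsQuasiIso.exists_linearEquiv {P : OperadKind} {M N : PInfAlgebra P 𝒢}
    {φ : PInfMorphism M N} (hφ : φ.IsQuasiIso) (hM : M.op 1 = 0) (hN : N.op 1 = 0) :
    ∃ L : H ≃ₗ[K] H, ∀ x, L x = φ.comp 1 fun _ => x := by
  let l : H →ₗ[K] H := (MultilinearMap.ofSubsingleton K H H (0 : Fin 1)).symm (φ.comp 1)
  have hl : ∀ x, l x = φ.comp 1 fun _ => x := fun x => rfl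
  refine ⟨LinearEquiv.ofBijective l ⟨(injective_iff_map_eq_zero l).2 fun x hx => ?_, fun y => ?_⟩,
    hl⟩
  · obtain ⟨y, hy⟩ := hφ.injective x (by simp [hM]) ⟨0, by rw [← hl, hx, hN]; rfl⟩
    rw [← hy, hM]
    rfl
  · obtain ⟨x, -, y', hy⟩ := hφ.surjective y (by simp [hN])
    exact ⟨x, by rw [hl, ← hy, hN]; simp⟩

theorem PInfMorphism.isQuasiIso_of_comp_one {P : OperadKind} {M N : PInfAlgebra P 𝒢}
    {φ : PInfMorphism M N} (hM : M.op 1 = 0) (hN : N.op 1 = 0)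
    (hφ : ∀ x, (φ.comp 1 fun _ => x) = x) : φ.IsQuasiIso where
  injective x _ h := by
    obtain ⟨y', hy⟩ := h
    rw [hN, hφ] at hy
    exact ⟨0, by rw [hM, ← hy]; rfl⟩
  surjective x _ := ⟨x, by simp [hM], 0, by simp [hφ, hN]⟩

variable [DirectSum.Decomposition 𝒢] [CharZero K]

theorem innerSum_eq_zero_iff (hB : ∀ i, B i ∈ 𝒢 (deg i)) {P : OperadKind}
    {m f : (n : ℕ) → MultilinearMap K (fun _ : Fin n => H) H}
    (hm : ∀ n : ℕ, IsCochain P 𝒢 𝒢 ((n : ℤ) - 1 + -1) (m n))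
    (hf : bar B deg (weight K P) f ∘ₗ symOf K P (fun i => deg i + 1) = bar B deg (weight K P) f) :
    (∀ (n : ℕ) (d : Fin n → ℤ) (x : Fin n → H), (∀ i, x i ∈ 𝒢 (d i)) →
      innerSum P m f d x = 0) ↔
    ∀ t, bar B deg (weight K P) f (hat (fun i => deg i + 1) (-1) (bar B deg (weight K P) m)
      (symOf K P (fun i => deg i + 1) t)) = 0 := by
  constructor
  · intro h
    suffices bar B deg (weight K P) f ∘ₗ hat (fun i => deg i + 1) (-1)
      (bar B deg (weight K P) m) ∘ₗ symOf K P (fun i => deg i + 1) = 0 from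
      fun t => LinearMap.congr_fun this t
    refine tens_ext_tensMap (B := B) fun n w => ?_
    have h1 := repr_innerSum hB hm hf (d := fun i => deg (w i)) (x := fun i => B (w i)) fun i => hB (w i)
    rw [h n _ _ fun i => hB (w i), map_zero, eq_comm, smul_eq_zero] at h1
    exact h1.resolve_left (mul_ne_zero (sg_ne_zero _) (weight_ne_zero P n))
  · intro h n d x hx
    refine B.repr.injective ?_
    rw [repr_innerSum hB hm hf hx, h, smul_zero, map_zero]

theorem innerSum_eq_outerSum_iff (hB : ∀ i, B i ∈ 𝒢 (deg i)) {P : OperadKind}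
    {m m' f : (n : ℕ) → MultilinearMap K (fun _ : Fin n => H) H}
    (hm : ∀ n : ℕ, IsCochain P 𝒢 𝒢 ((n : ℤ) - 1 + -1) (m n))
    (hf : ∀ n : ℕ, IsCochain P 𝒢 𝒢 ((n : ℤ) - 1) (f n)) :
    (∀ (n : ℕ) (d : Fin n → ℤ) (x : Fin n → H), (∀ i, x i ∈ 𝒢 (d i)) →
      innerSum P m f d x = outerSum P m' f d x) ↔
    ∀ t, bar B deg (weight K P) f (hat (fun i => deg i + 1) (-1) (bar B deg (weight K P) m)
      (symOf K P (fun i => deg i + 1) t)) =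
      bar B deg (weight K P) m' (lift (bar B deg (weight K P) f)
        (symOf K P (fun i => deg i + 1) t)) := by
  have hf' := (bar_isCochain hB (p := 0) (f := f) fun n => by rw [add_zero]; exact hf n).2.2.1
  constructor
  · intro h
    suffices bar B deg (weight K P) f ∘ₗ hat (fun i => deg i + 1) (-1)
      (bar B deg (weight K P) m) ∘ₗ symOf K P (fun i => deg i + 1) =
      bar B deg (weight K P) m' ∘ₗ lift (bar B deg (weight K P) f) ∘ₗ
        symOf K P (fun i => deg i + 1) from
      fun t => LinearMap.congr_fun this t
    refine tens_ext_tensMap (B := B) fun n w => ?_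
    have h1 := repr_innerSum hB hm hf' (d := fun i => deg (w i)) (x := fun i => B (w i))
      fun i => hB (w i)
    rw [h n _ _ fun i => hB (w i), repr_outerSum hB m' hf fun i => hB (w i)] at h1
    exact (smul_right_injective _ (mul_ne_zero (sg_ne_zero _) (weight_ne_zero P n)) h1).symm
  · intro h n d x hx
    refine B.repr.injective ?_
    rw [repr_innerSum hB hm hf' hx, h, repr_outerSum hB m' hf hx]

/-- On every basis word both sides of the cochain equation carry the same nonzero factor, a sign
times a weight, which can be cancelled. -/
theorem eq_differential_iff (hB : ∀ i, B i ∈ 𝒢 (deg i)) {P : OperadKind}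
    (A : GradedAlgebra P 𝒢) {m f : (n : ℕ) → MultilinearMap K (fun _ : Fin n => H) H} {n : ℕ}
    (hm : bar B deg (weight K P) m ∘ₗ symOf K P (fun i => deg i + 1) = bar B deg (weight K P) m)
    (hm2 : m 2 = A.mul) (hf : ∀ j : ℕ, IsCochain P 𝒢 𝒢 ((j : ℤ) - 1 + 0) (f j))
    (hf0 : ∀ j, j ≠ n + 1 → f j = 0) :
    m (n + 2) = A.differential n (f (n + 1)) ↔ ∀ t ∈ lenSub K I (n + 2),
      bar B deg (weight K P) m (symOf K P (fun i => deg i + 1) t) =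
        bar B deg (weight K P) m (hat (fun i => deg i + 1) 0 (bar B deg (weight K P) f)
          (symOf K P (fun i => deg i + 1) t)) -
        bar B deg (weight K P) f (hat (fun i => deg i + 1) (-1)
          (atLen 2 (bar B deg (weight K P) m)) (symOf K P (fun i => deg i + 1) t)) := by
  have h1 : ∀ w : Fin (n + 2) → I, B.repr (m (n + 2) fun i => B (w i)) =
      (sg K (decSum (toSeq fun i => deg (w i)) 0 (n + 2)) * weight K P (n + 2)) •
        bar B deg (weight K P) m (symOf K P (fun i => deg i + 1) (wd (List.ofFn w))) := by
    intro w
    rw [show bar B deg (weight K P) m (symOf K P (fun i => deg i + 1) (wd (List.ofFn w))) =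
      bar B deg (weight K P) m (wd (List.ofFn w)) from LinearMap.congr_fun hm _, bar_word]
    simp only [smul_smul]
    have h2 := sg_mul_self (K := K) (decSum (toSeq fun i => deg (w i)) 0 (n + 2))
    have h3 := weight_ne_zero (K := K) P (n + 2)
    refine (one_smul K _).symm.trans ?_
    congr 1
    rw [← h2]
    field_simp
  rw [atLen_two_bar _ hm2]
  constructor
  · intro h t ht
    refine lenSub_induction (f := bar B deg (weight K P) m ∘ₗ symOf K P (fun i => deg i + 1))
      (g := bar B deg (weight K P) m ∘ₗ hat (fun i => deg i + 1) 0 (bar B deg (weight K P) f) ∘ₗ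
          symOf K P (fun i => deg i + 1) -
        bar B deg (weight K P) f ∘ₗ hat (fun i => deg i + 1) (-1)
          (bar B deg (weight K P) (binaryOps A.mul)) ∘ₗ symOf K P (fun i => deg i + 1))
      (fun w hw => ?_) ht
    obtain ⟨w, rfl⟩ := exists_eq_ofFn hw
    have h2 := repr_differential hB A hm hm2 hf hf0 fun i => hB (w i)
    rw [← h, h1, tensMap_basis] at h2
    exact smul_right_injective _ (mul_ne_zero (sg_ne_zero _) (weight_ne_zero P _)) h2
  · intro h
    refine Module.Basis.ext_multilinear (fun _ => B) fun w => B.repr.injective ?_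
    rw [repr_differential hB A hm hm2 hf hf0 fun i => hB (w i), h1, tensMap_basis,
      h _ (by simpa using wd_mem_lenSub (K := K) (List.ofFn w))]

end Translation

/-! ### The two implications for algebras. -/

section Obstruction

variable {K H : Type*} [Field K] [CharZero K] [AddCommGroup H] [Module K H]
  {𝒢 : ℤ → Submodule K H} [DirectSum.Decomposition 𝒢] {P : OperadKind}

theorem isCoboundary_of_quasiIsomorphic (A : GradedAlgebra P 𝒢) {k : ℕ} (hk : 3 ≤ k)
    (M : PInfAlgebra P 𝒢) (hM : M.HasForm A k) (h : QuasiIsomorphic M A.toPInf) :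
    A.IsCoboundary ((k : ℤ) - 2) k (M.op k) := by
  obtain ⟨φ, hφ⟩ := h
  obtain ⟨B, hB⟩ := exists_homogeneous_basis 𝒢
  obtain ⟨n, rfl⟩ : ∃ n, k = n + 2 := ⟨k - 2, by omega⟩
  have hβ := bar_isCochain hB M.isCochain'
  have hβ' := bar_isCochain hB A.toPInf.isCochain'
  have hb := bar_isCochain hB (p := 0) (f := φ.comp) fun j => by
    rw [add_zero]; exact φ.isCochain j
  have hN : A.toPInf.op 1 = 0 := binaryOps_of_ne A.mul (by norm_num)
  obtain ⟨L, hL⟩ := hφ.exists_linearEquiv hM.op_one hN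
  obtain ⟨ψ, hψ, hψk, hψe, hψs, hψβ⟩ := exists_cobounding_of_lift (isSym_symOf P _) hk hβ.1 hβ'.1
    hb.1 hb.2.1 (B.repr.symm ≪≫ₗ L ≪≫ₗ B.repr)
    (fun i => by
      have := bar_word (B := B) (deg := Sigma.fst) (weight K P) φ.comp fun _ : Fin 1 => i
      have hw : weight K P 1 = 1 := by cases P <;> simp [weight]
      rw [List.ofFn_succ, List.ofFn_zero, hw] at this
      rw [this]
      simp [decSum, sg_zero, hL])
    (hM.bar_wd _) (suppLen_bar _ fun j hj => binaryOps_of_ne A.mul hj)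
    ((innerSum_eq_outerSum_iff hB M.isCochain' φ.isCochain).1 φ.relation)
  have hψ0 : ψ (wd []) = 0 := hψk [] (by simp)
  have hf := isCochain_unbar hB hψ hψ0 hψe fun hP => by
    subst hP
    exact hψs rfl (hb.2.2.2 rfl)
  have hbar := bar_unbar (B := B) (deg := Sigma.fst) (weight_ne_zero (K := K) P) ψ
  have hp : ((n + 2 : ℕ) : ℤ) - 2 = n := by push_cast; ring
  rw [hp]
  -- With `k = n + 2` the cobounding cochain has arity `k - 1 = n + 1` and degree `k - 2 = n`.
  refine ⟨unbar B Sigma.fst (weight K P) ψ (n + 1), ?_, ?_⟩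
  · have := hf (n + 1)
    rwa [show ((n + 1 : ℕ) : ℤ) - 1 + 0 = n by push_cast; ring] at this
  · refine (eq_differential_iff hB A (f := unbar B Sigma.fst (weight K P) ψ) hβ.2.2.1 hM.op_two hf
      fun j hj => unbar_eq_zero _ fun w hw => hψk w (by omega)).2 ?_
    rw [hbar]
    exact hψβ

theorem exists_quasiIsomorphic_of_isCoboundary (A : GradedAlgebra P 𝒢) {k : ℕ} (hk : 3 ≤ k)
    (M : PInfAlgebra P 𝒢) (hM : M.HasForm A k)
    (h : A.IsCoboundary ((k : ℤ) - 2) k (M.op k)) :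
    ∃ M' : PInfAlgebra P 𝒢, M'.HasForm A (k + 1) ∧ QuasiIsomorphic M M' := by
  obtain ⟨n, rfl⟩ : ∃ n, k = n + 2 := ⟨k - 2, by omega⟩
  have hp : ((n + 2 : ℕ) : ℤ) - 2 = n := by push_cast; ring
  rw [hp] at h
  obtain ⟨φ, hφ, hd⟩ := h
  obtain ⟨B, hB⟩ := exists_homogeneous_basis 𝒢
  -- The given cochain, extended by zero to a family, so that it has a corestriction concentrated in
  -- arity `k - 1`.
  let f : (j : ℕ) → MultilinearMap K (fun _ : Fin j => H) H := Function.update 0 (n + 1) φ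
  have hf1 : f (n + 1) = φ := Function.update_self ..
  have hf0 : ∀ j, j ≠ n + 1 → f j = 0 := fun j hj => Function.update_of_ne hj ..
  have hf : ∀ j : ℕ, IsCochain P 𝒢 𝒢 ((j : ℤ) - 1 + 0) (f j) := by
    intro j
    by_cases hj : j = n + 1
    · subst hj
      rw [hf1]
      rwa [show ((n + 1 : ℕ) : ℤ) - 1 + 0 = n by push_cast; ring]
    · rw [hf0 j hj]
      refine ⟨fun _ => rfl, fun _ _ _ => Submodule.zero_mem _, fun _ _ _ _ _ _ _ => ?_,
        fun _ _ _ _ _ => ?_⟩ <;> simp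
  have hfac := weight_ne_zero (K := K) P
  have hβ := bar_isCochain hB M.isCochain'
  have hψ := bar_isCochain hB hf
  have hsym := isSym_symOf (K := K) P fun i : (Σ j, Module.Basis.ofVectorSpaceIndex K (𝒢 j)) =>
    i.1 + 1
  rw [← hf1] at hd
  obtain ⟨β', hβ'd, hβ'e, hβ'β', hβ'lt, hβ'k, hmor, hβ's⟩ := exists_truncation hsym hk hβ.1
    hβ.2.2.1 ((innerSum_eq_zero_iff hB M.isCochain' hβ.2.2.1).1 M.relation) (hM.bar_wd _) hψ.1
    (suppLen_bar _ hf0) ((eq_differential_iff hB A hβ.2.2.1 hM.op_two hf hf0).1 hd)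
  set ψ := bar B Sigma.fst (weight K P) f with hψ_def
  have hm' := isCochain_unbar hB hβ'd (by rw [hβ'lt _ (by simp), hβ.2.1]) hβ'e fun hP => by
    subst hP
    exact hβ's rfl (hβ.2.2.2 rfl) (hψ.2.2.2 rfl)
  have hbar := bar_unbar (B := B) (deg := Sigma.fst) hfac β'
  have hlow : ∀ j < n + 2, unbar B Sigma.fst (weight K P) β' j = M.op j := fun j hj => by
    rw [unbar_congr _ fun w hw => hβ'lt w (hw ▸ hj), unbar_bar hfac]
  let M' : PInfAlgebra P 𝒢 :=
    { op := unbar B Sigma.fst (weight K P) β'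
      isCochain := fun j => by
        have := hm' j
        rwa [show (j : ℤ) - 1 + -1 = j - 2 by ring] at this
      relation := (innerSum_eq_zero_iff hB hm' (by rw [hbar]; exact hβ'e)).2 (by
        rw [hbar]; exact hβ'β') }
  have hM'1 : M'.op 1 = 0 := (hlow 1 (by omega)).trans hM.op_one
  -- The corestriction of the gauge automorphism; read back as operations it is the
  -- quasi-isomorphism, with identity linear part since `ψ` starts in arity at least two.
  let χ : Tens K (Σ j, Module.Basis.ofVectorSpaceIndex K (𝒢 j)) →ₗ[K]
    ((Σ j, Module.Basis.ofVectorSpaceIndex K (𝒢 j)) →₀ K) := letter + ψ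
  have hχ := bar_unbar (B := B) (deg := Sigma.fst) hfac χ
  have hc : ∀ j : ℕ, IsCochain P 𝒢 𝒢 ((j : ℤ) - 1) (unbar B Sigma.fst (weight K P) χ j) := by
    intro j
    have := isCochain_unbar hB (P := P) (p := 0) (β := χ)
      (fun c t => by
        have h1 := letter_degree (δ := fun i => i.1 + 1) c t
        have h2 := hψ.1 c t
        simp only [χ, LinearMap.add_apply, map_add, h1, h2]
        simp)
      (by simp [χ, hψ.2.1])
      (by rw [LinearMap.add_comp, letter_comp_of_isSym hsym, hψ.2.2.1])
      (fun hP u v hu hv => by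
        rw [LinearMap.add_apply, killsShuffles_letter _ u v hu hv, hψ.2.2.2 hP u v hu hv, add_zero])
      j
    rwa [add_zero] at this
  let Φ : PInfMorphism M M' :=
    { comp := unbar B Sigma.fst (weight K P) χ
      isCochain := hc
      relation := (innerSum_eq_outerSum_iff hB M.isCochain' hc).2 (by
        rw [hχ]
        change ∀ t, _ = bar B _ _ (unbar B _ _ β') _
        rw [hbar]
        exact hmor) }
  refine ⟨M', ⟨hM'1, (hlow 2 (by omega)).trans hM.op_two, fun j hj hjk => ?_⟩, Φ,
    PInfMorphism.isQuasiIso_of_comp_one hM.op_one hM'1 fun x => ?_⟩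
  · rcases Nat.lt_or_ge j (n + 2) with h | h
    · exact (hlow j h).trans (hM.op_eq_zero j hj h)
    · exact unbar_eq_zero _ fun w hw => hβ'k w (by omega)
  · have : Φ.comp 1 = MultilinearMap.ofSubsingleton K H H (0 : Fin 1) LinearMap.id :=
      Module.Basis.ext_multilinear (fun _ => B) fun w => by
        have hw : weight K P 1 = 1 := by cases P <;> simp [weight]
        refine (unbar_word (weight K P) χ w).trans ?_
        have h1 : χ (wd (List.ofFn w)) = Finsupp.single (w 0) 1 := by
          rw [List.ofFn_succ, List.ofFn_zero, LinearMap.add_apply, letter_wd_singleton,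
            suppLen_bar _ hf0 _ (by simp; omega), add_zero]
        rw [h1, hw]
        simp [decSum, sg_zero]
    rw [this]
    rfl

end Obstruction

end MinimalPInfinity

end

theorem mainTheorem6 {K : Type*} [Field K] [CharZero K] {H : Type*} [AddCommGroup H] [Module K H]
    (𝒢 : ℤ → Submodule K H) [DirectSum.Decomposition 𝒢] (P : MinimalPInfinity.OperadKind)
    (A : MinimalPInfinity.GradedAlgebra P 𝒢) (k : ℕ) (hk : 3 ≤ k)
    (M : MinimalPInfinity.PInfAlgebra P 𝒢) (hM : M.HasForm A k) :
    (MinimalPInfinity.QuasiIsomorphic M A.toPInf → A.IsCoboundary ((k : ℤ) - 2) k (M.op k)) ∧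
    (A.IsCoboundary ((k : ℤ) - 2) k (M.op k) →
      ∃ M' : MinimalPInfinity.PInfAlgebra P 𝒢,
        M'.HasForm A (k + 1) ∧ MinimalPInfinity.QuasiIsomorphic M M') :=
  ⟨MinimalPInfinity.isCoboundary_of_quasiIsomorphic A hk M hM,
    MinimalPInfinity.exists_quasiIsomorphic_of_isCoboundary A hk M hM⟩
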